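/- **Setting.** Let $\Omega=\mathbb R\times(-1,1)$, $\Omega_+=\mathbb R\times(0,1)$, $\Omega_-=\mathbb R\times(-1,0)$, with coordinates $x=(x_1,x_2)$. Let $g>0$, $\mu_\pm>0$ and $\rho_+>\rho_->0$ be constants, put $[\rho]=\rho_+-\rho_-$, and let $\rho,\mu$ denote the functions equal to $\rho_\pm,\mu_\pm$ on $\Omega_\pm$. For a function $f$ on $\Omega_+\cup\Omega_-$ let $\llbracket f\rrbracket=f_+|_{x_2=0}-f_-|_{x_2=0}$ be its jump (in the sense of traces). For a constant vector $\bar B\in\mathbb R^2$ consider the linearized system $$\partial_t\eta=v,\qquad \rho\,\partial_tv+\nabla q-\mu\Delta v-\bar B_l\bar B_m\partial_l\partial_m\eta=0,\qquad \operatorname{div}v=0\qquad\text{in }\Omega_\pm,$$ $$\llbracket v\rrbracket=0,\qquad \llbracket-\mu(Dv+Dv^T)+qI\rrbracket e_2=g[\rho]\,\eta_2e_2+\bar B_2\bar B_l\llbracket\partial_l\eta\rrbracket\quad\text{on }\{x_2=0\},\qquad v=0\ \text{ on }\{x_2=\pm1\}.$$ By a solution on $[0,T]$, $T>0$, we mean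 real-valued $(v,\eta,q)$ such that $v\in C^1([0,T];L^2(\Omega))\cap C([0,T];H^1(\Omega))$, $\eta\in C^1([0,T];L^2(\Omega))$, for every $t\in[0,T]$ the restrictions of $v(t),\eta(t)$ to $\Omega_\pm$ are in $H^2(\Omega_\pm)$, $\eta(t)\in H^1(\Omega)$, $q(t)$ has a locally integrable weak gradient in $\Omega_\pm$, $\partial_t\eta=v$ holds in $L^2(\Omega)$, and for every $t\in[0,T]$ the remaining equations hold almost everywhere and the jump and boundary conditions hold in the sense of traces. (Thus $\partial_tv(0)$ is determined by the initial data through the second equation.) The critical magnetic number $|B|_c\ge 0$ is defined by $$|B|_c^2=\sup_{0\ne\psi\in H^1_0((-1,1))}\frac{g[\rho]\,\psi(0)^2}{\int_{-1}^1|\psi'|^2\,dy}.$$ **Theorem 2.4.** Let $|B|>|B|_c$. There is a constant $C$, depending only on $g,\rho_\pm,\mu_\pm$ and $B$, such that for every $T>0$ the following holds; all norms are over $\Omega$. (i) Let $\bar B=(0,B)$. Every solution on $[0,T]$ satisfies, for all $t\in[0,T]$, $$\|\partial_tv(t)\|_{L^2}^2+\|v(t)\|_{L^2}^2+\|\partial_2v(t)\|_{L^2}^2+\int_0^t\|\partial_tv(s)\|_{H^1}^2\,ds\le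 C\big(\|\partial_tv(0)\|_{L^2}^2+\|v(0)\|_{L^2}^2+\|\partial_2v(0)\|_{L^2}^2\big).$$ If in addition $\eta(0,x_1,-1)=\eta(0,x_1,1)=0$, then for all $t\in[0,T]$ $$\|v(t)\|_{L^2}^2+\|\eta(t)\|_{L^2}^2+\|\partial_2\eta(t)\|_{L^2}^2+\int_0^t\|v(s)\|_{H^1}^2\,ds\le C\big(\|v(0)\|_{L^2}^2+\|\eta(0)\|_{L^2}^2+\|\partial_2\eta(0)\|_{L^2}^2\big).$$ (ii) Let $\bar B=(B,0)$. Every solution on $[0,T]$ satisfies, for all $t\in[0,T]$, $$\|\partial_tv(t)\|_{L^2}^2+\|\partial_1v_1(t)\|_{L^2}^2+\|v_2(t)\|_{H^1}^2+\int_0^t\|\partial_tv(s)\|_{H^1}^2\,ds\le C\big(\|\partial_tv(0)\|_{L^2}^2+\|\partial_1v_1(0)\|_{L^2}^2+\|v_2(0)\|_{H^1}^2\big).$$ If in addition $(\partial_1\eta_1+\partial_2\eta_2)(0)=0$, then for all $t\in[0,T]$ $$\|v(t)\|_{L^2}^2+\|\partial_1\eta_1(t)\|_{L^2}^2+\|\eta_2(t)\|_{H^1}^2+\int_0^t\|v(s)\|_{H^1}^2\,ds\le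 C\big(\|v(0)\|_{L^2}^2+\|\partial_1\eta_1(0)\|_{L^2}^2+\|\eta_2(0)\|_{H^1}^2\big).$$ -/

import Mathlib

open MeasureTheory Set
open scoped ContDiff ENNReal NNReal

noncomputable section

namespace RayleighTaylorMHD

/-- The horizontal strip `ℝ × (a, b)`; points are `x = (x₁, x₂)`, and the coordinate indices
`1, 2` of the mathematics are `0, 1 : Fin 2` below. -/
def strip (a b : ℝ) : Set (ℝ × ℝ) := Set.univ ×ˢ Set.Ioo a b

/-- `Ω = ℝ × (-1, 1)`. -/
def slab : Set (ℝ × ℝ) := strip (-1) 1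

/-- `Ω₊ = ℝ × (0, 1)`, occupied by the upper fluid. -/
def upper : Set (ℝ × ℝ) := strip 0 1

/-- `Ω₋ = ℝ × (-1, 0)`, occupied by the lower fluid. -/
def lower : Set (ℝ × ℝ) := strip (-1) 0

/-- The Hilbert space `L²(Ω)` of real functions. -/
abbrev L2 : Type := Lp ℝ 2 (volume.restrict slab)

/-- The coordinate directions `e₁ = (1, 0)`, `e₂ = (0, 1)`. -/
def dir (j : Fin 2) : ℝ × ℝ := if j = 0 then (1, 0) else (0, 1)

/-- The classical partial derivative `∂ⱼφ` (used for test functions). -/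
def classicalPartial (j : Fin 2) (φ : ℝ × ℝ → ℝ) (x : ℝ × ℝ) : ℝ := fderiv ℝ φ x (dir j)

/-- `φ` is smooth with compact support inside `V`. -/
structure IsTest (V : Set (ℝ × ℝ)) (φ : ℝ × ℝ → ℝ) : Prop where
  smooth : ContDiff ℝ ∞ φ
  compact : HasCompactSupport φ
  support : tsupport φ ⊆ V

/-- `g` is the weak partial derivative `∂ⱼf` on the open set `U`. -/
def HasWeakPartial (U : Set (ℝ × ℝ)) (j : Fin 2) (f g : ℝ × ℝ → ℝ) : Prop :=
  LocallyIntegrableOn f U ∧ LocallyIntegrableOn g U ∧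
    ∀ φ, IsTest U φ → ∫ x in U, f x * classicalPartial j φ x = -∫ x in U, g x * φ x

open Classical in
/-- The weak partial derivative `∂ⱼf` on `U`, which is unique almost everywhere in `U`
(and is used only where it exists). -/
def weakPartial (U : Set (ℝ × ℝ)) (j : Fin 2) (f : ℝ × ℝ → ℝ) : ℝ × ℝ → ℝ :=
  if h : ∃ g, HasWeakPartial U j f g then h.choose else 0

/-- `f ∈ H¹(U)`. -/
def MemH1 (U : Set (ℝ × ℝ)) (f : ℝ × ℝ → ℝ) : Prop :=
  MemLp f 2 (volume.restrict U) ∧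
    ∀ j, ∃ g, HasWeakPartial U j f g ∧ MemLp g 2 (volume.restrict U)

/-- `f ∈ H²(U)`. -/
def MemH2 (U : Set (ℝ × ℝ)) (f : ℝ × ℝ → ℝ) : Prop :=
  MemH1 U f ∧ ∀ j, MemH1 U (weakPartial U j f)

/-- `τ` is the trace on the lower side `{x₂ = a}` of the function `f` on the strip `ℝ × (a, b)`:
`f` and `∂₂f` are integrable up to the boundary, locally in `x₁`, and Green's formula with boundary
values `τ` holds against smooth functions that vanish near the upper side. -/
def HasLowerTrace (a b : ℝ) (f : ℝ × ℝ → ℝ) (τ : ℝ → ℝ) : Prop :=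
  LocallyIntegrable τ ∧ LocallyIntegrable f (volume.restrict (strip a b)) ∧
    ∃ g, HasWeakPartial (strip a b) 1 f g ∧ LocallyIntegrable g (volume.restrict (strip a b)) ∧
      ∀ φ, IsTest (Set.univ ×ˢ Set.Iio b) φ →
        ∫ x in strip a b, (f x * classicalPartial 1 φ x + g x * φ x) = -∫ s, τ s * φ (s, a)

/-- `τ` is the trace on the upper side `{x₂ = b}` of the function `f` on the strip `ℝ × (a, b)`. -/
def HasUpperTrace (a b : ℝ) (f : ℝ × ℝ → ℝ) (τ : ℝ → ℝ) : Prop :=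
  LocallyIntegrable τ ∧ LocallyIntegrable f (volume.restrict (strip a b)) ∧
    ∃ g, HasWeakPartial (strip a b) 1 f g ∧ LocallyIntegrable g (volume.restrict (strip a b)) ∧
      ∀ φ, IsTest (Set.univ ×ˢ Set.Ioi a) φ →
        ∫ x in strip a b, (f x * classicalPartial 1 φ x + g x * φ x) = ∫ s, τ s * φ (s, b)

/-- The interfacial jump: `J = f₊|_{x₂=0} - f₋|_{x₂=0}` almost everywhere on the interface, where
`f₊` is a function on `Ω₊` and `f₋` a function on `Ω₋`, both having a trace. -/
def HasJump (fp fm : ℝ × ℝ → ℝ) (J : ℝ → ℝ) : Prop :=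
  ∃ τp τm : ℝ → ℝ, HasLowerTrace 0 1 fp τp ∧ HasUpperTrace (-1) 0 fm τm ∧
    ∀ᵐ s : ℝ, J s = τp s - τm s

/-- The physical coefficients: gravity, the densities and the viscosities of the upper (`p`) and the
lower (`m`) fluid; all are positive and the upper fluid is the heavier one. -/
structure Coeffs where
  g : ℝ
  ρp : ℝ
  ρm : ℝ
  μp : ℝ
  μm : ℝ
  g_pos : 0 < g
  ρm_pos : 0 < ρm
  ρm_lt_ρp : ρm < ρp
  μp_pos : 0 < μp
  μm_pos : 0 < μm

/-- `g [ρ] = g (ρ₊ - ρ₋)`. -/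
def Coeffs.gJump (c : Coeffs) : ℝ := c.g * (c.ρp - c.ρm)

/-- `ψ ∈ H₀¹((-1, 1))` with weak derivative `dψ`: `ψ` is the primitive of a square integrable
function and vanishes at both end points. -/
structure IsH10 (ψ dψ : ℝ → ℝ) : Prop where
  memLp : MemLp dψ 2 (volume.restrict (Set.Ioo (-1) 1))
  primitive : ∀ y ∈ Set.Icc (-1 : ℝ) 1, ψ y = ∫ z in (-1 : ℝ)..y, dψ z
  right_end : ψ 1 = 0

/-- The critical magnetic number `|B|_c`, with
`|B|_c² = sup { g[ρ] ψ(0)² / ∫_{-1}^1 |ψ'|² : 0 ≠ ψ ∈ H₀¹((-1, 1)) }`. -/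
def criticalNumber (c : Coeffs) : ℝ :=
  Real.sqrt (sSup {r : ℝ | ∃ ψ dψ : ℝ → ℝ, IsH10 ψ dψ ∧
    (∃ y ∈ Set.Icc (-1 : ℝ) 1, ψ y ≠ 0) ∧
    r = c.gJump * ψ 0 ^ 2 / ∫ y in (-1 : ℝ)..1, dψ y ^ 2})

/-- The momentum equation
`ρ ∂ₜv + ∇q - μ Δv - B̄ₗ B̄ₘ ∂ₗ∂ₘ η = 0` almost everywhere in the phase `U` with constants `ρ, μ`. -/
def Momentum (U : Set (ℝ × ℝ)) (ρ μ : ℝ) (B : Fin 2 → ℝ) (vt v η : Fin 2 → ℝ × ℝ → ℝ)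
    (q : ℝ × ℝ → ℝ) : Prop :=
  ∀ i, ∀ᵐ x ∂(volume.restrict U),
    ρ * vt i x + weakPartial U i q x
      - μ * ∑ j, weakPartial U j (weakPartial U j (v i)) x
      - ∑ l, ∑ m, B l * B m * weakPartial U l (weakPartial U m (η i)) x = 0

/-- The `i`-th component of `(-μ (Dv + Dvᵀ) + q I) e₂` in the phase `U`. -/
def normalStress (U : Set (ℝ × ℝ)) (μ : ℝ) (v : Fin 2 → ℝ × ℝ → ℝ) (q : ℝ × ℝ → ℝ) (i : Fin 2) :
    ℝ × ℝ → ℝ :=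
  fun x => -μ * (weakPartial U 1 (v i) x + weakPartial U i (v 1) x) + (if i = 1 then q x else 0)

/-- The stress jump condition on the interface,
`⟦-μ (Dv + Dvᵀ) + q I⟧ e₂ = g[ρ] η₂ e₂ + B̄₂ B̄ₗ ⟦∂ₗη⟧`. -/
def StressJump (c : Coeffs) (B : Fin 2 → ℝ) (v η : Fin 2 → ℝ × ℝ → ℝ) (q : ℝ × ℝ → ℝ) : Prop :=
  ∃ e : ℝ → ℝ, HasLowerTrace 0 1 (η 1) e ∧
    ∀ i, ∃ J : Fin 2 → ℝ → ℝ,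
      (∀ l, HasJump (weakPartial upper l (η i)) (weakPartial lower l (η i)) (J l)) ∧
      HasJump (normalStress upper c.μp v q i) (normalStress lower c.μm v q i)
        (fun s => (if i = 1 then c.gJump * e s else 0) + B 1 * ∑ l, B l * J l s)

/-- The linearized system on `Ω` and the time interval `[0, T]`, with constant magnetic vector `B`,
for the velocity `v`, its time derivative `vt`, the (linearized) flow map `η` and the
pressure `q`. At all times `v` and `η` belong to `H¹(Ω)` and to `H²(Ω₊)`, `H²(Ω₋)`; the pressure has
weak gradients in `Ω₊` and in `Ω₋`, and no decay of `q` is asked for; in time,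
`v ∈ C¹([0, T]; L²(Ω)) ∩ C([0, T]; H¹(Ω))` and `η ∈ C¹([0, T]; L²(Ω))`. -/
structure IsSolution (c : Coeffs) (B : Fin 2 → ℝ) (T : ℝ) (v vt η : ℝ → Fin 2 → L2)
    (q : ℝ → ℝ × ℝ → ℝ) : Prop where
  /-- `vt = ∂ₜv` in `L²(Ω)` (one-sided at the ends), and it is continuous in time -/
  deriv_v : ∀ i, ∀ t ∈ Set.Icc 0 T,
    HasDerivWithinAt (fun s => v s i) (vt t i) (Set.Icc 0 T) t
  cont_vt : ∀ i, ContinuousOn (fun s => vt s i) (Set.Icc 0 T)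
  /-- `∂ₜη = v` -/
  deriv_η : ∀ i, ∀ t ∈ Set.Icc 0 T,
    HasDerivWithinAt (fun s => η s i) (v t i) (Set.Icc 0 T) t
  /-- `v ∈ C([0, T]; H¹(Ω))` -/
  grad_v : ∀ i j, ∃ D : ℝ → L2, ContinuousOn D (Set.Icc 0 T) ∧
    ∀ t ∈ Set.Icc 0 T, HasWeakPartial slab j (v t i) (D t)
  η_H1 : ∀ i, ∀ t ∈ Set.Icc 0 T, MemH1 slab (η t i)
  v_H2 : ∀ i, ∀ t ∈ Set.Icc 0 T, MemH2 upper (v t i) ∧ MemH2 lower (v t i)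
  η_H2 : ∀ i, ∀ t ∈ Set.Icc 0 T, MemH2 upper (η t i) ∧ MemH2 lower (η t i)
  grad_q : ∀ j, ∀ t ∈ Set.Icc 0 T,
    (∃ G, HasWeakPartial upper j (q t) G) ∧ (∃ G, HasWeakPartial lower j (q t) G)
  momentum : ∀ t ∈ Set.Icc 0 T,
    Momentum upper c.ρp c.μp B (fun i => vt t i) (fun i => v t i) (fun i => η t i) (q t) ∧
    Momentum lower c.ρm c.μm B (fun i => vt t i) (fun i => v t i) (fun i => η t i) (q t)
  /-- `div v = 0` -/
  div_v : ∀ t ∈ Set.Icc 0 T, ∀ᵐ x ∂(volume.restrict slab),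
    weakPartial slab 0 (v t 0) x + weakPartial slab 1 (v t 1) x = 0
  /-- `⟦v⟧ = 0` -/
  jump_v : ∀ i, ∀ t ∈ Set.Icc 0 T, HasJump (v t i) (v t i) 0
  jump_stress : ∀ t ∈ Set.Icc 0 T,
    StressJump c B (fun i => v t i) (fun i => η t i) (q t)
  /-- no slip at `x₂ = -1` and at `x₂ = 1` -/
  no_slip : ∀ i, ∀ t ∈ Set.Icc 0 T,
    HasLowerTrace (-1) 1 (v t i) 0 ∧ HasUpperTrace (-1) 1 (v t i) 0

/-- `‖f‖²_{L²(Ω)}`. -/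
def l2Sq (f : ℝ × ℝ → ℝ) : ℝ≥0∞ := eLpNorm f 2 (volume.restrict slab) ^ 2

open Classical in
/-- `‖∂ⱼf‖²_{L²(Ω)}`, infinite if `f` has no weak derivative `∂ⱼf` on `Ω`. -/
def partialSq (j : Fin 2) (f : ℝ × ℝ → ℝ) : ℝ≥0∞ :=
  if ∃ g, HasWeakPartial slab j f g then l2Sq (weakPartial slab j f) else ⊤

/-- `‖f‖²_{H¹(Ω)} = ‖f‖²_{L²} + ‖∂₁f‖²_{L²} + ‖∂₂f‖²_{L²}`, infinite if `f ∉ H¹(Ω)`. -/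
def h1Sq (f : ℝ × ℝ → ℝ) : ℝ≥0∞ := l2Sq f + ∑ j, partialSq j f

/-- The quantity `‖w‖²_{L²} + ‖u‖²_{L²} + ‖∂₂u‖²_{L²}` for vector fields `w, u`. -/
def verticalEnergy (w u : Fin 2 → L2) : ℝ≥0∞ :=
  ∑ i, l2Sq (w i) + ∑ i, l2Sq (u i) + ∑ i, partialSq 1 (u i)

/-- The quantity `‖w‖²_{L²} + ‖∂₁u₁‖²_{L²} + ‖u₂‖²_{H¹}` for vector fields `w, u`. -/
def horizontalEnergy (w u : Fin 2 → L2) : ℝ≥0∞ :=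
  ∑ i, l2Sq (w i) + partialSq 0 (u 0) + h1Sq (u 1)

/-- `∫₀ᵗ ‖w(s)‖²_{H¹(Ω)} ds` for a time dependent vector field `w`. -/
def dissipation (w : ℝ → Fin 2 → L2) (t : ℝ) : ℝ≥0∞ :=
  ∫⁻ s in Set.Icc 0 t, ∑ i, h1Sq (w s i)

end RayleighTaylorMHD

end

open MeasureTheory Set Filter Topology
open scoped ContDiff ENNReal NNReal Convolution

noncomputable section

namespace RayleighTaylorMHD

/-! ### Strips -/

/-! Tested with divergence free fields vanishing on the sides of the slab, the linearized system
becomes I(∂ₜv, w) + D(v, w) + P(η, w) = 0. Here I is the inertia form, D the viscous form, and P(u,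
w) = ∫ (B·∇u)·(B·∇w) - g[ρ] ∫ u₂w₂ dx₁, the last integral being over the interface. The form P is
symmetric and η is the time integral of v. Testing with w = v therefore gives the energy identity:
I(v, v)/2 + P(η, η)/2 plus the time integral of D(v, v) is constant in time.

The magnetic threshold makes P coercive. A function ψ vanishing at ±1 satisfies ψ(0)² ≤ (1/2)∫|ψ'|²,
and the tent function attains equality; the tent alone shows |B|_c² ≥ g[ρ]/2, so B² > g[ρ]/2
(`half_gJump_lt_sq`). Hence the gravity term costs at most (g[ρ]/2)‖∂₂u₂‖². For vertical B the
magnetic term is B²‖∂₂u‖². For horizontal B it is B²‖∂₁u‖², which also controls ∂₂u₂ because div u =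
0. A Poincaré inequality in x₂ supplies the remaining norms (`isEnergy_vertSq`, `isEnergy_horSq`). A
Korn inequality, exact for divergence free fields with zero boundary values, makes D control the
full H¹ norm (`korn`).

Coercivity holds only on divergence free fields with zero boundary values. The increment η(t) - η(0)
always lies in that closed space, being an integral of velocities (`IsEvolution.sub_mem`). Expanding
P(η(t), η(t)) around η(0), P(η(0), η(0)) cancels in the energy identity and the cross term is
absorbed by Young's inequality (`IsEvolution.estimate`). This bounds v and η. The bound for ∂ₜv and
v is the same estimate for time difference quotients, which solve the same linear system. Their
energies converge strongly and their dissipation passes to the limit by weak lower semicontinuity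
and Fatou's lemma (`IsEvolution.estimate_deriv`).

Two facts justify the testing. First, the pressure has no decay at infinity, so the weak form is
derived only for curls of compactly supported stream functions (`phase_identity`, `weak_form`).
Every term is continuous in the H¹ norm of the test field, so the identity extends to the closure of
these curls. Second, the velocity lies in this closure (`mem_solenoidal`): it is extended by zero,
mollified and dilated away from the walls; the result has a stream function, which is cut off
horizontally. -/

lemma isOpen_strip (a b : ℝ) : IsOpen (strip a b) := isOpen_univ.prod isOpen_Ioo

lemma measurableSet_strip (a b : ℝ) : MeasurableSet (strip a b) := (isOpen_strip a b).measurableSet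

lemma mem_strip {a b : ℝ} {x : ℝ × ℝ} : x ∈ strip a b ↔ a < x.2 ∧ x.2 < b := by
  simp [strip]

lemma upper_subset_slab : upper ⊆ slab := fun x hx => by
  have := mem_strip.1 hx
  exact mem_strip.2 ⟨by linarith, by linarith⟩

lemma lower_subset_slab : lower ⊆ slab := fun x hx => by
  have := mem_strip.1 hx
  exact mem_strip.2 ⟨by linarith, by linarith⟩

lemma measurableSet_slab : MeasurableSet slab := measurableSet_strip _ _

/-! ### Test functions -/

lemma IsTest.mono {U V : Set (ℝ × ℝ)} {φ : ℝ × ℝ → ℝ} (h : IsTest U φ) (hUV : U ⊆ V) :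
    IsTest V φ := ⟨h.smooth, h.compact, h.support.trans hUV⟩

lemma classicalPartial_smooth {φ : ℝ × ℝ → ℝ} (h : ContDiff ℝ ∞ φ) (j : Fin 2) :
    ContDiff ℝ ∞ (classicalPartial j φ) := by
  unfold classicalPartial
  exact (h.fderiv_right (m := ∞) (by simp)).clm_apply contDiff_const

lemma tsupport_classicalPartial_subset (φ : ℝ × ℝ → ℝ) (j : Fin 2) :
    tsupport (classicalPartial j φ) ⊆ tsupport φ := by
  unfold classicalPartial
  exact tsupport_fderiv_apply_subset ℝ _

lemma IsTest.partial {U : Set (ℝ × ℝ)} {φ : ℝ × ℝ → ℝ} (h : IsTest U φ) (j : Fin 2) :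
    IsTest U (classicalPartial j φ) where
  smooth := classicalPartial_smooth h.smooth j
  compact := h.compact.of_isClosed_subset (isClosed_tsupport _)
    (tsupport_classicalPartial_subset φ j)
  support := (tsupport_classicalPartial_subset φ j).trans h.support

lemma IsTest.neg {U : Set (ℝ × ℝ)} {φ : ℝ × ℝ → ℝ} (h : IsTest U φ) :
    IsTest U (fun x => -φ x) := by
  refine ⟨h.smooth.neg, h.compact.neg, ?_⟩
  have : tsupport (fun x => -φ x) = tsupport φ := by
    simp [tsupport]
  rw [this]; exact h.support

lemma IsTest.add {U : Set (ℝ × ℝ)} {φ ψ : ℝ × ℝ → ℝ} (h : IsTest U φ) (h' : IsTest U ψ) :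
    IsTest U (fun x => φ x + ψ x) :=
  ⟨h.smooth.add h'.smooth, h.compact.add h'.compact,
    (tsupport_add φ ψ).trans (union_subset h.support h'.support)⟩

lemma IsTest.const_mul {U : Set (ℝ × ℝ)} {φ : ℝ × ℝ → ℝ} (h : IsTest U φ) (c : ℝ) :
    IsTest U (fun x => c * φ x) :=
  ⟨contDiff_const.mul h.smooth, h.compact.mul_left,
    (tsupport_mul_subset_right (f := fun _ => c) (g := φ)).trans h.support⟩

lemma isTest_zero (U : Set (ℝ × ℝ)) : IsTest U (fun _ => 0) := by
  refine ⟨contDiff_const, ?_, ?_⟩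
  · exact HasCompactSupport.zero
  · have : tsupport (fun _ : ℝ × ℝ => (0 : ℝ)) = ∅ := by
      rw [tsupport_eq_empty_iff]; rfl
    rw [this]; exact empty_subset _

lemma IsTest.mul_left {U V : Set (ℝ × ℝ)} {χ φ : ℝ × ℝ → ℝ} (h : IsTest U φ)
    (hχ : ContDiff ℝ ∞ χ) (hV : U ∩ tsupport χ ⊆ V) : IsTest V (fun x => χ x * φ x) := by
  refine ⟨hχ.mul h.smooth, h.compact.mul_left, fun x hx => hV ⟨?_, ?_⟩⟩
  · exact h.support (tsupport_mul_subset_right (f := χ) (g := φ) hx)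
  · exact tsupport_mul_subset_left (f := χ) (g := φ) hx

lemma classicalPartial_comm {φ : ℝ × ℝ → ℝ} (h : ContDiff ℝ ∞ φ) (i j : Fin 2) (x : ℝ × ℝ) :
    classicalPartial i (classicalPartial j φ) x = classicalPartial j (classicalPartial i φ) x := by
  have hd : Differentiable ℝ (fderiv ℝ φ) :=
    (h.fderiv_right (m := ∞) (by simp)).differentiable (by simp)
  have key : ∀ i j, classicalPartial i (classicalPartial j φ) x
      = fderiv ℝ (fderiv ℝ φ) x (dir i) (dir j) := by
    intro i j
    have : fderiv ℝ (fun y => fderiv ℝ φ y (dir j)) x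
        = (fderiv ℝ (fderiv ℝ φ) x).flip (dir j) := by
      rw [fderiv_clm_apply (hd x) (differentiableAt_const _)]
      simp
    simp only [classicalPartial]
    change fderiv ℝ (fun y => fderiv ℝ φ y (dir j)) x (dir i) = _
    rw [this]; rfl
  rw [key, key]
  have hs : IsSymmSndFDerivAt ℝ φ x :=
    h.contDiffAt.isSymmSndFDerivAt (by
      rw [minSmoothness_of_isRCLikeNormedField]
      exact WithTop.coe_le_coe.2 (le_top : (2 : ℕ∞) ≤ ⊤))
  exact hs.eq _ _

lemma classicalPartial_mul {f g : ℝ × ℝ → ℝ} {x : ℝ × ℝ} (hf : DifferentiableAt ℝ f x)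
    (hg : DifferentiableAt ℝ g x) (j : Fin 2) :
    classicalPartial j (fun y => f y * g y) x
      = f x * classicalPartial j g x + classicalPartial j f x * g x := by
  simp only [classicalPartial]
  rw [fderiv_fun_mul hf hg]
  simp [mul_comm]

lemma classicalPartial_add {f g : ℝ × ℝ → ℝ} {x : ℝ × ℝ} (hf : DifferentiableAt ℝ f x)
    (hg : DifferentiableAt ℝ g x) (j : Fin 2) :
    classicalPartial j (fun y => f y + g y) x
      = classicalPartial j f x + classicalPartial j g x := by
  simp only [classicalPartial]
  rw [fderiv_fun_add hf hg]
  simp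

lemma classicalPartial_neg (f : ℝ × ℝ → ℝ) (x : ℝ × ℝ) (j : Fin 2) :
    classicalPartial j (fun y => -f y) x = -classicalPartial j f x := by
  simp only [classicalPartial]
  rw [fderiv_fun_neg]
  simp

lemma classicalPartial_const_mul (c : ℝ) {f : ℝ × ℝ → ℝ} {x : ℝ × ℝ}
    (hf : DifferentiableAt ℝ f x) (j : Fin 2) :
    classicalPartial j (fun y => c * f y) x = c * classicalPartial j f x := by
  simp only [classicalPartial]
  rw [fderiv_const_mul hf]
  simp

/-- A function of the second variable only. -/
lemma classicalPartial_snd {χ : ℝ → ℝ} (hχ : Differentiable ℝ χ) (x : ℝ × ℝ) (j : Fin 2) :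
    classicalPartial j (fun y => χ y.2) x = if j = 0 then 0 else deriv χ x.2 := by
  have h : HasFDerivAt (fun y : ℝ × ℝ => χ y.2)
      ((ContinuousLinearMap.toSpanSingleton ℝ (deriv χ x.2)).comp
        (ContinuousLinearMap.snd ℝ ℝ ℝ)) x :=
    (hχ x.2).hasDerivAt.hasFDerivAt.comp x hasFDerivAt_snd
  simp only [classicalPartial, h.fderiv]
  fin_cases j <;> simp [dir]

/-- A function of the first variable only. -/
lemma classicalPartial_fst {χ : ℝ → ℝ} (hχ : Differentiable ℝ χ) (x : ℝ × ℝ) (j : Fin 2) :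
    classicalPartial j (fun y => χ y.1) x = if j = 0 then deriv χ x.1 else 0 := by
  have h : HasFDerivAt (fun y : ℝ × ℝ => χ y.1)
      ((ContinuousLinearMap.toSpanSingleton ℝ (deriv χ x.1)).comp
        (ContinuousLinearMap.fst ℝ ℝ ℝ)) x :=
    (hχ x.1).hasDerivAt.hasFDerivAt.comp x hasFDerivAt_fst
  simp only [classicalPartial, h.fderiv]
  fin_cases j <;> simp [dir]

/-! ### Integrability against test functions -/

lemma IsTest.integrable_mul {V : Set (ℝ × ℝ)} {φ : ℝ × ℝ → ℝ} (h : IsTest V φ)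
    {μ : Measure (ℝ × ℝ)} {f : ℝ × ℝ → ℝ} (hf : LocallyIntegrable f μ) :
    Integrable (fun x => f x * φ x) μ := by
  have := hf.integrable_smul_left_of_hasCompactSupport h.smooth.continuous h.compact
  simpa [mul_comm] using this

lemma IsTest.integrable_mul_on {U : Set (ℝ × ℝ)} {φ : ℝ × ℝ → ℝ} (h : IsTest U φ)
    {f : ℝ × ℝ → ℝ} (hf : LocallyIntegrableOn f U) :
    IntegrableOn (fun x => f x * φ x) U := by
  have h1 : IntegrableOn (fun x => f x * φ x) (tsupport φ) :=
    (hf.integrableOn_compact_subset h.support h.compact).mul_continuousOn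
      h.smooth.continuous.continuousOn h.compact
  have h2 : IntegrableOn (fun x => f x * φ x) univ :=
    h1.of_forall_sdiff_eq_zero MeasurableSet.univ (fun x hx => by
      rw [image_eq_zero_of_notMem_tsupport hx.2, mul_zero])
  exact h2.mono_set (subset_univ _)

lemma IsTest.memLp {V : Set (ℝ × ℝ)} {φ : ℝ × ℝ → ℝ} (h : IsTest V φ) (p : ℝ≥0∞)
    (μ : Measure (ℝ × ℝ)) [IsFiniteMeasureOnCompacts μ] : MemLp φ p μ :=
  h.smooth.continuous.memLp_of_hasCompactSupport h.compact

lemma locallyIntegrable_of_memLp {f : ℝ × ℝ → ℝ} {U : Set (ℝ × ℝ)}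
    (hf : MemLp f 2 (volume.restrict U)) : LocallyIntegrable f (volume.restrict U) :=
  hf.locallyIntegrable (by norm_num)

lemma locallyIntegrableOn_of_restrict {f : ℝ × ℝ → ℝ} {U : Set (ℝ × ℝ)} (hU : IsOpen U)
    (hf : LocallyIntegrable f (volume.restrict U)) : LocallyIntegrableOn f U := by
  rw [locallyIntegrableOn_iff hU.isLocallyClosed]
  intro k hkU hk
  have := hf.integrableOn_isCompact hk
  rwa [IntegrableOn, Measure.restrict_restrict hk.measurableSet,
    inter_eq_left.2 hkU] at this

/-! ### Weak derivatives -/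

lemma HasWeakPartial.unique {U : Set (ℝ × ℝ)} (hU : IsOpen U) {j : Fin 2}
    {f g g' : ℝ × ℝ → ℝ} (h : HasWeakPartial U j f g) (h' : HasWeakPartial U j f g') :
    g =ᵐ[volume.restrict U] g' := by
  have hl : LocallyIntegrableOn (fun x => g x - g' x) U := h.2.1.sub h'.2.1
  have := hU.ae_eq_zero_of_integral_contDiff_smul_eq_zero hl (fun φ h1 h2 h3 => by
    have ht : IsTest U φ := ⟨h1, h2, h3⟩
    have e1 := h.2.2 φ ht
    have e2 := h'.2.2 φ ht
    have i1 := ht.integrable_mul_on h.2.1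
    have i2 := ht.integrable_mul_on h'.2.1
    have e3 : ∫ x in U, (g x * φ x - g' x * φ x) = 0 := by
      rw [integral_sub i1 i2]; linarith
    rw [← e3, ← setIntegral_eq_integral_of_forall_compl_eq_zero (s := U)]
    · congr 1; ext x; simp; ring
    · intro x hx
      rw [image_eq_zero_of_notMem_tsupport (fun hx' => hx (h3 hx')), zero_smul])
  rw [EventuallyEq, ae_restrict_iff' hU.measurableSet]
  filter_upwards [this] with x hx hxU
  have := hx hxU; linarith

lemma HasWeakPartial.congr {U : Set (ℝ × ℝ)} {j : Fin 2}
    {f f' g g' : ℝ × ℝ → ℝ} (h : HasWeakPartial U j f g)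
    (hf : f =ᵐ[volume.restrict U] f') (hg : g =ᵐ[volume.restrict U] g') :
    HasWeakPartial U j f' g' := by
  have aux : ∀ {u u' : ℝ × ℝ → ℝ}, LocallyIntegrableOn u U → u =ᵐ[volume.restrict U] u' →
      LocallyIntegrableOn u' U := by
    intro u u' hu huu' x hx
    obtain ⟨s, hs, hi⟩ := hu x hx
    refine ⟨s ∩ U, inter_mem hs self_mem_nhdsWithin, ?_⟩
    exact (hi.mono_set inter_subset_left).congr
      (ae_mono (Measure.restrict_mono inter_subset_right le_rfl) huu')
  refine ⟨aux h.1 hf, aux h.2.1 hg, fun φ hφ => ?_⟩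
  have e1 : ∫ x in U, f' x * classicalPartial j φ x = ∫ x in U, f x * classicalPartial j φ x :=
    integral_congr_ae (by filter_upwards [hf] with x hx; rw [hx])
  have e2 : ∫ x in U, g' x * φ x = ∫ x in U, g x * φ x :=
    integral_congr_ae (by filter_upwards [hg] with x hx; rw [hx])
  rw [e1, e2, h.2.2 φ hφ]

lemma HasWeakPartial.mono {U V : Set (ℝ × ℝ)} (hVU : V ⊆ U)
    (hU : MeasurableSet U) {j : Fin 2}
    {f g : ℝ × ℝ → ℝ} (h : HasWeakPartial U j f g) : HasWeakPartial V j f g := by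
  refine ⟨h.1.mono_set hVU, h.2.1.mono_set hVU, fun φ hφ => ?_⟩
  have e := h.2.2 φ (hφ.mono hVU)
  have hz : ∀ (u : ℝ × ℝ → ℝ) (χ : ℝ × ℝ → ℝ), IsTest V χ →
      ∫ x in V, u x * χ x = ∫ x in U, u x * χ x := by
    intro u χ hχ
    refine (setIntegral_eq_of_subset_of_forall_sdiff_eq_zero hU hVU fun x hx => ?_).symm
    rw [image_eq_zero_of_notMem_tsupport (fun hx' => hx.2 (hχ.support hx')), mul_zero]
  rw [hz f _ (hφ.partial j), hz g _ hφ, e]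

lemma HasWeakPartial.spec {U : Set (ℝ × ℝ)} {j : Fin 2} {f g : ℝ × ℝ → ℝ}
    (h : HasWeakPartial U j f g) : HasWeakPartial U j f (weakPartial U j f) := by
  have hex : ∃ g, HasWeakPartial U j f g := ⟨g, h⟩
  unfold weakPartial
  rw [dif_pos hex]
  exact hex.choose_spec

lemma HasWeakPartial.weakPartial_ae {U : Set (ℝ × ℝ)} (hU : IsOpen U) {j : Fin 2}
    {f g : ℝ × ℝ → ℝ} (h : HasWeakPartial U j f g) :
    weakPartial U j f =ᵐ[volume.restrict U] g := h.spec.unique hU h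

lemma MemH1.hasWeakPartial {U : Set (ℝ × ℝ)} {f : ℝ × ℝ → ℝ} (h : MemH1 U f) (j : Fin 2) :
    HasWeakPartial U j f (weakPartial U j f) := by
  obtain ⟨g, hg, -⟩ := h.2 j
  exact hg.spec

lemma MemH1.memLp_weakPartial {U : Set (ℝ × ℝ)} (hU : IsOpen U) {f : ℝ × ℝ → ℝ}
    (h : MemH1 U f) (j : Fin 2) : MemLp (weakPartial U j f) 2 (volume.restrict U) := by
  obtain ⟨g, hg, hg2⟩ := h.2 j
  exact (memLp_congr_ae (hg.weakPartial_ae hU)).2 hg2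

lemma HasWeakPartial.neg {U : Set (ℝ × ℝ)} {j : Fin 2} {f g : ℝ × ℝ → ℝ}
    (h : HasWeakPartial U j f g) : HasWeakPartial U j (fun x => -f x) (fun x => -g x) := by
  refine ⟨h.1.neg, h.2.1.neg, fun φ hφ => ?_⟩
  simp only [neg_mul, integral_neg, h.2.2 φ hφ]

lemma HasWeakPartial.add {U : Set (ℝ × ℝ)} {j : Fin 2}
    {f g f' g' : ℝ × ℝ → ℝ}
    (h : HasWeakPartial U j f g) (h' : HasWeakPartial U j f' g') :
    HasWeakPartial U j (fun x => f x + f' x) (fun x => g x + g' x) := by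
  refine ⟨h.1.add h'.1, h.2.1.add h'.2.1, fun φ hφ => ?_⟩
  simp only [add_mul]
  rw [integral_add ((hφ.partial j).integrable_mul_on h.1)
      ((hφ.partial j).integrable_mul_on h'.1),
    integral_add (hφ.integrable_mul_on h.2.1) (hφ.integrable_mul_on h'.2.1),
    h.2.2 φ hφ, h'.2.2 φ hφ]
  ring

lemma HasWeakPartial.const_mul {U : Set (ℝ × ℝ)} (c : ℝ) {j : Fin 2} {f g : ℝ × ℝ → ℝ}
    (h : HasWeakPartial U j f g) : HasWeakPartial U j (fun x => c * f x) (fun x => c * g x) := by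
  refine ⟨?_, ?_, fun φ hφ => ?_⟩
  · exact h.1.smul c
  · exact h.2.1.smul c
  · simp only [mul_assoc, integral_const_mul, h.2.2 φ hφ]
    ring

/-- Mixed weak derivatives commute. -/
lemma HasWeakPartial.comm {U : Set (ℝ × ℝ)} {i j : Fin 2} {f fi fj g : ℝ × ℝ → ℝ}
    (hi : HasWeakPartial U i f fi) (hj : HasWeakPartial U j f fj)
    (hg : HasWeakPartial U j fi g) : HasWeakPartial U i fj g := by
  refine ⟨hj.2.1, hg.2.1, fun φ hφ => ?_⟩
  rw [← hg.2.2 φ hφ]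
  have e1 := hi.2.2 _ (hφ.partial j)
  have e2 := hj.2.2 _ (hφ.partial i)
  have e3 : ∫ x in U, f x * classicalPartial i (classicalPartial j φ) x
      = ∫ x in U, f x * classicalPartial j (classicalPartial i φ) x := by
    simp only [classicalPartial_comm hφ.smooth i j]
  linarith

/-! ### Testing horizontal derivatives up to the horizontal boundary -/

/-- Smooth cutoff functions exhausting an open interval. -/
lemma exists_cutoff_Ioo {a b : ℝ} (hab : a < b) :
    ∃ χ : ℕ → ℝ → ℝ, (∀ n, ContDiff ℝ ∞ (χ n)) ∧ (∀ n, tsupport (χ n) ⊆ Ioo a b) ∧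
      (∀ n y, |χ n y| ≤ 1) ∧ ∀ y ∈ Ioo a b, Tendsto (fun n => χ n y) atTop (𝓝 1) := by
  set r : ℝ := (b - a) / 2 with hr
  have hr0 : 0 < r := by rw [hr]; linarith
  have hn : ∀ n : ℕ, (0 : ℝ) < 1 / ((n : ℝ) + 3) := fun n => by positivity
  have hn1 : ∀ n : ℕ, 1 / ((n : ℝ) + 3) ≤ 1 / 3 := fun n => by
    apply one_div_le_one_div_of_le <;> linarith [n.cast_nonneg (α := ℝ)]
  -- Bumps centred at the midpoint, with radii filling the half length `r` as `n` grows. The shift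
  -- by 3 keeps the inner radius positive already at `n = 0`.
  let β : ℕ → ContDiffBump ((a + b) / 2) := fun n =>
    { rIn := r * (1 - 2 * (1 / ((n : ℝ) + 3)))
      rOut := r * (1 - 1 / ((n : ℝ) + 3))
      rIn_pos := mul_pos hr0 (by linarith [hn1 n])
      rIn_lt_rOut := mul_lt_mul_of_pos_left (by linarith [hn n]) hr0 }
  refine ⟨fun n => β n, fun n => (β n).contDiff, fun n => ?_, fun n y => ?_, fun y hy => ?_⟩
  · rw [(β n).tsupport_eq]
    intro y hy
    rw [Metric.mem_closedBall, Real.dist_eq] at hy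
    have h2 : |y - (a + b) / 2| < r := by
      refine hy.trans_lt ?_
      change r * (1 - 1 / ((n : ℝ) + 3)) < r
      nlinarith [hn n]
    rw [abs_lt, hr] at h2
    constructor <;> linarith [h2.1, h2.2]
  · rw [abs_of_nonneg (β n).nonneg]; exact (β n).le_one
  · have h2 : |y - (a + b) / 2| < r := by
      rw [abs_lt, hr]; constructor <;> linarith [hy.1, hy.2]
    have hlim : Tendsto (fun n : ℕ => r * (1 - 2 * (1 / ((n : ℝ) + 3)))) atTop
        (𝓝 (r * (1 - 2 * 0))) := by
      have : Tendsto (fun n : ℕ => 1 / ((n : ℝ) + 3)) atTop (𝓝 0) := by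
        have := (tendsto_one_div_add_atTop_nhds_zero_nat (𝕜 := ℝ)).comp (tendsto_add_atTop_nat 2)
        refine this.congr fun n => ?_
        simp only [Function.comp, Nat.cast_add, Nat.cast_ofNat]
        ring_nf
      exact (tendsto_const_nhds.sub (this.const_mul 2)).const_mul r
    have hev := hlim.eventually (lt_mem_nhds (by simpa using h2))
    refine tendsto_const_nhds.congr' ?_
    filter_upwards [hev] with n hn'
    symm
    apply (β n).one_of_mem_closedBall
    rw [Metric.mem_closedBall, Real.dist_eq]
    exact hn'.le

/-- The horizontal weak derivative may be tested with functions that do not vanish on the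
boundary of the strip. -/
lemma HasWeakPartial.integral_horizontal {a b : ℝ} (hab : a < b) {f g φ : ℝ × ℝ → ℝ}
    (h : HasWeakPartial (strip a b) 0 f g)
    (hf : LocallyIntegrable f (volume.restrict (strip a b)))
    (hg : LocallyIntegrable g (volume.restrict (strip a b))) (hφ : IsTest univ φ) :
    ∫ x in strip a b, f x * classicalPartial 0 φ x = -∫ x in strip a b, g x * φ x := by
  obtain ⟨χ, hχs, hχt, hχ1, hχl⟩ := exists_cutoff_Ioo hab
  have hcd : ∀ n, ContDiff ℝ ∞ (fun x : ℝ × ℝ => χ n x.2) := fun n => (hχs n).comp contDiff_snd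
  have htest : ∀ n, IsTest (strip a b) (fun x => χ n x.2 * φ x) := fun n => by
    refine hφ.mul_left (hcd n) fun x hx => ?_
    have : x.2 ∈ tsupport (χ n) :=
      (tsupport_comp_subset_preimage (χ n) continuous_snd) hx.2
    exact ⟨mem_univ _, hχt n this⟩
  -- The cutoff depends on `x₂` only, so it commutes with `∂₁`. No derivative of the cutoff appears,
  -- and dominated convergence suffices.
  have hpart : ∀ n x, classicalPartial 0 (fun x => χ n x.2 * φ x) x
      = χ n x.2 * classicalPartial 0 φ x := fun n x => by
    rw [classicalPartial_mul ((hcd n).differentiable (by simp) x)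
      (hφ.smooth.differentiable (by simp) x),
      classicalPartial_snd ((hχs n).differentiable (by simp))]
    simp
  have key : ∀ (u θ : ℝ × ℝ → ℝ), IsTest univ θ →
      LocallyIntegrable u (volume.restrict (strip a b)) →
      Tendsto (fun n => ∫ x in strip a b, u x * (χ n x.2 * θ x)) atTop
        (𝓝 (∫ x in strip a b, u x * θ x)) := by
    intro u θ hθ hu
    have hi := hθ.integrable_mul hu
    refine tendsto_integral_of_dominated_convergence (fun x => ‖u x * θ x‖) ?_ hi.norm ?_ ?_
    · intro n
      have : (fun x : ℝ × ℝ => u x * (χ n x.2 * θ x)) = fun x => χ n x.2 * (u x * θ x) := by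
        ext x; ring
      rw [this]
      exact (hcd n).continuous.aestronglyMeasurable.mul hi.aestronglyMeasurable
    · intro n
      refine Eventually.of_forall fun x => ?_
      have : u x * (χ n x.2 * θ x) = χ n x.2 * (u x * θ x) := by ring
      rw [this, norm_mul]
      exact mul_le_of_le_one_left (norm_nonneg _) (hχ1 n x.2)
    · filter_upwards [ae_restrict_mem (measurableSet_strip a b)] with x hx
      have := hχl x.2 hx.2
      simpa using (tendsto_const_nhds (x := u x)).mul (this.mul_const (θ x))
  have l1 := key f _ (hφ.partial 0) hf
  have l2 := (key g φ hφ hg).neg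
  refine tendsto_nhds_unique l1 (l2.congr fun n => ?_)
  rw [← h.2.2 _ (htest n)]
  simp only [hpart]

/-! ### Weak form of the system for divergence free test fields -/

/-- The pairing `∫_U f g`. -/
def pair (U : Set (ℝ × ℝ)) (f g : ℝ × ℝ → ℝ) : ℝ := ∫ x in U, f x * g x

lemma pair_congr_left {U : Set (ℝ × ℝ)} {f f' : ℝ × ℝ → ℝ} (h : f =ᵐ[volume.restrict U] f')
    (g : ℝ × ℝ → ℝ) : pair U f g = pair U f' g :=
  integral_congr_ae (by filter_upwards [h] with x hx; rw [hx])

lemma pair_neg_left (U : Set (ℝ × ℝ)) (f g : ℝ × ℝ → ℝ) :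
    pair U (fun x => -f x) g = -pair U f g := by
  simp [pair, integral_neg]

lemma pair_const_mul_left (U : Set (ℝ × ℝ)) (c : ℝ) (f g : ℝ × ℝ → ℝ) :
    pair U (fun x => c * f x) g = c * pair U f g := by
  simp [pair, mul_assoc, integral_const_mul]

lemma pair_add_left {U V : Set (ℝ × ℝ)} {f f' φ : ℝ × ℝ → ℝ} (hφ : IsTest V φ)
    (hf : LocallyIntegrable f (volume.restrict U))
    (hf' : LocallyIntegrable f' (volume.restrict U)) :
    pair U (fun x => f x + f' x) φ = pair U f φ + pair U f' φ := by
  simp only [pair, add_mul]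
  exact integral_add (hφ.integrable_mul hf) (hφ.integrable_mul hf')

/-- The curl `(∂₂ψ, -∂₁ψ)` of a stream function. -/
def curl (ψ : ℝ × ℝ → ℝ) : Fin 2 → ℝ × ℝ → ℝ :=
  ![classicalPartial 1 ψ, fun x => -classicalPartial 0 ψ x]

lemma IsTest.curl {U : Set (ℝ × ℝ)} {ψ : ℝ × ℝ → ℝ} (h : IsTest U ψ) (i : Fin 2) :
    IsTest U (curl ψ i) := by
  fin_cases i
  · exact h.partial 1
  · exact (h.partial 0).neg

lemma div_curl {ψ : ℝ × ℝ → ℝ} (h : ContDiff ℝ ∞ ψ) (x : ℝ × ℝ) :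
    classicalPartial 0 (curl ψ 0) x + classicalPartial 1 (curl ψ 1) x = 0 := by
  change classicalPartial 0 (classicalPartial 1 ψ) x
    + classicalPartial 1 (fun y => -classicalPartial 0 ψ y) x = 0
  rw [classicalPartial_neg, classicalPartial_comm h]
  ring

/-- Integration by parts of the momentum equation in one phase, against a divergence free test
field that need not vanish on the horizontal boundary. -/
lemma phase_identity {a b : ℝ} (hab : a < b) {ρ μ : ℝ} {B : Fin 2 → ℝ}
    {vt v η : Fin 2 → ℝ × ℝ → ℝ} {q : ℝ × ℝ → ℝ} {S' φ : Fin 2 → ℝ × ℝ → ℝ}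
    (hvt : ∀ i, MemLp (vt i) 2 (volume.restrict (strip a b)))
    (hv : ∀ i, MemH2 (strip a b) (v i)) (hη : ∀ i, MemH2 (strip a b) (η i))
    (hq : ∀ j, ∃ G, HasWeakPartial (strip a b) j q G)
    (hmom : Momentum (strip a b) ρ μ B vt v η q)
    (hdiv : ∀ᵐ x ∂(volume.restrict (strip a b)),
      weakPartial (strip a b) 0 (v 0) x + weakPartial (strip a b) 1 (v 1) x = 0)
    (hS : LocallyIntegrable (normalStress (strip a b) μ v q 1) (volume.restrict (strip a b)))
    (hS' : ∀ i, HasWeakPartial (strip a b) 1 (normalStress (strip a b) μ v q i) (S' i))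
    (hφ : ∀ i, IsTest univ (φ i))
    (hφdiv : ∀ x, classicalPartial 0 (φ 0) x + classicalPartial 1 (φ 1) x = 0) :
    ρ * ∑ i, pair (strip a b) (vt i) (φ i)
      + μ * ∑ i, ∑ j, (pair (strip a b) (weakPartial (strip a b) j (v i)) (classicalPartial j (φ i))
          + pair (strip a b) (weakPartial (strip a b) i (v j)) (classicalPartial j (φ i)))
      + ∑ i, (pair (strip a b) (normalStress (strip a b) μ v q i) (classicalPartial 1 (φ i))
          + pair (strip a b) (S' i) (φ i))
      + ∑ i, ∑ l, ∑ m, B l * B m *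
          pair (strip a b) (weakPartial (strip a b) m (η i)) (classicalPartial l (φ i))
      - ∑ i, ∑ m, B 1 * B m *
          (pair (strip a b) (weakPartial (strip a b) m (η i)) (classicalPartial 1 (φ i))
            + pair (strip a b) (weakPartial (strip a b) 1 (weakPartial (strip a b) m (η i)))
                (φ i)) = 0 := by
  set U := strip a b with hU
  have hUo : IsOpen U := isOpen_strip a b
  -- regularity
  have lvt : ∀ i, LocallyIntegrable (vt i) (volume.restrict U) :=
    fun i => locallyIntegrable_of_memLp (hvt i)
  have lDv : ∀ i j, LocallyIntegrable (weakPartial U j (v i)) (volume.restrict U) :=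
    fun i j => locallyIntegrable_of_memLp ((hv i).1.memLp_weakPartial hUo j)
  have lD2v : ∀ i j k, LocallyIntegrable (weakPartial U k (weakPartial U j (v i)))
      (volume.restrict U) :=
    fun i j k => locallyIntegrable_of_memLp (((hv i).2 j).memLp_weakPartial hUo k)
  have lDη : ∀ i j, LocallyIntegrable (weakPartial U j (η i)) (volume.restrict U) :=
    fun i j => locallyIntegrable_of_memLp ((hη i).1.memLp_weakPartial hUo j)
  have lD2η : ∀ i j k, LocallyIntegrable (weakPartial U k (weakPartial U j (η i)))
      (volume.restrict U) :=
    fun i j k => locallyIntegrable_of_memLp (((hη i).2 j).memLp_weakPartial hUo k)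
  have wq : ∀ j, HasWeakPartial U j q (weakPartial U j q) := fun j => (hq j).choose_spec.spec
  have wDv : ∀ i j, HasWeakPartial U j (v i) (weakPartial U j (v i)) :=
    fun i j => (hv i).1.hasWeakPartial j
  have wD2v : ∀ i j k, HasWeakPartial U k (weakPartial U j (v i))
      (weakPartial U k (weakPartial U j (v i))) := fun i j k => ((hv i).2 j).hasWeakPartial k
  have wD2η : ∀ i j k, HasWeakPartial U k (weakPartial U j (η i))
      (weakPartial U k (weakPartial U j (η i))) := fun i j k => ((hη i).2 j).hasWeakPartial k
  -- A priori `∇q` is only locally integrable inside the phase. The momentum equation expresses it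
  -- through square integrable quantities, which gives integrability up to the boundary.
  have lDq : ∀ i, LocallyIntegrable (weakPartial U i q) (volume.restrict U) := by
    intro i
    have m1 : MemLp (fun x => -(ρ * vt i x) + (μ * ∑ j, weakPartial U j (weakPartial U j (v i)) x
        + ∑ l, ∑ m, B l * B m * weakPartial U l (weakPartial U m (η i)) x)) 2
        (volume.restrict U) := by
      refine ((hvt i).const_mul ρ).neg.add (MemLp.add (MemLp.const_mul ?_ μ) ?_)
      · exact memLp_finsetSum _ fun j _ => ((hv i).2 j).memLp_weakPartial hUo j
      · exact memLp_finsetSum _ fun l _ => memLp_finsetSum _ fun m _ =>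
          (((hη i).2 m).memLp_weakPartial hUo l).const_mul _
    refine (locallyIntegrable_of_memLp m1).congr ?_
    filter_upwards [hmom i] with x hx
    linarith
  -- The pressure is the second component of the normal stress plus `2μ ∂₂v₂`, and both are
  -- integrable up to the boundary.
  have lq : LocallyIntegrable q (volume.restrict U) := by
    have := hS.add ((lDv 1 1).smul (2 * μ))
    refine this.congr (Eventually.of_forall fun x => ?_)
    simp [normalStress]
    ring
  -- the momentum equation, tested
  have mom : ∀ i, ρ * pair U (vt i) (φ i) + pair U (weakPartial U i q) (φ i)
      - μ * ∑ j, pair U (weakPartial U j (weakPartial U j (v i))) (φ i)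
      - ∑ l, ∑ m, B l * B m * pair U (weakPartial U l (weakPartial U m (η i))) (φ i) = 0 := by
    intro i
    have e : ∫ x in U, (ρ * (vt i x * φ i x) + weakPartial U i q x * φ i x
        - μ * ∑ j, weakPartial U j (weakPartial U j (v i)) x * φ i x
        - ∑ l, ∑ m, B l * B m * (weakPartial U l (weakPartial U m (η i)) x * φ i x)) = 0 := by
      refine integral_eq_zero_of_ae ?_
      filter_upwards [hmom i] with x hx
      have : (ρ * vt i x + weakPartial U i q x
        - μ * ∑ j, weakPartial U j (weakPartial U j (v i)) x
        - ∑ l, ∑ m, B l * B m * weakPartial U l (weakPartial U m (η i)) x) * φ i x = 0 := by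
        rw [hx, zero_mul]
      simp only [Fin.sum_univ_two] at this ⊢
      simp only [Pi.zero_apply]
      linear_combination this
    have i1 := (hφ i).integrable_mul (lvt i)
    have i2 := (hφ i).integrable_mul (lDq i)
    have i3 := fun j => (hφ i).integrable_mul (lD2v i j j)
    have i4 := fun l m => (hφ i).integrable_mul (lD2η i m l)
    have i3' := (integrable_finsetSum Finset.univ fun j _ => i3 j).const_mul μ
    have i4' := integrable_finsetSum Finset.univ fun l _ =>
      integrable_finsetSum Finset.univ fun m _ => (i4 l m).const_mul (B l * B m)
    have i12 : Integrable (fun x => ρ * (vt i x * φ i x) + weakPartial U i q x * φ i x)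
        (volume.restrict U) := (i1.const_mul ρ).add i2
    have i123 : Integrable (fun x => ρ * (vt i x * φ i x) + weakPartial U i q x * φ i x
        - μ * ∑ j, weakPartial U j (weakPartial U j (v i)) x * φ i x)
        (volume.restrict U) := i12.sub i3'
    rw [integral_sub i123 i4', integral_sub i12 i3', integral_add (i1.const_mul ρ) i2,
      integral_const_mul, integral_const_mul, integral_finsetSum _ fun j _ => i3 j,
      integral_finsetSum _ fun l _ =>
        integrable_finsetSum Finset.univ fun m _ => (i4 l m).const_mul (B l * B m)] at e
    simp only [integral_finsetSum _ fun m _ => (i4 _ m).const_mul (B _ * B m),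
      integral_const_mul] at e
    exact e
  -- horizontal integrations by parts
  have hor : ∀ {f g : ℝ × ℝ → ℝ} (i : Fin 2), HasWeakPartial U 0 f g →
      LocallyIntegrable f (volume.restrict U) → LocallyIntegrable g (volume.restrict U) →
      pair U f (classicalPartial 0 (φ i)) = -pair U g (φ i) :=
    fun i h hf hg => h.integral_horizontal hab hf hg (hφ i)
  have h1 := fun i => hor i (wD2v i 0 0) (lDv i 0) (lD2v i 0 0)
  have h2 := fun i m => hor i (wD2η i m 0) (lDη i m) (lD2η i m 0)
  have h3 := hor 0 (wq 0) lq (lDq 0)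
  -- incompressibility
  have hd : weakPartial U 1 (v 1) =ᵐ[volume.restrict U] fun x => -weakPartial U 0 (v 0) x := by
    filter_upwards [hdiv] with x hx; linarith
  -- This and `h5` express that the divergence of `Dvᵀ` is the gradient of `div v` and so vanishes.
  -- The Laplacian in the momentum equation can then be replaced by the divergence of `Dv + Dvᵀ`,
  -- whose flux is the given stress. Only horizontal integrations by parts are used.
  have h4 : pair U (weakPartial U 1 (weakPartial U 0 (v 1))) (φ 0)
      = pair U (weakPartial U 0 (v 0)) (classicalPartial 0 (φ 0)) := by
    have := hor 0 ((wDv 1 0).comm (wDv 1 1) (wD2v 1 0 1)) (lDv 1 1) (lD2v 1 0 1)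
    rw [pair_congr_left hd, pair_neg_left] at this
    linarith
  have h5 : pair U (weakPartial U 1 (weakPartial U 1 (v 1))) (φ 1)
      = pair U (weakPartial U 1 (v 0)) (classicalPartial 0 (φ 1)) := by
    have e1 : weakPartial U 1 (weakPartial U 1 (v 1)) =ᵐ[volume.restrict U]
        fun x => -weakPartial U 1 (weakPartial U 0 (v 0)) x :=
      (wD2v 1 1 1).unique hUo ((wD2v 0 0 1).neg.congr hd.symm (ae_eq_refl _))
    have := hor 1 ((wDv 0 0).comm (wDv 0 1) (wD2v 0 0 1)) (lDv 0 1) (lD2v 0 0 1)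
    rw [pair_congr_left e1, pair_neg_left]
    linarith
  -- the normal stresses
  have s0 : S' 0 =ᵐ[volume.restrict U] fun x => -μ * (weakPartial U 1 (weakPartial U 1 (v 0)) x
      + weakPartial U 1 (weakPartial U 0 (v 1)) x) := by
    refine (hS' 0).unique hUo ?_
    refine (((wD2v 0 1 1).add (wD2v 1 0 1)).const_mul (-μ)).congr ?_ (ae_eq_refl _)
    exact Eventually.of_forall fun x => by simp [normalStress]
  have s1 : S' 1 =ᵐ[volume.restrict U] fun x =>
      -(2 * μ) * weakPartial U 1 (weakPartial U 1 (v 1)) x + weakPartial U 1 q x := by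
    refine (hS' 1).unique hUo ?_
    refine (((wD2v 1 1 1).const_mul (-(2 * μ))).add (wq 1)).congr ?_ (ae_eq_refl _)
    exact Eventually.of_forall fun x => by simp [normalStress]; ring
  have t0 : pair U (S' 0) (φ 0) = -μ * (pair U (weakPartial U 1 (weakPartial U 1 (v 0))) (φ 0)
      + pair U (weakPartial U 1 (weakPartial U 0 (v 1))) (φ 0)) := by
    rw [pair_congr_left s0, pair_const_mul_left,
      pair_add_left (hφ 0) (lD2v 0 1 1) (lD2v 1 0 1)]
  have t1 : pair U (S' 1) (φ 1)
      = -(2 * μ) * pair U (weakPartial U 1 (weakPartial U 1 (v 1))) (φ 1)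
        + pair U (weakPartial U 1 q) (φ 1) := by
    have l : LocallyIntegrable (fun x => -(2 * μ) * weakPartial U 1 (weakPartial U 1 (v 1)) x)
        (volume.restrict U) := (lD2v 1 1 1).smul (-(2 * μ))
    rw [pair_congr_left s1, pair_add_left (hφ 1) l (lDq 1), pair_const_mul_left]
  have t2 : pair U (normalStress U μ v q 0) (classicalPartial 1 (φ 0))
      = -μ * (pair U (weakPartial U 1 (v 0)) (classicalPartial 1 (φ 0))
        + pair U (weakPartial U 0 (v 1)) (classicalPartial 1 (φ 0))) := by
    rw [← pair_add_left ((hφ 0).partial 1) (lDv 0 1) (lDv 1 0), ← pair_const_mul_left]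
    exact pair_congr_left (Eventually.of_forall fun x => by simp [normalStress]) _
  have t3 : pair U (normalStress U μ v q 1) (classicalPartial 1 (φ 1))
      = -(2 * μ) * pair U (weakPartial U 1 (v 1)) (classicalPartial 1 (φ 1))
        + pair U q (classicalPartial 1 (φ 1)) := by
    have l : LocallyIntegrable (fun x => -(2 * μ) * weakPartial U 1 (v 1) x)
        (volume.restrict U) := (lDv 1 1).smul (-(2 * μ))
    rw [← pair_const_mul_left, ← pair_add_left ((hφ 1).partial 1) l lq]
    exact pair_congr_left (Eventually.of_forall fun x => by simp [normalStress]; ring) _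
  -- Since the test field is divergence free, the vertical pairing of the pressure turns into a
  -- horizontal one, which can be integrated by parts without a boundary term. In the vertical
  -- direction nothing is integrated by parts: the combinations `⟨f, ∂₂φ⟩ + ⟨∂₂f, φ⟩` are kept and
  -- later evaluated as traces.
  have t4 : pair U q (classicalPartial 1 (φ 1)) = -pair U q (classicalPartial 0 (φ 0)) := by
    simp only [pair, ← integral_neg]
    congr 1; ext x
    linear_combination q x * hφdiv x
  have m0 := mom 0
  have m1 := mom 1
  have h10 := h1 0
  have h11 := h1 1
  have h200 := h2 0 0
  have h201 := h2 0 1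
  have h210 := h2 1 0
  have h211 := h2 1 1
  simp only [Fin.sum_univ_two] at m0 m1 ⊢
  rw [t0, t1, t2, t3, t4]
  linear_combination m0 + m1 - h3 + μ * h10 + μ * h11 - μ * h4 - μ * h5 + B 0 * B 0 * h200
    + B 0 * B 1 * h201 + B 0 * B 0 * h210 + B 0 * B 1 * h211

/-- Weak derivatives in a phase and in the slab are separate choices of representatives. Uniqueness
identifies them, so the two phases can be added. -/
lemma pair_congr_restrict {U V : Set (ℝ × ℝ)} (hU : IsOpen U) (hUV : U ⊆ V) (hV : MeasurableSet V)
    {j : Fin 2} {f g : ℝ × ℝ → ℝ} (h : HasWeakPartial V j f g) (φ : ℝ × ℝ → ℝ) :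
    pair U (weakPartial U j f) φ = pair U g φ :=
  pair_congr_left ((h.mono hUV hV).weakPartial_ae hU) φ

/-- The weak form of the linearized system at a fixed time, tested with `curl ψ`. The interfacial
gravity term is written as an integral over the upper phase. -/
lemma weak_form {c : Coeffs} {B : Fin 2 → ℝ} {vt v η : Fin 2 → L2} {q : ℝ × ℝ → ℝ}
    {DV DN : Fin 2 → Fin 2 → L2}
    (hDV : ∀ i j, HasWeakPartial slab j (v i) (DV i j))
    (hDN : ∀ i j, HasWeakPartial slab j (η i) (DN i j))
    (hv : ∀ i, MemH2 upper (v i) ∧ MemH2 lower (v i))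
    (hη : ∀ i, MemH2 upper (η i) ∧ MemH2 lower (η i))
    (hq : ∀ j, (∃ G, HasWeakPartial upper j q G) ∧ (∃ G, HasWeakPartial lower j q G))
    (hmomu : Momentum upper c.ρp c.μp B (fun i => vt i) (fun i => v i) (fun i => η i) q)
    (hmoml : Momentum lower c.ρm c.μm B (fun i => vt i) (fun i => v i) (fun i => η i) q)
    (hdiv : ∀ᵐ x ∂(volume.restrict slab), DV 0 0 x + DV 1 1 x = 0)
    (hjump : StressJump c B (fun i => v i) (fun i => η i) q)
    {ψ : ℝ × ℝ → ℝ} (hψ : IsTest slab ψ) :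
    (c.ρp * ∑ i, pair upper (vt i) (curl ψ i)
        + c.ρm * ∑ i, pair lower (vt i) (curl ψ i))
      + (c.μp * ∑ i, ∑ j, (pair upper (DV i j) (classicalPartial j (curl ψ i))
          + pair upper (DV j i) (classicalPartial j (curl ψ i)))
        + c.μm * ∑ i, ∑ j, (pair lower (DV i j) (classicalPartial j (curl ψ i))
          + pair lower (DV j i) (classicalPartial j (curl ψ i))))
      + (∑ i, ∑ l, ∑ m, B l * B m * (pair upper (DN i m) (classicalPartial l (curl ψ i))
          + pair lower (DN i m) (classicalPartial l (curl ψ i)))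
        + c.gJump * (pair upper (η 1) (classicalPartial 1 (curl ψ 1))
          + pair upper (DN 1 1) (curl ψ 1))) = 0 := by
  obtain ⟨e, he, hJ⟩ := hjump
  choose J hJη hJS using hJ
  choose τp τm hτp hτm hJτ using hJη
  choose σp σm hσp hσm hJσ using hJS
  have hφ : ∀ i, IsTest slab (curl ψ i) := hψ.curl
  have hφu : ∀ i, IsTest (univ ×ˢ Iio (1 : ℝ)) (curl ψ i) := fun i =>
    (hφ i).mono fun x hx => ⟨mem_univ _, (mem_strip.1 hx).2⟩
  have hφl : ∀ i, IsTest (univ ×ˢ Ioi (-1 : ℝ)) (curl ψ i) := fun i =>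
    (hφ i).mono fun x hx => ⟨mem_univ _, (mem_strip.1 hx).1⟩
  have ou : IsOpen upper := isOpen_strip _ _
  have ol : IsOpen lower := isOpen_strip _ _
  -- traces against the test field
  have tr_u : ∀ {f τ : _} (i : Fin 2), HasLowerTrace 0 1 f τ → ∀ g, HasWeakPartial upper 1 f g →
      pair upper f (classicalPartial 1 (curl ψ i)) + pair upper g (curl ψ i)
        = -∫ s, τ s * curl ψ i (s, 0) := by
    rintro f τ i ⟨-, hf, g', hg', hg'l, h⟩ g hg
    rw [pair_congr_left (hg.unique ou hg'), ← h _ (hφu i)]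
    exact (integral_add (((hφ i).partial 1).integrable_mul hf) ((hφ i).integrable_mul hg'l)).symm
  have tr_l : ∀ {f τ : _} (i : Fin 2), HasUpperTrace (-1) 0 f τ → ∀ g, HasWeakPartial lower 1 f g →
      pair lower f (classicalPartial 1 (curl ψ i)) + pair lower g (curl ψ i)
        = ∫ s, τ s * curl ψ i (s, 0) := by
    rintro f τ i ⟨-, hf, g', hg', hg'l, h⟩ g hg
    rw [pair_congr_left (hg.unique ol hg'), ← h _ (hφl i)]
    exact (integral_add (((hφ i).partial 1).integrable_mul hf) ((hφ i).integrable_mul hg'l)).symm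
  have hSp : ∀ i, ∃ g, HasWeakPartial upper 1
      (normalStress upper c.μp (fun i => v i) q i) g := fun i => by
    obtain ⟨-, -, g, hg, -⟩ := hσp i; exact ⟨g, hg⟩
  have hSm : ∀ i, ∃ g, HasWeakPartial lower 1
      (normalStress lower c.μm (fun i => v i) q i) g := fun i => by
    obtain ⟨-, -, g, hg, -⟩ := hσm i; exact ⟨g, hg⟩
  choose Sp hSp using hSp
  choose Sm hSm using hSm
  have memu : ∀ f : L2, MemLp f 2 (volume.restrict upper) := fun f =>
    (Lp.memLp f).mono_measure (Measure.restrict_mono upper_subset_slab le_rfl)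
  have meml : ∀ f : L2, MemLp f 2 (volume.restrict lower) := fun f =>
    (Lp.memLp f).mono_measure (Measure.restrict_mono lower_subset_slab le_rfl)
  have du := fun i j => (hDV i j).mono upper_subset_slab measurableSet_slab
  have dl := fun i j => (hDV i j).mono lower_subset_slab measurableSet_slab
  have divu : ∀ᵐ x ∂(volume.restrict upper),
      weakPartial upper 0 (v 0) x + weakPartial upper 1 (v 1) x = 0 := by
    filter_upwards [(du 0 0).weakPartial_ae ou, (du 1 1).weakPartial_ae ou,
      ae_mono (Measure.restrict_mono upper_subset_slab le_rfl) hdiv] with x h1 h2 h3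
    rw [h1, h2, h3]
  have divl : ∀ᵐ x ∂(volume.restrict lower),
      weakPartial lower 0 (v 0) x + weakPartial lower 1 (v 1) x = 0 := by
    filter_upwards [(dl 0 0).weakPartial_ae ol, (dl 1 1).weakPartial_ae ol,
      ae_mono (Measure.restrict_mono lower_subset_slab le_rfl) hdiv] with x h1 h2 h3
    rw [h1, h2, h3]
  have Pu := phase_identity (a := 0) (b := 1) one_pos (fun i => memu (vt i)) (fun i => (hv i).1)
    (fun i => (hη i).1) (fun j => (hq j).1) hmomu divu (hσp 1).2.1 hSp
    (fun i => (hφ i).mono (subset_univ _)) (div_curl hψ.smooth)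
  have Pl := phase_identity (a := -1) (b := 0) (by norm_num) (fun i => meml (vt i))
    (fun i => (hv i).2) (fun i => (hη i).2) (fun j => (hq j).2) hmoml divl (hσm 1).2.1 hSm
    (fun i => (hφ i).mono (subset_univ _)) (div_curl hψ.smooth)
  change _ * ∑ i, pair upper _ _ + _ * ∑ i, ∑ j, (pair upper (weakPartial upper _ _) _
    + pair upper (weakPartial upper _ _) _) + ∑ i, (pair upper (normalStress upper _ _ _ _) _
    + pair upper _ _) + ∑ i, ∑ l, ∑ m, _ * pair upper (weakPartial upper _ _) _
    - ∑ i, ∑ m, _ * (pair upper (weakPartial upper _ _) _ + pair upper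
      (weakPartial upper _ (weakPartial upper _ _)) _) = 0 at Pu
  change _ * ∑ i, pair lower _ _ + _ * ∑ i, ∑ j, (pair lower (weakPartial lower _ _) _
    + pair lower (weakPartial lower _ _) _) + ∑ i, (pair lower (normalStress lower _ _ _ _) _
    + pair lower _ _) + ∑ i, ∑ l, ∑ m, _ * pair lower (weakPartial lower _ _) _
    - ∑ i, ∑ m, _ * (pair lower (weakPartial lower _ _) _ + pair lower
      (weakPartial lower _ (weakPartial lower _ _)) _) = 0 at Pl
  simp only [fun i => tr_u i (hσp i) _ (hSp i),
    fun i m => tr_u i (hτp i m) _ (((hη i).1.2 m).hasWeakPartial 1)] at Pu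
  simp only [fun i => tr_l i (hσm i) _ (hSm i),
    fun i m => tr_l i (hτm i m) _ (((hη i).2.2 m).hasWeakPartial 1)] at Pl
  -- The interfacial integral of `η₂ φ₂` equals minus this bulk expression over the upper phase, as
  -- the test field vanishes near the wall `x₂ = 1`. In this form gravity is a bounded form on `H¹`
  -- fields and needs no trace operator.
  have gr := tr_u 1 he _ ((hDN 1 1).mono upper_subset_slab measurableSet_slab)
  -- the interface
  have li : ∀ {τ : ℝ → ℝ} (i : Fin 2), LocallyIntegrable τ →
      Integrable (fun s => τ s * curl ψ i (s, 0)) := by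
    intro τ i hτ
    have hcont : Continuous fun s : ℝ => curl ψ i (s, 0) :=
      (hφ i).smooth.continuous.comp (by fun_prop)
    have hcomp : HasCompactSupport fun s : ℝ => curl ψ i (s, 0) := by
      have hcl : Topology.IsClosedEmbedding (fun s : ℝ => (s, (0 : ℝ))) :=
        (Isometry.of_dist_eq fun s t => by simp [Prod.dist_eq]).isClosedEmbedding
      exact (hφ i).compact.comp_isClosedEmbedding hcl
    simpa [mul_comm] using hτ.integrable_smul_left_of_hasCompactSupport hcont hcomp
  have jump : ∀ i, (∫ s, σp i s * curl ψ i (s, 0)) - (∫ s, σm i s * curl ψ i (s, 0))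
      = (if i = 1 then c.gJump * ∫ s, e s * curl ψ i (s, 0) else 0)
        + ∑ m, B 1 * B m * ((∫ s, τp i m s * curl ψ i (s, 0))
          - ∫ s, τm i m s * curl ψ i (s, 0)) := by
    intro i
    have ie := (li i he.1).const_mul (if i = 1 then c.gJump else 0)
    have ip : ∀ m, Integrable fun s => τp i m s * curl ψ i (s, 0) - τm i m s * curl ψ i (s, 0) :=
      fun m => (li i (hτp i m).1).sub (li i (hτm i m).1)
    have is := integrable_finsetSum Finset.univ fun m _ => (ip m).const_mul (B 1 * B m)
    rw [← integral_sub (li i (hσp i).1) (li i (hσm i).1)]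
    have : ∀ᵐ s, σp i s * curl ψ i (s, 0) - σm i s * curl ψ i (s, 0)
        = (if i = 1 then c.gJump else 0) * (e s * curl ψ i (s, 0))
          + ∑ m, B 1 * B m * (τp i m s * curl ψ i (s, 0) - τm i m s * curl ψ i (s, 0)) := by
      filter_upwards [hJσ i, hJτ i 0, hJτ i 1] with s h1 h2 h3
      rw [← sub_mul, ← h1, Fin.sum_univ_two, Fin.sum_univ_two, h2, h3]
      split_ifs <;> ring
    rw [integral_congr_ae this]
    rw [integral_add ie is, integral_const_mul,
      integral_finsetSum _ fun m _ => (ip m).const_mul (B 1 * B m)]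
    congr 1
    · split_ifs <;> simp
    · refine Finset.sum_congr rfl fun m _ => ?_
      rw [← integral_sub (li i (hτp i m).1) (li i (hτm i m).1), ← integral_const_mul]
  simp only [fun i j => pair_congr_restrict ou upper_subset_slab measurableSet_slab (hDV i j),
    fun i j => pair_congr_restrict ou upper_subset_slab measurableSet_slab (hDN i j)] at Pu
  simp only [fun i j => pair_congr_restrict ol lower_subset_slab measurableSet_slab (hDV i j),
    fun i j => pair_congr_restrict ol lower_subset_slab measurableSet_slab (hDN i j)] at Pl
  have j0 := jump 0
  have j1 := jump 1
  simp only [Fin.sum_univ_two, if_true, zero_ne_one, if_false] at Pu Pl j0 j1 ⊢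
  linear_combination Pu + Pl + j0 + j1 + c.gJump * gr

/-! ### One-dimensional inequalities and the critical number -/

lemma sq_intervalIntegral_le {a b : ℝ} (hab : a ≤ b) {f : ℝ → ℝ}
    (hf : IntervalIntegrable f volume a b) (hf2 : IntervalIntegrable (fun y => f y ^ 2) volume a b) :
    (∫ y in a..b, f y) ^ 2 ≤ (b - a) * ∫ y in a..b, f y ^ 2 := by
  rcases hab.eq_or_lt with rfl | hlt
  · simp
  set m := ∫ y in a..b, f y with hm
  have h0 : 0 ≤ ∫ y in a..b, ((b - a) ^ 2 * f y ^ 2 - 2 * (b - a) * m * f y + m ^ 2) :=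
    intervalIntegral.integral_nonneg hab fun y _ => by
      nlinarith [sq_nonneg ((b - a) * f y - m)]
  rw [intervalIntegral.integral_add ((hf2.const_mul _).sub (hf.const_mul _)) (by simp),
    intervalIntegral.integral_sub (hf2.const_mul _) (hf.const_mul _),
    intervalIntegral.integral_const_mul, intervalIntegral.integral_const_mul, ← hm] at h0
  simp only [intervalIntegral.integral_const, smul_eq_mul] at h0
  have h1 : 0 ≤ (b - a) * ((b - a) * (∫ y in a..b, f y ^ 2) - m ^ 2) := by nlinarith
  have := nonneg_of_mul_nonneg_right h1 (sub_pos.2 hlt)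
  linarith

lemma Coeffs.gJump_pos (c : Coeffs) : 0 < c.gJump :=
  mul_pos c.g_pos (sub_pos.2 c.ρm_lt_ρp)

/-- The tent function with slopes 1 and -1 has `ψ(0) = 1` and `∫|ψ'|² = 2`, so it contributes the
value `g[ρ]/2` to the supremum. It is in fact extremal, but only this lower bound matters. -/
lemma half_gJump_lt_sq {c : Coeffs} {B : ℝ} (hB : criticalNumber c < |B|) :
    c.gJump / 2 < B ^ 2 := by
  set S := {r : ℝ | ∃ ψ dψ : ℝ → ℝ, IsH10 ψ dψ ∧
    (∃ y ∈ Set.Icc (-1 : ℝ) 1, ψ y ≠ 0) ∧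
    r = c.gJump * ψ 0 ^ 2 / ∫ y in (-1 : ℝ)..1, dψ y ^ 2} with hS
  have hg := c.gJump_pos
  -- A real supremum is informative only for a set bounded above. The crude bound `g[ρ]` comes from
  -- Cauchy-Schwarz on `(-1, 0)` alone.
  have hbdd : BddAbove S := by
    refine ⟨c.gJump, ?_⟩
    rintro r ⟨ψ, dψ, h, -, rfl⟩
    have hm : MemLp dψ 2 (volume.restrict (Ioc (-1) 1)) := by
      rw [← Measure.restrict_congr_set Ioo_ae_eq_Ioc]; exact h.memLp
    have i1 : IntervalIntegrable dψ volume (-1) 1 :=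
      (intervalIntegrable_iff_integrableOn_Ioc_of_le (by norm_num)).2
        (hm.integrable (by norm_num))
    have i2 : IntervalIntegrable (fun y => dψ y ^ 2) volume (-1) 1 :=
      (intervalIntegrable_iff_integrableOn_Ioc_of_le (by norm_num)).2 hm.integrable_sq
    have sub1 : uIcc (-1 : ℝ) 0 ⊆ uIcc (-1) 1 := by
      rw [uIcc_of_le (by norm_num), uIcc_of_le (by norm_num)]
      exact Icc_subset_Icc le_rfl (by norm_num)
    have sub2 : uIcc (0 : ℝ) 1 ⊆ uIcc (-1) 1 := by
      rw [uIcc_of_le (by norm_num), uIcc_of_le (by norm_num)]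
      exact Icc_subset_Icc (by norm_num) le_rfl
    have e1 := sq_intervalIntegral_le (by norm_num) (i1.mono_set sub1) (i2.mono_set sub1)
    norm_num only at e1
    rw [← h.primitive 0 (by norm_num)] at e1
    have e2 : 0 ≤ ∫ y in (0 : ℝ)..1, dψ y ^ 2 :=
      intervalIntegral.integral_nonneg (by norm_num) fun y _ => sq_nonneg _
    have e3 := intervalIntegral.integral_add_adjacent_intervals (i2.mono_set sub1)
      (i2.mono_set sub2)
    have e4 : 0 ≤ ∫ y in (-1 : ℝ)..0, dψ y ^ 2 :=
      intervalIntegral.integral_nonneg (by norm_num) fun y _ => sq_nonneg _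
    refine div_le_of_le_mul₀ (by linarith) hg.le ?_
    exact mul_le_mul_of_nonneg_left (by linarith) hg.le
  have hmem : c.gJump / 2 ∈ S := by
    -- the tent function
    set d : ℝ → ℝ := fun y => if y ≤ 0 then 1 else -1 with hd
    have hdm : Measurable d := Measurable.ite measurableSet_Iic measurable_const measurable_const
    have hdb : ∀ y, ‖d y‖ ≤ 1 := fun y => by
      simp only [hd]; split_ifs <;> simp
    have hdi : ∀ a b, IntervalIntegrable d volume a b := fun a b =>
      (intervalIntegrable_const (c := (1 : ℝ))).mono_fun hdm.aestronglyMeasurable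
        (Eventually.of_forall fun y => by simpa using hdb y)
    have hneg : ∀ y ≤ (0 : ℝ), -1 ≤ y → ∫ z in (-1 : ℝ)..y, d z = y + 1 := fun y hy hy' => by
      rw [intervalIntegral.integral_congr (g := fun _ => (1 : ℝ))]
      · simp
      · intro z hz
        rw [uIcc_of_le hy'] at hz
        simp [hd, hz.2.trans hy]
    have hpos : ∫ z in (0 : ℝ)..1, d z = -1 := by
      rw [intervalIntegral.integral_congr_ae (g := fun _ => (-1 : ℝ))]
      · simp
      · refine Eventually.of_forall fun z hz => ?_
        rw [uIoc_of_le (by norm_num)] at hz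
        simp [hd, not_le.2 hz.1]
    have h0 : ∫ z in (-1 : ℝ)..0, d z = 1 := by rw [hneg 0 le_rfl (by norm_num)]; norm_num
    refine ⟨fun y => ∫ z in (-1 : ℝ)..y, d z, d, ⟨?_, fun y _ => rfl, ?_⟩,
      ⟨0, by norm_num, ?_⟩, ?_⟩
    · exact MemLp.of_bound hdm.aestronglyMeasurable 1 (Eventually.of_forall hdb)
    · rw [← intervalIntegral.integral_add_adjacent_intervals (hdi (-1) 0) (hdi 0 1), h0, hpos]
      norm_num
    · change (∫ z in (-1 : ℝ)..0, d z) ≠ 0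
      rw [h0]; norm_num
    · have : ∀ y, d y ^ 2 = 1 := fun y => by simp only [hd]; split_ifs <;> norm_num
      simp only [this, h0]
      norm_num
  have h1 : c.gJump / 2 ≤ sSup S := le_csSup hbdd hmem
  have h2 : 0 ≤ criticalNumber c := Real.sqrt_nonneg _
  have h3 : criticalNumber c ^ 2 = sSup S := Real.sq_sqrt (by linarith)
  rw [← sq_abs B]
  nlinarith

/-- The left side is `h(0)²`, because `2hh' = (h²)'` and `h(1) = 0`. By Cauchy-Schwarz `h(0)²` is at
most the integral of `h'²` over each of the two unit intervals, hence at most the average of the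
two. -/
lemma tent_inequality {h h' : ℝ → ℝ} (hd : ∀ y, HasDerivAt h (h' y) y) (hc : Continuous h')
    (h1 : h 1 = 0) (hm1 : h (-1) = 0) :
    -2 * ∫ y in Ioo (0 : ℝ) 1, h y * h' y ≤ (1 / 2) * ∫ y in Ioo (-1 : ℝ) 1, h' y ^ 2 := by
  have hi : ∀ a b, IntervalIntegrable h' volume a b := fun a b => hc.intervalIntegrable a b
  have hi2 : ∀ a b, IntervalIntegrable (fun y => h' y ^ 2) volume a b :=
    fun a b => (hc.pow 2).intervalIntegrable a b
  rw [← integral_Ioc_eq_integral_Ioo, ← integral_Ioc_eq_integral_Ioo,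
    ← intervalIntegral.integral_of_le (by norm_num), ← intervalIntegral.integral_of_le (by norm_num),
    ← intervalIntegral.integral_add_adjacent_intervals (hi2 (-1) 0) (hi2 0 1)]
  have e1 : ∫ y in (0 : ℝ)..1, h' y = h 1 - h 0 :=
    intervalIntegral.integral_eq_sub_of_hasDerivAt (fun y _ => hd y) (hi _ _)
  have e2 : ∫ y in (-1 : ℝ)..0, h' y = h 0 - h (-1) :=
    intervalIntegral.integral_eq_sub_of_hasDerivAt (fun y _ => hd y) (hi _ _)
  have hcont : Continuous h := continuous_iff_continuousAt.2 fun y => (hd y).continuousAt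
  have e3 : ∫ y in (0 : ℝ)..1, h y * h' y = h 1 ^ 2 / 2 - h 0 ^ 2 / 2 := by
    refine intervalIntegral.integral_eq_sub_of_hasDerivAt (f := fun y => h y ^ 2 / 2)
      (fun y _ => ?_) ((hcont.mul hc).intervalIntegrable _ _)
    refine (((hd y).pow 2).div_const 2).congr_deriv ?_
    push_cast
    ring
  have e4 := sq_intervalIntegral_le (by norm_num) (hi 0 1) (hi2 0 1)
  have e5 := sq_intervalIntegral_le (by norm_num) (hi (-1) 0) (hi2 (-1) 0)
  norm_num only at e4 e5
  rw [e3]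
  rw [e1] at e4
  rw [e2] at e5
  rw [h1] at e4 ⊢
  rw [hm1] at e5
  nlinarith

/-! ### Inequalities for test functions -/

lemma setIntegral_slab_of_test {F : ℝ × ℝ → ℝ} (hF : ∀ x, x ∉ slab → F x = 0) :
    ∫ x in slab, F x = ∫ x, F x := setIntegral_eq_integral_of_forall_compl_eq_zero hF

lemma IsTest.eq_zero {U : Set (ℝ × ℝ)} {φ : ℝ × ℝ → ℝ} (h : IsTest U φ) {x : ℝ × ℝ}
    (hx : x ∉ U) : φ x = 0 := image_eq_zero_of_notMem_tsupport fun h' => hx (h.support h')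

lemma IsTest.integral_by_parts {U V : Set (ℝ × ℝ)} {f g : ℝ × ℝ → ℝ} (hf : IsTest U f)
    (hg : IsTest V g) (j : Fin 2) :
    ∫ x, f x * classicalPartial j g x = -∫ x, classicalPartial j f x * g x := by
  have hi : ∀ {U V : Set (ℝ × ℝ)} {f g : ℝ × ℝ → ℝ}, IsTest U f → IsTest V g →
      Integrable fun x => f x * g x := fun hf hg =>
    hg.integrable_mul hf.smooth.continuous.locallyIntegrable
  exact integral_mul_fderiv_eq_neg_fderiv_mul_of_integrable (hi (hf.partial j) hg)
    (hi hf (hg.partial j)) (hi hf hg) (fun x _ => hf.smooth.differentiable (by simp) x)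
    (fun x _ => hg.smooth.differentiable (by simp) x)

lemma IsTest.integrable_mul_test {U V : Set (ℝ × ℝ)} {f g : ℝ × ℝ → ℝ} (hf : IsTest U f)
    (hg : IsTest V g) : Integrable fun x => f x * g x :=
  hg.integrable_mul hf.smooth.continuous.locallyIntegrable

/-- Integrating by parts against the multiplier `x₂` gives `∫ f² = -2 ∫ x₂ f ∂₂f`. Since `|x₂| ≤ 1`,
this is at most `(1/2) ∫ f² + 2 ∫ (∂₂f)²`, whence the constant 4. -/
lemma IsTest.poincare {f : ℝ × ℝ → ℝ} (hf : IsTest slab f) :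
    pair slab f f ≤ 4 * pair slab (classicalPartial 1 f) (classicalPartial 1 f) := by
  have z : ∀ {g h : ℝ × ℝ → ℝ}, IsTest slab g → IsTest slab h → pair slab g h = ∫ x, g x * h x :=
    fun hg _ => setIntegral_slab_of_test fun x hx => by rw [hg.eq_zero hx, zero_mul]
  have hf1 := hf.partial 1
  rw [z hf hf, z hf1 hf1]
  have hy : IsTest slab fun x => x.2 * f x := hf.mul_left contDiff_snd inter_subset_left
  have e := hf.integral_by_parts hy 1
  have hp : ∀ x, classicalPartial 1 (fun x : ℝ × ℝ => x.2 * f x) x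
      = x.2 * classicalPartial 1 f x + f x := fun x => by
    rw [classicalPartial_mul differentiableAt_snd (hf.smooth.differentiable (by simp) x)]
    have : classicalPartial 1 (fun y : ℝ × ℝ => y.2) x = 1 := by
      have := classicalPartial_snd (χ := fun y => y) differentiable_id x 1
      simpa using this
    rw [this]; ring
  simp only [hp] at e
  have i1 := hf.integrable_mul_test hf
  have i2 := hf1.integrable_mul_test hy
  have i3 := hf1.integrable_mul_test hf1
  have e2 : ∫ x, f x * (x.2 * classicalPartial 1 f x + f x)
      = (∫ x, classicalPartial 1 f x * (x.2 * f x)) + ∫ x, f x * f x := by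
    rw [← integral_add i2 i1]
    congr 1; ext x; ring
  have e3 : ∫ x, -(2 * (classicalPartial 1 f x * (x.2 * f x)))
      ≤ ∫ x, ((1 / 2) * (f x * f x) + 2 * (classicalPartial 1 f x * classicalPartial 1 f x)) := by
    refine integral_mono (i2.const_mul 2).neg ((i1.const_mul _).add (i3.const_mul _)) fun x => ?_
    simp only
    by_cases hx : x ∈ slab
    · have := mem_strip.1 hx
      have h1 : x.2 ^ 2 ≤ 1 := by nlinarith
      nlinarith [sq_nonneg (f x + 2 * (x.2 * classicalPartial 1 f x)),
        mul_nonneg (sub_nonneg.2 h1) (sq_nonneg (classicalPartial 1 f x))]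
    · rw [hf.eq_zero hx]
      nlinarith [mul_self_nonneg (classicalPartial 1 f x)]
  rw [integral_neg, integral_const_mul, integral_add (i1.const_mul _) (i3.const_mul _),
    integral_const_mul, integral_const_mul] at e3
  linarith

lemma setIntegral_strip {a b : ℝ} {F : ℝ × ℝ → ℝ} (hF : Integrable F) :
    ∫ x in strip a b, F x = ∫ s, ∫ y in Ioo a b, F (s, y) := by
  unfold strip
  rw [Measure.volume_eq_prod, setIntegral_prod _ (by
    rw [← Measure.volume_eq_prod]; exact hF.integrableOn)]
  simp

lemma integrable_setIntegral_strip {a b : ℝ} {F : ℝ × ℝ → ℝ} (hF : Integrable F) :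
    Integrable fun s => ∫ y in Ioo a b, F (s, y) := by
  have h : Integrable F ((volume : Measure ℝ).prod (volume.restrict (Ioo a b))) := by
    refine hF.mono_measure ?_
    rw [Measure.volume_eq_prod]
    exact Measure.prod_mono le_rfl Measure.restrict_le_self
  exact h.integral_prod_left

/-- This is `tent_inequality` on each vertical segment, integrated over `x₁`. -/
lemma IsTest.trace_inequality {f : ℝ × ℝ → ℝ} (hf : IsTest slab f) :
    -2 * pair upper f (classicalPartial 1 f)
      ≤ (1 / 2) * pair slab (classicalPartial 1 f) (classicalPartial 1 f) := by
  have hf1 := hf.partial 1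
  have i1 := hf.integrable_mul_test hf1
  have i2 := hf1.integrable_mul_test hf1
  unfold pair upper slab
  rw [setIntegral_strip i1, setIntegral_strip i2, ← integral_const_mul, ← integral_const_mul]
  refine integral_mono ((integrable_setIntegral_strip i1).const_mul _)
    ((integrable_setIntegral_strip i2).const_mul _) fun s => ?_
  have hd : ∀ y, HasDerivAt (fun y => f (s, y)) (classicalPartial 1 f (s, y)) y := fun y => by
    have h1 := (hf.smooth.differentiable (by simp) (s, y)).hasFDerivAt
    have h2 : HasDerivAt (fun y : ℝ => (s, y)) ((0 : ℝ), (1 : ℝ)) y :=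
      (hasDerivAt_const y s).prodMk (hasDerivAt_id y)
    exact h1.comp_hasDerivAt y h2
  have := tent_inequality hd (hf1.smooth.continuous.comp (by fun_prop))
    (hf.eq_zero fun h => by simpa using (mem_strip.1 h).2)
    (hf.eq_zero fun h => by simpa using (mem_strip.1 h).1)
  simpa only [pow_two] using this

/-- Two integrations by parts turn `∫ ∂₁w₂ ∂₂w₁` into `∫ ∂₁w₁ ∂₂w₂`, so the sum is `∫ (div w)²`,
which vanishes for a curl. -/
lemma integral_sum_transpose_curl {ψ : ℝ × ℝ → ℝ} (hψ : IsTest slab ψ) :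
    ∑ i, ∑ j, pair slab (classicalPartial i (curl ψ j)) (classicalPartial j (curl ψ i)) = 0 := by
  have z : ∀ {g h : ℝ × ℝ → ℝ}, IsTest slab g → IsTest slab h → pair slab g h = ∫ x, g x * h x :=
    fun hg _ => setIntegral_slab_of_test fun x hx => by rw [hg.eq_zero hx, zero_mul]
  have t := fun i j => (hψ.curl i).partial j
  simp only [Fin.sum_univ_two, z (t _ _) (t _ _)]
  have p1 := (t 0 1).integral_by_parts (hψ.curl 1) 0
  have p2 := (t 0 0).integral_by_parts (hψ.curl 1) 1
  simp only [classicalPartial_comm (hψ.curl 0).smooth 0 1] at p1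
  have e1 : ∫ x, classicalPartial 0 (curl ψ 1) x * classicalPartial 1 (curl ψ 0) x
      = ∫ x, classicalPartial 1 (curl ψ 0) x * classicalPartial 0 (curl ψ 1) x := by
    simp only [mul_comm]
  have e2 : (∫ x, classicalPartial 0 (curl ψ 0) x * classicalPartial 0 (curl ψ 0) x)
      + ∫ x, classicalPartial 0 (curl ψ 0) x * classicalPartial 1 (curl ψ 1) x = 0 := by
    rw [← integral_add ((t 0 0).integrable_mul_test (t 0 0)) ((t 0 0).integrable_mul_test (t 1 1))]
    simp only [← mul_add, div_curl hψ.smooth, mul_zero, integral_zero]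
  have e3 : (∫ x, classicalPartial 0 (curl ψ 0) x * classicalPartial 1 (curl ψ 1) x)
      + ∫ x, classicalPartial 1 (curl ψ 1) x * classicalPartial 1 (curl ψ 1) x = 0 := by
    rw [← integral_add ((t 0 0).integrable_mul_test (t 1 1)) ((t 1 1).integrable_mul_test (t 1 1))]
    simp only [← add_mul, div_curl hψ.smooth, zero_mul, integral_zero]
  rw [e1]
  linarith

/-! ### Pairings on `L²(Ω)` -/

lemma integrable_mul_L2 (f g : L2) : Integrable (fun x => f x * g x) (volume.restrict slab) :=
  (Lp.memLp f).integrable_mul (Lp.memLp g)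

lemma norm_integral_mul_le (U : Set (ℝ × ℝ)) (f g : L2) :
    ‖∫ x in U, f x * g x ∂(volume.restrict slab)‖ ≤ ‖f‖ * ‖g‖ := by
  have h1 : ‖∫ x in U, f x * g x ∂(volume.restrict slab)‖
      ≤ ∫ x, ‖f x‖ * ‖g x‖ ∂(volume.restrict slab) := by
    refine (norm_integral_le_integral_norm _).trans ?_
    simp only [norm_mul]
    exact setIntegral_le_integral
      (by simpa only [norm_mul] using (integrable_mul_L2 f g).norm)
      (Eventually.of_forall fun x => by positivity)
  have hp : (2 : ℝ).HolderConjugate 2 := Real.HolderConjugate.two_two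
  have hm : ∀ f : L2, MemLp f (ENNReal.ofReal 2) (volume.restrict slab) := fun f => by
    simpa using Lp.memLp f
  have h2 := integral_mul_norm_le_Lp_mul_Lq hp (hm f) (hm g)
  have h3 : ∀ f : L2, (∫ x, ‖f x‖ ^ (2 : ℝ) ∂(volume.restrict slab)) ^ (1 / (2 : ℝ)) = ‖f‖ := by
    intro f
    have e : ∫ x, ‖f x‖ ^ (2 : ℝ) ∂(volume.restrict slab) = ‖f‖ ^ 2 := by
      rw [← real_inner_self_eq_norm_sq, L2.inner_def]
      refine integral_congr_ae (Eventually.of_forall fun x => ?_)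
      simp
    rw [e, ← Real.sqrt_eq_rpow, Real.sqrt_sq (norm_nonneg _)]
  rw [h3, h3] at h2
  exact h1.trans h2

/-- The bounded bilinear form `(f, g) ↦ ∫_{U ∩ Ω} f g` on `L²(Ω)`. -/
def pairCLM (U : Set (ℝ × ℝ)) : L2 →L[ℝ] L2 →L[ℝ] ℝ :=
  LinearMap.mkContinuous₂
    (LinearMap.mk₂ ℝ (fun f g : L2 => ∫ x in U, f x * g x ∂(volume.restrict slab))
      (fun f f' g => by
        rw [← integral_add (integrable_mul_L2 f g).restrict (integrable_mul_L2 f' g).restrict]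
        refine integral_congr_ae (ae_restrict_of_ae ?_)
        filter_upwards [Lp.coeFn_add f f'] with x hx
        rw [hx, Pi.add_apply, add_mul])
      (fun r f g => by
        rw [smul_eq_mul, ← integral_const_mul]
        refine integral_congr_ae (ae_restrict_of_ae ?_)
        filter_upwards [Lp.coeFn_smul r f] with x hx
        rw [hx, Pi.smul_apply, smul_eq_mul, mul_assoc])
      (fun f g g' => by
        rw [← integral_add (integrable_mul_L2 f g).restrict (integrable_mul_L2 f g').restrict]
        refine integral_congr_ae (ae_restrict_of_ae ?_)
        filter_upwards [Lp.coeFn_add g g'] with x hx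
        rw [hx, Pi.add_apply, mul_add])
      (fun r f g => by
        rw [smul_eq_mul, ← integral_const_mul]
        refine integral_congr_ae (ae_restrict_of_ae ?_)
        filter_upwards [Lp.coeFn_smul r g] with x hx
        rw [hx, Pi.smul_apply, smul_eq_mul]
        ring)) 1
    (fun f g => by simpa using norm_integral_mul_le U f g)

lemma pairCLM_apply {U : Set (ℝ × ℝ)} (hU : MeasurableSet U) (hUs : U ⊆ slab) (f g : L2) :
    pairCLM U f g = pair U f g := by
  change ∫ x in U, f x * g x ∂(volume.restrict slab) = _
  rw [Measure.restrict_restrict hU, inter_eq_left.2 hUs]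
  rfl

lemma pairCLM_comm (U : Set (ℝ × ℝ)) (f g : L2) : pairCLM U f g = pairCLM U g f := by
  change ∫ x in U, f x * g x ∂(volume.restrict slab) = ∫ x in U, g x * f x ∂(volume.restrict slab)
  simp only [mul_comm]

lemma pairCLM_self_nonneg (U : Set (ℝ × ℝ)) (f : L2) : 0 ≤ pairCLM U f f :=
  integral_nonneg fun x => mul_self_nonneg (f x)

lemma abs_pairCLM_le (U : Set (ℝ × ℝ)) (f g : L2) : |pairCLM U f g| ≤ ‖f‖ * ‖g‖ :=
  norm_integral_mul_le U f g

lemma measurableSet_upper : MeasurableSet upper := measurableSet_strip _ _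

lemma measurableSet_lower : MeasurableSet lower := measurableSet_strip _ _

lemma upper_union_lower_ae : (upper ∪ lower : Set (ℝ × ℝ)) =ᵐ[volume] slab := by
  have hz : volume ((univ : Set ℝ) ×ˢ ({0} : Set ℝ)) = 0 := by
    rw [Measure.volume_eq_prod, Measure.prod_prod]; simp
  have hz' : ∀ᵐ x : ℝ × ℝ, x ∉ (univ : Set ℝ) ×ˢ ({0} : Set ℝ) := measure_eq_zero_iff_ae_notMem.1 hz
  filter_upwards [hz'] with x hx
  have hx2 : x.2 ≠ 0 := fun h => hx ⟨mem_univ _, h⟩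
  apply propext
  change (x ∈ upper ∪ lower ↔ x ∈ slab)
  constructor
  · rintro (h | h)
    · exact upper_subset_slab h
    · exact lower_subset_slab h
  · intro h
    have := mem_strip.1 h
    rcases lt_or_gt_of_ne hx2 with h' | h'
    · exact Or.inr (mem_strip.2 ⟨this.1, h'⟩)
    · exact Or.inl (mem_strip.2 ⟨h', this.2⟩)

lemma pairCLM_upper_add_lower (f g : L2) :
    pairCLM upper f g + pairCLM lower f g = inner ℝ f g := by
  rw [pairCLM_apply measurableSet_upper upper_subset_slab,
    pairCLM_apply measurableSet_lower lower_subset_slab]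
  have hi : IntegrableOn (fun x => f x * g x) slab := integrable_mul_L2 f g
  unfold pair
  rw [← setIntegral_union ?_ measurableSet_lower (hi.mono_set upper_subset_slab)
    (hi.mono_set lower_subset_slab), setIntegral_congr_set upper_union_lower_ae, L2.inner_def]
  · refine integral_congr_ae (Eventually.of_forall fun x => ?_)
    simp [mul_comm]
  · rw [Set.disjoint_left]
    intro x hx hx'
    linarith [(mem_strip.1 hx).1, (mem_strip.1 hx').2]

lemma pairCLM_slab (f g : L2) : pairCLM slab f g = inner ℝ f g := by
  rw [pairCLM_apply measurableSet_slab le_rfl, L2.inner_def]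
  refine integral_congr_ae (Eventually.of_forall fun x => ?_)
  simp [mul_comm]

lemma pairCLM_slab_self (f : L2) : pairCLM slab f f = ‖f‖ ^ 2 := by
  rw [pairCLM_slab, real_inner_self_eq_norm_sq]

lemma pairCLM_self_add (f : L2) : pairCLM upper f f + pairCLM lower f f = ‖f‖ ^ 2 := by
  rw [pairCLM_upper_add_lower, real_inner_self_eq_norm_sq]

/-! ### Fields with gradient -/

/-- Pairs `(u, ∇u)`; the entry `(i, j)` of the second component stands for `∂ⱼuᵢ`. -/
abbrev Field : Type := (Fin 2 → L2) × (Fin 2 → Fin 2 → L2)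

/-- The components of the field. -/
def fval (i : Fin 2) : Field →L[ℝ] L2 :=
  (ContinuousLinearMap.proj i).comp (ContinuousLinearMap.fst ℝ (Fin 2 → L2) (Fin 2 → Fin 2 → L2))

/-- The components of the gradient. -/
def fgrad (i j : Fin 2) : Field →L[ℝ] L2 :=
  ((ContinuousLinearMap.proj (R := ℝ) (φ := fun _ : Fin 2 => L2) j).comp
    (ContinuousLinearMap.proj (R := ℝ) (φ := fun _ : Fin 2 => Fin 2 → L2) i)).comp
    (ContinuousLinearMap.snd ℝ (Fin 2 → L2) (Fin 2 → Fin 2 → L2))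

@[simp] lemma fval_apply (i : Fin 2) (x : Field) : fval i x = x.1 i := rfl

@[simp] lemma fgrad_apply (i j : Fin 2) (x : Field) : fgrad i j x = x.2 i j := rfl

/-- The class of a test function in `L²(Ω)`. -/
def IsTest.toL2 {U : Set (ℝ × ℝ)} {φ : ℝ × ℝ → ℝ} (h : IsTest U φ) : L2 :=
  (h.memLp 2 (volume.restrict slab)).toLp φ

lemma IsTest.coe_toL2 {U : Set (ℝ × ℝ)} {φ : ℝ × ℝ → ℝ} (h : IsTest U φ) :
    h.toL2 =ᵐ[volume.restrict slab] φ := MemLp.coeFn_toLp _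

/-- The field `(curl ψ, ∇ curl ψ)`. -/
def streamField {ψ : ℝ × ℝ → ℝ} (h : IsTest slab ψ) : Field :=
  (fun i => (h.curl i).toL2, fun i j => ((h.curl i).partial j).toL2)

lemma curl_add {ψ χ : ℝ × ℝ → ℝ} (h : ContDiff ℝ ∞ ψ) (h' : ContDiff ℝ ∞ χ) (i : Fin 2) :
    curl (fun x => ψ x + χ x) i = fun x => curl ψ i x + curl χ i x := by
  have hd := h.differentiable (by simp)
  have hd' := h'.differentiable (by simp)
  ext x
  fin_cases i
  · exact classicalPartial_add (hd x) (hd' x) 1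
  · change -classicalPartial 0 _ x = -classicalPartial 0 ψ x + -classicalPartial 0 χ x
    rw [classicalPartial_add (hd x) (hd' x)]; ring

lemma curl_const_mul {ψ : ℝ × ℝ → ℝ} (r : ℝ) (h : ContDiff ℝ ∞ ψ) (i : Fin 2) :
    curl (fun x => r * ψ x) i = fun x => r * curl ψ i x := by
  have hd := h.differentiable (by simp)
  ext x
  fin_cases i
  · exact classicalPartial_const_mul r (hd x) 1
  · change -classicalPartial 0 _ x = r * -classicalPartial 0 ψ x
    rw [classicalPartial_const_mul r (hd x)]; ring

lemma IsTest.toL2_congr {U : Set (ℝ × ℝ)} {φ φ' : ℝ × ℝ → ℝ} (h : IsTest U φ)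
    (h' : IsTest U φ') (e : φ = φ') : h.toL2 = h'.toL2 := by subst e; rfl

lemma IsTest.toL2_add {U : Set (ℝ × ℝ)} {φ φ' : ℝ × ℝ → ℝ} (h : IsTest U φ) (h' : IsTest U φ') :
    (h.add h').toL2 = h.toL2 + h'.toL2 := rfl

lemma IsTest.toL2_const_mul {U : Set (ℝ × ℝ)} {φ : ℝ × ℝ → ℝ} (h : IsTest U φ) (r : ℝ) :
    (h.const_mul r).toL2 = r • h.toL2 := rfl

/-- The test fields as a subspace. -/
def testFields : Submodule ℝ Field where
  carrier := {x | ∃ (ψ : ℝ × ℝ → ℝ) (h : IsTest slab ψ), x = streamField h}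
  add_mem' := by
    rintro _ _ ⟨ψ, h, rfl⟩ ⟨χ, h', rfl⟩
    refine ⟨_, h.add h', ?_⟩
    have e := fun i => curl_add h.smooth h'.smooth i
    refine Prod.ext (funext fun i => ?_) (funext fun i => funext fun j => ?_)
    · exact (IsTest.toL2_add (h.curl i) (h'.curl i)).symm.trans (IsTest.toL2_congr _ (IsTest.curl (h.add h') i) (e i).symm)
    · refine (IsTest.toL2_add ((h.curl i).partial j) ((h'.curl i).partial j)).symm.trans
        (IsTest.toL2_congr _ ((IsTest.curl (h.add h') i).partial j) ?_)
      rw [e i]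
      ext x
      exact (classicalPartial_add ((h.curl i).smooth.differentiable (by simp) x)
        ((h'.curl i).smooth.differentiable (by simp) x) j).symm
  zero_mem' := by
    refine ⟨_, isTest_zero _, ?_⟩
    have e : ∀ i, curl (fun _ => 0) i = fun _ => 0 := fun i => by
      fin_cases i <;> ext x <;> simp [curl, classicalPartial]
    have z : ∀ {φ : ℝ × ℝ → ℝ} (h : IsTest slab φ), φ = (fun _ => 0) → (0 : L2) = h.toL2 := by
      rintro φ h rfl; rfl
    refine Prod.ext (funext fun i => ?_) (funext fun i => funext fun j => ?_)
    · exact z (IsTest.curl (isTest_zero slab) i) (e i)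
    · refine z ((IsTest.curl (isTest_zero slab) i).partial j) ?_
      rw [e i]; ext x; simp [classicalPartial]
  smul_mem' := by
    rintro r _ ⟨ψ, h, rfl⟩
    refine ⟨_, h.const_mul r, ?_⟩
    have e := fun i => curl_const_mul r h.smooth i
    refine Prod.ext (funext fun i => ?_) (funext fun i => funext fun j => ?_)
    · exact (IsTest.toL2_const_mul (h.curl i) r).symm.trans (IsTest.toL2_congr _ (IsTest.curl (h.const_mul r) i) (e i).symm)
    · refine (IsTest.toL2_const_mul ((h.curl i).partial j) r).symm.trans
        (IsTest.toL2_congr _ ((IsTest.curl (h.const_mul r) i).partial j) ?_)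
      rw [e i]
      ext x
      exact (classicalPartial_const_mul r ((h.curl i).smooth.differentiable (by simp) x) j).symm

/-- The closure in `H¹` of the divergence free test fields. -/
def solenoidal : Submodule ℝ Field := testFields.topologicalClosure

lemma isClosed_solenoidal : IsClosed (solenoidal : Set Field) :=
  testFields.isClosed_topologicalClosure

/-- Inequalities and identities that are closed conditions in the `H¹` topology need only be checked
for smooth compactly supported curls. -/
lemma solenoidal_induction {P : Field → Prop} (hc : IsClosed {x | P x})
    (h : ∀ ψ (hψ : IsTest slab ψ), P (streamField hψ)) {x : Field} (hx : x ∈ solenoidal) : P x := by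
  have : closure (testFields : Set Field) ⊆ {x | P x} := by
    refine closure_minimal ?_ hc
    rintro _ ⟨ψ, hψ, rfl⟩
    exact h ψ hψ
  exact this hx

lemma pairCLM_toL2 {U V W : Set (ℝ × ℝ)} (hU : MeasurableSet U) (hUs : U ⊆ slab)
    {φ χ : ℝ × ℝ → ℝ} (h : IsTest V φ) (h' : IsTest W χ) :
    pairCLM U h.toL2 h'.toL2 = pair U φ χ := by
  rw [pairCLM_apply hU hUs]
  refine integral_congr_ae ?_
  filter_upwards [ae_mono (Measure.restrict_mono hUs le_rfl) h.coe_toL2,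
    ae_mono (Measure.restrict_mono hUs le_rfl) h'.coe_toL2] with x h1 h2
  rw [h1, h2]

lemma pairCLM_toL2_right {U W : Set (ℝ × ℝ)} (hU : MeasurableSet U) (hUs : U ⊆ slab)
    {χ : ℝ × ℝ → ℝ} (f : L2) (h' : IsTest W χ) :
    pairCLM U f h'.toL2 = pair U f χ := by
  rw [pairCLM_apply hU hUs]
  refine integral_congr_ae ?_
  filter_upwards [ae_mono (Measure.restrict_mono hUs le_rfl) h'.coe_toL2] with x h2
  rw [h2]

lemma continuous_pairCLM (U : Set (ℝ × ℝ)) {X : Type*} [TopologicalSpace X] {f g : X → L2}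
    (hf : Continuous f) (hg : Continuous g) : Continuous fun x => pairCLM U (f x) (g x) :=
  ((pairCLM U).continuous.comp hf).clm_apply hg

lemma continuous_fst_apply (i : Fin 2) : Continuous fun x : Field => x.1 i := (fval i).continuous

lemma continuous_snd_apply (i j : Fin 2) : Continuous fun x : Field => x.2 i j :=
  (fgrad i j).continuous

lemma solenoidal_div {x : Field} (hx : x ∈ solenoidal) : x.2 0 0 + x.2 1 1 = 0 := by
  refine solenoidal_induction (P := fun x => x.2 0 0 + x.2 1 1 = 0)
    (isClosed_eq ((continuous_snd_apply 0 0).add (continuous_snd_apply 1 1)) continuous_const)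
    (fun ψ hψ => ?_) hx
  refine Lp.ext ?_
  filter_upwards [Lp.coeFn_add ((streamField hψ).2 0 0) ((streamField hψ).2 1 1),
    ((hψ.curl 0).partial 0).coe_toL2, ((hψ.curl 1).partial 1).coe_toL2,
    Lp.coeFn_zero ℝ 2 (volume.restrict slab)] with x h1 h2 h3 h4
  rw [h1, h4, Pi.add_apply]
  change ((hψ.curl 0).partial 0).toL2 x + ((hψ.curl 1).partial 1).toL2 x = _
  rw [h2, h3, div_curl hψ.smooth]
  rfl

lemma solenoidal_poincare {x : Field} (hx : x ∈ solenoidal) (i : Fin 2) :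
    ‖x.1 i‖ ^ 2 ≤ 4 * ‖x.2 i 1‖ ^ 2 := by
  refine solenoidal_induction (P := fun x => ‖x.1 i‖ ^ 2 ≤ 4 * ‖x.2 i 1‖ ^ 2)
    (isClosed_le ((continuous_fst_apply i).norm.pow 2)
      (((continuous_snd_apply i 1).norm.pow 2).const_mul 4)) (fun ψ hψ => ?_) hx
  rw [← pairCLM_slab_self, ← pairCLM_slab_self]
  change pairCLM slab (hψ.curl i).toL2 (hψ.curl i).toL2
    ≤ 4 * pairCLM slab ((hψ.curl i).partial 1).toL2 ((hψ.curl i).partial 1).toL2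
  rw [pairCLM_toL2 measurableSet_slab le_rfl, pairCLM_toL2 measurableSet_slab le_rfl]
  exact (hψ.curl i).poincare

/-- The left side stands for the integral of `u₂²` over the interface. Written as a bulk pairing it
is continuous on `Field`, so the inequality passes to the closure. -/
lemma solenoidal_trace {x : Field} (hx : x ∈ solenoidal) :
    -2 * pairCLM upper (x.1 1) (x.2 1 1) ≤ (1 / 2) * ‖x.2 1 1‖ ^ 2 := by
  refine solenoidal_induction
    (P := fun x => -2 * pairCLM upper (x.1 1) (x.2 1 1) ≤ (1 / 2) * ‖x.2 1 1‖ ^ 2)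
    (isClosed_le ((continuous_pairCLM _ (continuous_fst_apply 1)
      (continuous_snd_apply 1 1)).const_mul _)
      (((continuous_snd_apply 1 1).norm.pow 2).const_mul _)) (fun ψ hψ => ?_) hx
  rw [← pairCLM_slab_self]
  change -2 * pairCLM upper (hψ.curl 1).toL2 ((hψ.curl 1).partial 1).toL2
    ≤ 1 / 2 * pairCLM slab ((hψ.curl 1).partial 1).toL2 ((hψ.curl 1).partial 1).toL2
  rw [pairCLM_toL2 measurableSet_slab le_rfl, pairCLM_toL2 measurableSet_upper upper_subset_slab]
  exact (hψ.curl 1).trace_inequality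

lemma solenoidal_transpose {x : Field} (hx : x ∈ solenoidal) :
    ∑ i, ∑ j, pairCLM slab (x.2 j i) (x.2 i j) = 0 := by
  refine solenoidal_induction (P := fun x => ∑ i, ∑ j, pairCLM slab (x.2 j i) (x.2 i j) = 0)
    (isClosed_eq (continuous_finsetSum _ fun i _ => continuous_finsetSum _ fun j _ =>
      continuous_pairCLM _ (continuous_snd_apply j i) (continuous_snd_apply i j))
      continuous_const) (fun ψ hψ => ?_) hx
  rw [← integral_sum_transpose_curl hψ]
  refine Finset.sum_congr rfl fun i _ => Finset.sum_congr rfl fun j _ => ?_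
  exact pairCLM_toL2 measurableSet_slab le_rfl ((hψ.curl j).partial i) ((hψ.curl i).partial j)

/-! ### The forms -/

/-- The form `∫ ρ u · w`. -/
def inertia (c : Coeffs) : (Fin 2 → L2) →L[ℝ] (Fin 2 → L2) →L[ℝ] ℝ :=
  ∑ i, (c.ρp • pairCLM upper + c.ρm • pairCLM lower).bilinearComp
    (ContinuousLinearMap.proj i) (ContinuousLinearMap.proj i)

/-- The viscous form `∑ᵢⱼ ∫ μ (∂ⱼuᵢ + ∂ᵢuⱼ) ∂ⱼwᵢ`. -/
def viscous (c : Coeffs) : Field →L[ℝ] Field →L[ℝ] ℝ :=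
  ∑ i, ∑ j, (c.μp • pairCLM upper + c.μm • pairCLM lower).bilinearComp
    (fgrad i j + fgrad j i) (fgrad i j)

/-- The form `∫ (B · ∇u) · (B · ∇w) - g[ρ] ∫ u₂ w₂ dx₁`, the latter integral being over the
interface and written as an integral over the upper phase. -/
def potential (c : Coeffs) (B : Fin 2 → ℝ) : Field →L[ℝ] Field →L[ℝ] ℝ :=
  (∑ i, ∑ l, ∑ m, (B l * B m) • (pairCLM upper + pairCLM lower).bilinearComp
    (fgrad i m) (fgrad i l))
  + c.gJump • ((pairCLM upper).bilinearComp (fval 1) (fgrad 1 1)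
    + (pairCLM upper).bilinearComp (fgrad 1 1) (fval 1))

lemma inertia_apply (c : Coeffs) (u w : Fin 2 → L2) :
    inertia c u w = ∑ i, (c.ρp * pairCLM upper (u i) (w i) + c.ρm * pairCLM lower (u i) (w i)) := by
  simp [inertia]

lemma viscous_apply (c : Coeffs) (x y : Field) :
    viscous c x y = ∑ i, ∑ j, (c.μp * pairCLM upper (x.2 i j + x.2 j i) (y.2 i j)
      + c.μm * pairCLM lower (x.2 i j + x.2 j i) (y.2 i j)) := by
  simp [viscous]
  ring

lemma potential_apply (c : Coeffs) (B : Fin 2 → ℝ) (x y : Field) :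
    potential c B x y
      = ∑ i, ∑ l, ∑ m, B l * B m * inner ℝ (x.2 i m) (y.2 i l)
      + c.gJump * (pairCLM upper (x.1 1) (y.2 1 1) + pairCLM upper (x.2 1 1) (y.1 1)) := by
  simp [potential, ← pairCLM_upper_add_lower]
  ring

lemma inertia_comm (c : Coeffs) (u w : Fin 2 → L2) : inertia c u w = inertia c w u := by
  simp only [inertia_apply, pairCLM_comm _ (u _)]

lemma potential_comm (c : Coeffs) (B : Fin 2 → ℝ) (x y : Field) :
    potential c B x y = potential c B y x := by
  simp only [potential_apply, Fin.sum_univ_two]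
  rw [pairCLM_comm upper (x.1 1), pairCLM_comm upper (x.2 1 1)]
  simp only [real_inner_comm (y.2 _ _)]
  ring

lemma le_inertia_self (c : Coeffs) (u : Fin 2 → L2) :
    c.ρm * ∑ i, ‖u i‖ ^ 2 ≤ inertia c u u := by
  rw [inertia_apply, Finset.mul_sum]
  refine Finset.sum_le_sum fun i _ => ?_
  rw [← pairCLM_self_add]
  nlinarith [pairCLM_self_nonneg upper (u i), c.ρm_lt_ρp]

lemma inertia_self_le (c : Coeffs) (u : Fin 2 → L2) :
    inertia c u u ≤ c.ρp * ∑ i, ‖u i‖ ^ 2 := by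
  rw [inertia_apply, Finset.mul_sum]
  refine Finset.sum_le_sum fun i _ => ?_
  rw [← pairCLM_self_add]
  nlinarith [pairCLM_self_nonneg lower (u i), c.ρm_lt_ρp]

/-- The viscous density at `w = u` symmetrizes to `(μ/2) |Du + Duᵀ|²`, which is nonnegative in each
phase, so `μ` may be replaced by its minimum. With constant viscosity the cross term `∑ ∫ ∂ᵢuⱼ ∂ⱼuᵢ`
over the whole slab vanishes by `solenoidal_transpose`, which leaves exactly `‖∇u‖²`. -/
lemma korn {c : Coeffs} {x : Field} (hx : x ∈ solenoidal) :
    min c.μp c.μm * ∑ i, ∑ j, ‖x.2 i j‖ ^ 2 ≤ viscous c x x := by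
  have hsym : ∀ U, ∑ i, ∑ j, pairCLM U (x.2 i j + x.2 j i) (x.2 i j)
      = (1 / 2) * ∑ i, ∑ j, pairCLM U (x.2 i j + x.2 j i) (x.2 i j + x.2 j i) := fun U => by
    simp only [Fin.sum_univ_two, map_add, add_apply]
    rw [pairCLM_comm U (x.2 1 0) (x.2 0 1)]
    ring
  have hnn : ∀ U, 0 ≤ ∑ i, ∑ j, pairCLM U (x.2 i j + x.2 j i) (x.2 i j) := fun U => by
    rw [hsym]
    have := Finset.sum_nonneg fun i (_ : i ∈ Finset.univ) =>
      Finset.sum_nonneg fun j (_ : j ∈ Finset.univ) => pairCLM_self_nonneg U (x.2 i j + x.2 j i)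
    positivity
  have htot : ∑ i, ∑ j, pairCLM upper (x.2 i j + x.2 j i) (x.2 i j)
      + ∑ i, ∑ j, pairCLM lower (x.2 i j + x.2 j i) (x.2 i j) = ∑ i, ∑ j, ‖x.2 i j‖ ^ 2 := by
    have h0 := solenoidal_transpose hx
    simp only [← Finset.sum_add_distrib, pairCLM_upper_add_lower, inner_add_left,
      real_inner_self_eq_norm_sq, pairCLM_slab] at h0 ⊢
    rw [Finset.sum_congr rfl fun i _ => Finset.sum_add_distrib, Finset.sum_add_distrib, h0,
      add_zero]
  have hv : viscous c x x = c.μp * ∑ i, ∑ j, pairCLM upper (x.2 i j + x.2 j i) (x.2 i j)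
      + c.μm * ∑ i, ∑ j, pairCLM lower (x.2 i j + x.2 j i) (x.2 i j) := by
    rw [viscous_apply]
    simp only [Finset.mul_sum, ← Finset.sum_add_distrib]
  rw [hv, ← htot, mul_add]
  exact add_le_add (mul_le_mul_of_nonneg_right (min_le_left _ _) (hnn upper))
    (mul_le_mul_of_nonneg_right (min_le_right _ _) (hnn lower))

/-- The weak form of the system at a fixed time. -/
lemma weak_form_solenoidal {c : Coeffs} {B : Fin 2 → ℝ} {vt v η : Fin 2 → L2} {q : ℝ × ℝ → ℝ}
    {DV DN : Fin 2 → Fin 2 → L2}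
    (hDV : ∀ i j, HasWeakPartial slab j (v i) (DV i j))
    (hDN : ∀ i j, HasWeakPartial slab j (η i) (DN i j))
    (hv : ∀ i, MemH2 upper (v i) ∧ MemH2 lower (v i))
    (hη : ∀ i, MemH2 upper (η i) ∧ MemH2 lower (η i))
    (hq : ∀ j, (∃ G, HasWeakPartial upper j q G) ∧ (∃ G, HasWeakPartial lower j q G))
    (hmomu : Momentum upper c.ρp c.μp B (fun i => vt i) (fun i => v i) (fun i => η i) q)
    (hmoml : Momentum lower c.ρm c.μm B (fun i => vt i) (fun i => v i) (fun i => η i) q)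
    (hdiv : ∀ᵐ x ∂(volume.restrict slab), DV 0 0 x + DV 1 1 x = 0)
    (hjump : StressJump c B (fun i => v i) (fun i => η i) q)
    {x : Field} (hx : x ∈ solenoidal) :
    inertia c vt x.1 + viscous c (v, DV) x + potential c B (η, DN) x = 0 := by
  refine solenoidal_induction
    (P := fun x => inertia c vt x.1 + viscous c (v, DV) x + potential c B (η, DN) x = 0)
    (isClosed_eq ((((inertia c vt).continuous.comp continuous_fst).add
      (viscous c (v, DV)).continuous).add (potential c B (η, DN)).continuous)
      continuous_const) (fun ψ hψ => ?_) hx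
  have e := weak_form hDV hDN hv hη hq hmomu hmoml hdiv hjump hψ
  have a1 : ∀ (f : L2) i, pairCLM upper f ((streamField hψ).1 i) = pair upper f (curl ψ i) :=
    fun f i => pairCLM_toL2_right measurableSet_upper upper_subset_slab f (hψ.curl i)
  have a2 : ∀ (f : L2) i, pairCLM lower f ((streamField hψ).1 i) = pair lower f (curl ψ i) :=
    fun f i => pairCLM_toL2_right measurableSet_lower lower_subset_slab f (hψ.curl i)
  have a3 : ∀ (f : L2) i j, pairCLM upper f ((streamField hψ).2 i j)
      = pair upper f (classicalPartial j (curl ψ i)) :=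
    fun f i j => pairCLM_toL2_right measurableSet_upper upper_subset_slab f
      ((hψ.curl i).partial j)
  have a4 : ∀ (f : L2) i j, pairCLM lower f ((streamField hψ).2 i j)
      = pair lower f (classicalPartial j (curl ψ i)) :=
    fun f i j => pairCLM_toL2_right measurableSet_lower lower_subset_slab f
      ((hψ.curl i).partial j)
  rw [← e, inertia_apply, viscous_apply, potential_apply]
  simp only [← pairCLM_upper_add_lower, map_add, add_apply, a1, a2, a3, a4,
    Fin.sum_univ_two]
  ring

/-! ### Convergence in `L²` -/

lemma tendsto_eLpNorm_two_of_dominated {α : Type*} [MeasurableSpace α] {μ : Measure α}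
    {F : ℕ → α → ℝ} {f b : α → ℝ} (hF : ∀ n, AEStronglyMeasurable (F n) μ)
    (hf : AEStronglyMeasurable f μ) (hb : MemLp b 2 μ)
    (hbound : ∀ n, ∀ᵐ x ∂μ, |F n x - f x| ≤ |b x|)
    (hlim : ∀ᵐ x ∂μ, Tendsto (fun n => F n x) atTop (𝓝 (f x))) :
    Tendsto (fun n => eLpNorm (fun x => F n x - f x) 2 μ) atTop (𝓝 0) := by
  have h2 : ∀ g : α → ℝ, eLpNorm g 2 μ = (∫⁻ x, ‖g x‖ₑ ^ (2 : ℝ) ∂μ) ^ (1 / (2 : ℝ)) := fun g => by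
    rw [eLpNorm_eq_lintegral_rpow_enorm_toReal (by norm_num) (by norm_num)]
    simp
  simp only [h2]
  have hbi : ∫⁻ x, ‖b x‖ₑ ^ (2 : ℝ) ∂μ ≠ ⊤ := by
    have := hb.2
    rw [h2] at this
    exact fun h => by rw [h] at this; simp at this
  have key : Tendsto (fun n => ∫⁻ x, ‖F n x - f x‖ₑ ^ (2 : ℝ) ∂μ) atTop
      (𝓝 (∫⁻ _, 0 ∂μ)) := by
    refine tendsto_lintegral_of_dominated_convergence' (fun x => ‖b x‖ₑ ^ (2 : ℝ)) ?_ ?_ hbi ?_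
    · exact fun n => ((hF n).sub hf).enorm.pow_const _
    · intro n
      filter_upwards [hbound n] with x hx
      refine ENNReal.rpow_le_rpow ?_ (by norm_num)
      exact enorm_le_iff_norm_le.2 (by simpa using hx)
    · filter_upwards [hlim] with x hx
      have h0 : Tendsto (fun n => F n x - f x) atTop (𝓝 0) := by
        simpa using hx.sub_const (f x)
      have := (ENNReal.continuous_rpow_const (y := (2 : ℝ))).tendsto _ |>.comp h0.enorm
      simpa [Function.comp_def] using this
  rw [lintegral_zero] at key
  have := (ENNReal.continuous_rpow_const (y := 1 / (2 : ℝ))).tendsto _ |>.comp key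
  simpa [Function.comp_def] using this

/-- Convergence in `L²(Ω)` of functions. -/
def L2Tendsto (F : ℕ → ℝ × ℝ → ℝ) (f : ℝ × ℝ → ℝ) : Prop :=
  (∀ n, AEStronglyMeasurable (F n) (volume.restrict slab)) ∧
  AEStronglyMeasurable f (volume.restrict slab) ∧
  Tendsto (fun n => eLpNorm (fun x => F n x - f x) 2 (volume.restrict slab)) atTop (𝓝 0)

lemma L2Tendsto.add {F G : ℕ → ℝ × ℝ → ℝ} {f g : ℝ × ℝ → ℝ} (hF : L2Tendsto F f)
    (hG : L2Tendsto G g) : L2Tendsto (fun n x => F n x + G n x) (fun x => f x + g x) := by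
  refine ⟨fun n => (hF.1 n).add (hG.1 n), hF.2.1.add hG.2.1, ?_⟩
  have h := hF.2.2.add hG.2.2
  rw [add_zero] at h
  refine tendsto_of_tendsto_of_tendsto_of_le_of_le tendsto_const_nhds h (fun _ => zero_le)
    fun n => ?_
  have e : (fun x => F n x + G n x - (f x + g x))
      = (fun x => F n x - f x) + fun x => G n x - g x := by
    ext x; simp; ring
  simp only [e]
  exact eLpNorm_add_le ((hF.1 n).sub hF.2.1) ((hG.1 n).sub hG.2.1) (by norm_num)

lemma L2Tendsto.neg {F : ℕ → ℝ × ℝ → ℝ} {f : ℝ × ℝ → ℝ} (hF : L2Tendsto F f) :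
    L2Tendsto (fun n x => -F n x) (fun x => -f x) := by
  refine ⟨fun n => (hF.1 n).neg, hF.2.1.neg, hF.2.2.congr fun n => ?_⟩
  rw [← eLpNorm_neg]
  congr 1; ext x; simp; ring

lemma L2Tendsto.congr {F : ℕ → ℝ × ℝ → ℝ} {f f' : ℝ × ℝ → ℝ} (hF : L2Tendsto F f)
    (h : f =ᵐ[volume.restrict slab] f') : L2Tendsto F f' := by
  refine ⟨hF.1, hF.2.1.congr h, hF.2.2.congr fun n => eLpNorm_congr_ae ?_⟩
  filter_upwards [h] with x hx
  rw [hx]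

lemma L2Tendsto.toL2 {F : ℕ → ℝ × ℝ → ℝ} {f : L2} {U : Set (ℝ × ℝ)} (h : ∀ n, IsTest U (F n))
    (hF : L2Tendsto F f) : Tendsto (fun n => (h n).toL2) atTop (𝓝 f) := by
  rw [Lp.tendsto_Lp_iff_tendsto_eLpNorm']
  refine hF.2.2.congr fun n => eLpNorm_congr_ae ?_
  filter_upwards [(h n).coe_toL2] with x hx
  rw [Pi.sub_apply, hx]

lemma mem_solenoidal_of_tendsto {ψ : ℕ → ℝ × ℝ → ℝ} (hψ : ∀ n, IsTest slab (ψ n)) {x : Field}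
    (h1 : ∀ i, L2Tendsto (fun n => curl (ψ n) i) (x.1 i))
    (h2 : ∀ i j, L2Tendsto (fun n => classicalPartial j (curl (ψ n) i)) (x.2 i j)) :
    x ∈ solenoidal := by
  have : Tendsto (fun n => streamField (hψ n)) atTop (𝓝 x) := by
    refine Prod.tendsto_iff _ _ |>.2 ⟨tendsto_pi_nhds.2 fun i => ?_,
      tendsto_pi_nhds.2 fun i => tendsto_pi_nhds.2 fun j => ?_⟩
    · exact (h1 i).toL2 fun n => (hψ n).curl i
    · exact (h2 i j).toL2 fun n => ((hψ n).curl i).partial j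
  exact isClosed_solenoidal.mem_of_tendsto this (Eventually.of_forall fun n =>
    testFields.le_topologicalClosure ⟨_, hψ n, rfl⟩)

/-- Multiplication by bounded, pointwise convergent functions. -/
lemma L2Tendsto.mul_of_bounded {g : ℕ → ℝ × ℝ → ℝ} {K ℓ : ℝ} {f : ℝ × ℝ → ℝ}
    (hf : MemLp f 2 (volume.restrict slab)) (hg : ∀ n, Continuous (g n))
    (hb : ∀ n x, |g n x| ≤ K) (hl : ∀ x, Tendsto (fun n => g n x) atTop (𝓝 ℓ)) :
    L2Tendsto (fun n x => g n x * f x) (fun x => ℓ * f x) := by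
  have hm : ∀ n, AEStronglyMeasurable (fun x => g n x * f x) (volume.restrict slab) :=
    fun n => (hg n).aestronglyMeasurable.mul hf.1
  refine ⟨hm, hf.1.const_mul ℓ, tendsto_eLpNorm_two_of_dominated hm (hf.1.const_mul ℓ)
    (hf.const_mul (K + |ℓ|)) (fun n => Eventually.of_forall fun x => ?_)
    (Eventually.of_forall fun x => (hl x).mul_const _)⟩
  rw [← sub_mul, abs_mul, abs_mul]
  refine mul_le_mul_of_nonneg_right ?_ (abs_nonneg _)
  have := hb n x
  have h2 : |g n x - ℓ| ≤ |g n x| + |ℓ| := abs_sub _ _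
  exact (h2.trans (add_le_add_left this _)).trans (le_abs_self _)

/-! ### Mollification and dilation -/

section Mollify

variable (ρ : ContDiffBump (0 : ℝ × ℝ))

/-- The mollification of a function on the plane. -/
def mollify (f : ℝ × ℝ → ℝ) : ℝ × ℝ → ℝ := ρ.normed volume ⋆[ContinuousLinearMap.lsmul ℝ ℝ] f

lemma mollify_apply (f : ℝ × ℝ → ℝ) (x : ℝ × ℝ) :
    mollify ρ f x = ∫ t, ρ.normed volume t * f (x - t) := rfl

lemma lintegral_normed : ∫⁻ t, ENNReal.ofReal (ρ.normed volume t) = 1 := by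
  rw [← ofReal_integral_eq_lintegral_ofReal ρ.integrable_normed
    (Eventually.of_forall ρ.nonneg_normed), ρ.integral_normed, ENNReal.ofReal_one]

/-- The kernel is a probability density. Cauchy-Schwarz for that measure bounds the square of the
average by the average of the squares; Tonelli and translation invariance finish the proof. -/
lemma eLpNorm_mollify_le {f : ℝ × ℝ → ℝ} (hf : Measurable f) :
    eLpNorm (mollify ρ f) 2 volume ≤ eLpNorm f 2 volume := by
  have h2 : ∀ g : ℝ × ℝ → ℝ, eLpNorm g 2 volume = (∫⁻ x, ‖g x‖ₑ ^ (2 : ℝ)) ^ (1 / (2 : ℝ)) :=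
    fun g => by
    rw [eLpNorm_eq_lintegral_rpow_enorm_toReal (by norm_num) (by norm_num)]
    simp
  rw [h2, h2]
  refine ENNReal.rpow_le_rpow ?_ (by norm_num)
  have hρm : Measurable fun t => ENNReal.ofReal (ρ.normed volume t) :=
    (ρ.continuous_normed.measurable).ennreal_ofReal
  set ν : Measure (ℝ × ℝ) := volume.withDensity fun t => ENNReal.ofReal (ρ.normed volume t) with hν
  have hνp : IsProbabilityMeasure ν := ⟨by
    rw [hν, withDensity_apply _ MeasurableSet.univ, Measure.restrict_univ, lintegral_normed]⟩
  have hpt : ∀ x, ‖mollify ρ f x‖ₑ ^ (2 : ℝ) ≤ ∫⁻ t, ‖f (x - t)‖ₑ ^ (2 : ℝ) ∂ν := fun x => by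
    have hm : Measurable fun t => ‖f (x - t)‖ₑ := (hf.comp (measurable_const.sub measurable_id)).enorm
    have e1 : ‖mollify ρ f x‖ₑ ≤ ∫⁻ t, ‖f (x - t)‖ₑ ∂ν := by
      rw [mollify_apply]
      refine (enorm_integral_le_lintegral_enorm _).trans (le_of_eq ?_)
      rw [hν, lintegral_withDensity_eq_lintegral_mul _ hρm hm]
      refine lintegral_congr fun t => ?_
      rw [enorm_mul, Pi.mul_apply, Real.enorm_of_nonneg (ρ.nonneg_normed t)]
    have e2 := ENNReal.lintegral_mul_le_Lp_mul_Lq ν Real.HolderConjugate.two_two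
      hm.aemeasurable (aemeasurable_const (b := (1 : ℝ≥0∞)))
    simp only [Pi.mul_apply, mul_one, ENNReal.one_rpow, lintegral_const, measure_univ] at e2
    calc ‖mollify ρ f x‖ₑ ^ (2 : ℝ)
        ≤ ((∫⁻ t, ‖f (x - t)‖ₑ ^ (2 : ℝ) ∂ν) ^ (1 / (2 : ℝ))) ^ (2 : ℝ) :=
          ENNReal.rpow_le_rpow (e1.trans e2) (by norm_num)
      _ = _ := by rw [← ENNReal.rpow_mul]; norm_num
  calc ∫⁻ x, ‖mollify ρ f x‖ₑ ^ (2 : ℝ) ≤ ∫⁻ x, ∫⁻ t, ‖f (x - t)‖ₑ ^ (2 : ℝ) ∂ν :=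
        lintegral_mono hpt
    _ = ∫⁻ t, (∫⁻ x, ‖f (x - t)‖ₑ ^ (2 : ℝ)) ∂ν := by
        refine lintegral_lintegral_swap (μ := volume) (ν := ν) (Measurable.aemeasurable ?_)
        exact ((hf.comp (measurable_fst.sub measurable_snd)).enorm.pow_const _)
    _ = ∫⁻ _, (∫⁻ x, ‖f x‖ₑ ^ (2 : ℝ)) ∂ν := by
        refine lintegral_congr fun t => ?_
        exact lintegral_sub_right_eq_self (fun x => ‖f x‖ₑ ^ (2 : ℝ)) t
    _ = _ := by simp

/-- The change of variables produces the Jacobian `r⁻²`, which is at most 1. -/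
lemma eLpNorm_comp_smul_le {F : ℝ × ℝ → ℝ} (hF : Measurable F) {r : ℝ} (hr : 1 ≤ r) :
    eLpNorm (fun x => F (r • x)) 2 volume ≤ eLpNorm F 2 volume := by
  have hr0 : r ≠ 0 := by linarith
  have e : eLpNorm F 2 (Measure.map (fun x : ℝ × ℝ => r • x) volume)
      = eLpNorm (fun x => F (r • x)) 2 volume :=
    eLpNorm_map_measure hF.aestronglyMeasurable (measurable_const_smul r).aemeasurable
  rw [← e, Measure.map_addHaar_smul _ hr0]
  refine eLpNorm_mono_measure _ ?_
  refine Measure.le_iff.2 fun s _ => ?_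
  rw [Measure.smul_apply, smul_eq_mul]
  refine mul_le_of_le_one_left zero_le ?_
  rw [← ENNReal.ofReal_one]
  refine ENNReal.ofReal_le_ofReal ?_
  rw [abs_of_nonneg (by positivity)]
  exact inv_le_one_of_one_le₀ (one_le_pow₀ hr)

lemma mollify_sub {f g : ℝ × ℝ → ℝ} (hf : LocallyIntegrable f) (hg : LocallyIntegrable g)
    (x : ℝ × ℝ) : mollify ρ (fun x => f x - g x) x = mollify ρ f x - mollify ρ g x := by
  have hex : ∀ {h : ℝ × ℝ → ℝ}, LocallyIntegrable h →
      Integrable fun t => ρ.normed volume t * h (x - t) := fun {h} hh =>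
    ((ρ.hasCompactSupport_normed (μ := volume)).convolutionExists_left
      (ContinuousLinearMap.lsmul ℝ ℝ) ρ.continuous_normed hh x :)
  simp only [mollify_apply, mul_sub]
  exact integral_sub (hex hf) (hex hg)

lemma contDiff_mollify {f : ℝ × ℝ → ℝ} (hf : LocallyIntegrable f) :
    ContDiff ℝ ∞ (mollify ρ f) :=
  ρ.hasCompactSupport_normed.contDiff_convolution_left _ ρ.contDiff_normed hf

end Mollify

/-- Mollifying and then dilating is a contraction of `L²`, so it is enough to treat the dense class
of continuous functions with compact support. There the convergence is pointwise, with a common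
bound and a common compact support, and dominated convergence applies. -/
lemma tendsto_mollify_dilate {ρ : ℕ → ContDiffBump (0 : ℝ × ℝ)} {r : ℕ → ℝ}
    (hρ : Tendsto (fun n => (ρ n).rOut) atTop (𝓝 0)) (hρ1 : ∀ n, (ρ n).rOut ≤ 1)
    (hr1 : ∀ n, 1 ≤ r n) (hr : Tendsto r atTop (𝓝 1)) {f : ℝ × ℝ → ℝ} (hfm : Measurable f)
    (hf : MemLp f 2 volume) :
    Tendsto (fun n => eLpNorm (fun x => mollify (ρ n) f (r n • x) - f x) 2 volume) atTop (𝓝 0) := by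
  rw [ENNReal.tendsto_nhds_zero]
  intro ε hε
  have hε3 : ε / 3 ≠ 0 := (ENNReal.div_pos hε.ne' (by norm_num)).ne'
  obtain ⟨g, hgc, hgε, hgcont, hgm⟩ :=
    hf.exists_hasCompactSupport_eLpNorm_sub_le (by norm_num) hε3
  have hlf : LocallyIntegrable f := hf.locallyIntegrable (by norm_num)
  have hlg : LocallyIntegrable g := hgcont.locallyIntegrable
  -- the continuous part
  have hG : Tendsto (fun n => eLpNorm (fun x => mollify (ρ n) g (r n • x) - g x) 2 volume)
      atTop (𝓝 0) := by
    obtain ⟨M, hM⟩ := hgc.exists_bound_of_continuous hgcont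
    have hM0 : 0 ≤ M := (norm_nonneg _).trans (hM 0)
    obtain ⟨R, hR⟩ := hgc.isBounded.subset_closedBall (0 : ℝ × ℝ)
    have hcm : ∀ n, Continuous fun x => mollify (ρ n) g (r n • x) := fun n =>
      (contDiff_mollify (ρ n) hlg).continuous.comp (continuous_const_smul _)
    have hbm : ∀ n y, |mollify (ρ n) g y| ≤ M := fun n y => by
      rw [mollify_apply, ← Real.norm_eq_abs]
      calc ‖∫ t, (ρ n).normed volume t * g (y - t)‖
          ≤ ∫ t, (ρ n).normed volume t * M := by
            refine norm_integral_le_of_norm_le ((ρ n).integrable_normed.mul_const M)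
              (Eventually.of_forall fun t => ?_)
            rw [norm_mul, Real.norm_of_nonneg ((ρ n).nonneg_normed t)]
            exact mul_le_mul_of_nonneg_left (hM _) ((ρ n).nonneg_normed t)
        _ = M := by rw [integral_mul_const, (ρ n).integral_normed, one_mul]
    have hzero : ∀ n x, R + 1 < ‖x‖ → mollify (ρ n) g (r n • x) = 0 ∧ g x = 0 := fun n x hx => by
      have hz : ∀ y, R < ‖y‖ → g y = 0 := fun y hy =>
        image_eq_zero_of_notMem_tsupport fun h => by
          have := hR h
          rw [mem_closedBall_zero_iff] at this
          linarith
      refine ⟨?_, hz x (by linarith)⟩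
      rw [mollify_apply]
      refine integral_eq_zero_of_ae (Eventually.of_forall fun t => ?_)
      simp only [Pi.zero_apply]
      by_cases ht : ‖t‖ < (ρ n).rOut
      · rw [hz _ ?_, mul_zero]
        have h1 : ‖x‖ ≤ ‖r n • x‖ := by
          rw [norm_smul, Real.norm_of_nonneg (by linarith [hr1 n])]
          nlinarith [norm_nonneg x, hr1 n]
        have h2 : ‖r n • x‖ - ‖t‖ ≤ ‖r n • x - t‖ := norm_sub_norm_le _ _
        linarith [hρ1 n]
      · have : t ∉ Function.support ((ρ n).normed volume) := by
          rw [(ρ n).support_normed_eq, mem_ball_zero_iff]; exact ht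
        rw [Function.notMem_support.1 this, zero_mul]
    refine tendsto_eLpNorm_two_of_dominated
      (b := (Metric.closedBall (0 : ℝ × ℝ) (R + 1)).indicator fun _ => M + M)
      (fun n => (hcm n).aestronglyMeasurable) hgcont.aestronglyMeasurable ?_ (fun n => ?_) ?_
    · refine (memLp_indicator_const 2 Metric.isClosed_closedBall.measurableSet _ (Or.inr ?_))
      exact (isCompact_closedBall _ _).measure_lt_top.ne
    · refine Eventually.of_forall fun x => ?_
      by_cases hx : ‖x‖ ≤ R + 1
      · rw [indicator_of_mem (by simpa using hx), abs_of_nonneg (by linarith : 0 ≤ M + M)]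
        exact (abs_sub _ _).trans (add_le_add (hbm n _) (by simpa using hM x))
      · rw [(hzero n x (not_le.1 hx)).1, (hzero n x (not_le.1 hx)).2]
        simp
    · refine Eventually.of_forall fun x => ?_
      refine ContDiffBump.convolution_tendsto_right (g := fun _ => g) hρ
        (Eventually.of_forall fun _ => hgcont.aestronglyMeasurable)
        ((hgcont.tendsto x).comp tendsto_snd) ?_
      simpa using hr.smul_const x
  have hev := (ENNReal.tendsto_nhds_zero.1 hG) (ε / 3) (pos_iff_ne_zero.2 hε3)
  filter_upwards [hev] with n hn
  have hfg : Measurable fun x => f x - g x := hfm.sub hgcont.measurable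
  have hlfg : LocallyIntegrable fun x => f x - g x := hlf.sub hlg
  have e : (fun x => mollify (ρ n) f (r n • x) - f x)
      = ((fun x => mollify (ρ n) (fun x => f x - g x) (r n • x))
        + fun x => mollify (ρ n) g (r n • x) - g x) - fun x => f x - g x := by
    ext x
    simp only [Pi.add_apply, Pi.sub_apply, mollify_sub (ρ n) hlf hlg]
    ring
  have m1 : Measurable fun x => mollify (ρ n) (fun x => f x - g x) (r n • x) :=
    (contDiff_mollify (ρ n) hlfg).continuous.measurable.comp (measurable_const_smul _)
  have m2 : Measurable fun x => mollify (ρ n) g (r n • x) - g x :=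
    ((contDiff_mollify (ρ n) hlg).continuous.measurable.comp (measurable_const_smul _)).sub
      hgcont.measurable
  have b1 : eLpNorm (fun x => mollify (ρ n) (fun x => f x - g x) (r n • x)) 2 volume ≤ ε / 3 :=
    ((eLpNorm_comp_smul_le (contDiff_mollify (ρ n) hlfg).continuous.measurable (hr1 n)).trans
      (eLpNorm_mollify_le (ρ n) hfg)).trans hgε
  rw [e]
  calc _ ≤ _ := eLpNorm_sub_le (m1.add m2).aestronglyMeasurable hfg.aestronglyMeasurable
        (by norm_num)
    _ ≤ (ε / 3 + ε / 3) + ε / 3 :=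
      add_le_add ((eLpNorm_add_le m1.aestronglyMeasurable m2.aestronglyMeasurable
        (by norm_num)).trans (add_le_add b1 hn)) hgε
    _ = ε := by rw [ENNReal.add_thirds]

/-! ### Extension by zero -/

/-- A function with zero traces on both sides of the slab has a weakly differentiable extension
by zero (vertical derivative). -/
lemma pair_vertical_of_zero_trace {u g φ : ℝ × ℝ → ℝ} (hug : HasWeakPartial slab 1 u g)
    (hl : HasLowerTrace (-1) 1 u 0) (hu : HasUpperTrace (-1) 1 u 0) (hφ : IsTest univ φ) :
    pair slab u (classicalPartial 1 φ) = -pair slab g φ := by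
  obtain ⟨-, hul, g₁, hg₁, hg₁l, h₁⟩ := hl
  obtain ⟨-, -, g₂, hg₂, hg₂l, h₂⟩ := hu
  have e₁ : g =ᵐ[volume.restrict slab] g₁ := hug.unique (isOpen_strip _ _) hg₁
  have e₂ : g =ᵐ[volume.restrict slab] g₂ := hug.unique (isOpen_strip _ _) hg₂
  have hgl : LocallyIntegrable g (volume.restrict slab) := hg₁l.congr e₁.symm
  -- A smooth step in `x₂`, equal to 0 below `-1/2` and to 1 above `1/2`. It splits `φ` into a part
  -- vanishing near the lower wall and one vanishing near the upper wall, so that each part is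
  -- admissible in one of the two Green formulas.
  set s : ℝ → ℝ := fun y => Real.smoothTransition (y + 1 / 2) with hs
  have hsc : ContDiff ℝ ∞ s := Real.smoothTransition.contDiff.comp (contDiff_id.add contDiff_const)
  have t₂ : IsTest (univ ×ˢ Ioi (-1 : ℝ)) fun x => s x.2 * φ x := by
    refine hφ.mul_left (hsc.comp contDiff_snd) fun x hx => ⟨mem_univ _, ?_⟩
    have : tsupport (fun x : ℝ × ℝ => s x.2) ⊆ {x | -(1 / 2) ≤ x.2} := by
      refine closure_minimal (fun x hx => ?_) (isClosed_le continuous_const continuous_snd)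
      by_contra h
      exact hx (Real.smoothTransition.zero_of_nonpos (by simp at h; linarith))
    have := this hx.2
    simp only [mem_ofPred_eq] at this
    exact mem_Ioi.2 (by linarith)
  have t₁ : IsTest (univ ×ˢ Iio (1 : ℝ)) fun x => (1 - s x.2) * φ x := by
    refine hφ.mul_left ((contDiff_const.sub hsc).comp contDiff_snd) fun x hx => ⟨mem_univ _, ?_⟩
    have : tsupport (fun x : ℝ × ℝ => 1 - s x.2) ⊆ {x | x.2 ≤ 1 / 2} := by
      refine closure_minimal (fun x hx => ?_) (isClosed_le continuous_snd continuous_const)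
      by_contra h
      refine hx ?_
      simp only [hs]
      rw [Real.smoothTransition.one_of_one_le (by simp at h; linarith), sub_self]
    have := this hx.2
    simp only [mem_ofPred_eq] at this
    exact mem_Iio.2 (by linarith)
  have a₁ := h₁ _ t₁
  have a₂ := h₂ _ t₂
  simp only [Pi.zero_apply, zero_mul, integral_zero, neg_zero] at a₁ a₂
  rw [integral_add ((t₁.partial 1).integrable_mul hul) (t₁.integrable_mul hg₁l)] at a₁
  rw [integral_add ((t₂.partial 1).integrable_mul hul) (t₂.integrable_mul hg₂l)] at a₂
  change pair slab u _ + pair slab g₁ _ = 0 at a₁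
  change pair slab u _ + pair slab g₂ _ = 0 at a₂
  rw [← pair_congr_left e₁] at a₁
  rw [← pair_congr_left e₂] at a₂
  have s₁ : ∀ {f : ℝ × ℝ → ℝ} {V W : Set (ℝ × ℝ)} {χ θ : ℝ × ℝ → ℝ}, IsTest V χ → IsTest W θ →
      LocallyIntegrable f (volume.restrict slab) →
      pair slab f χ + pair slab f θ = pair slab f fun x => χ x + θ x := by
    intro f V W χ θ hχ hθ hf
    simp only [pair, mul_add]
    exact (integral_add (hχ.integrable_mul hf) (hθ.integrable_mul hf)).symm
  have d : (fun x => (1 - s x.2) * φ x + s x.2 * φ x) = φ := by ext x; ring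
  have d' : (fun x => classicalPartial 1 (fun x => (1 - s x.2) * φ x) x
      + classicalPartial 1 (fun x => s x.2 * φ x) x) = classicalPartial 1 φ := by
    ext x
    rw [← classicalPartial_add (t₁.smooth.differentiable (by simp) x)
      (t₂.smooth.differentiable (by simp) x), d]
  have b₁ := s₁ (t₁.partial 1) (t₂.partial 1) hul
  have b₂ := s₁ t₁ t₂ hgl
  rw [d'] at b₁
  rw [d] at b₂
  linarith

/-- The mollified extension by zero. -/
lemma classicalPartial_mollify (ρ : ContDiffBump (0 : ℝ × ℝ)) {f g : ℝ × ℝ → ℝ} {j : Fin 2}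
    (hf : LocallyIntegrable (slab.indicator f))
    (h : ∀ φ, IsTest univ φ → pair slab f (classicalPartial j φ) = -pair slab g φ) (x : ℝ × ℝ) :
    classicalPartial j (mollify ρ (slab.indicator f)) x = mollify ρ (slab.indicator g) x := by
  have hflip : ∀ f : ℝ × ℝ → ℝ, mollify ρ f
      = f ⋆[(ContinuousLinearMap.lsmul ℝ ℝ).flip] ρ.normed volume := fun f => by
    rw [convolution_flip]; rfl
  have hd := ρ.hasCompactSupport_normed (μ := volume) |>.hasFDerivAt_convolution_right
    (ContinuousLinearMap.lsmul ℝ ℝ (E := ℝ)).flip hf (ρ.contDiff_normed (n := 1)) x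
  -- The reflected and translated kernel is an admissible test function. Testing `h` with it moves
  -- the derivative from the kernel onto `f`; the sign from the reflection cancels the one in `h`.
  have hct : IsTest univ fun t => ρ.normed volume (x - t) :=
    ⟨ρ.contDiff_normed.comp (contDiff_const.sub contDiff_id),
      ρ.hasCompactSupport_normed.comp_homeomorph (Homeomorph.subLeft x), subset_univ _⟩
  have hcp : ∀ t, classicalPartial j (fun t => ρ.normed volume (x - t)) t
      = -classicalPartial j (ρ.normed volume) (x - t) := fun t => by
    have h1 : HasFDerivAt (ρ.normed volume) (fderiv ℝ (ρ.normed volume) (x - t)) (x - t) :=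
      ((ρ.contDiff_normed (n := 1)).differentiable (by simp) _).hasFDerivAt
    have h2 : HasFDerivAt (fun t : ℝ × ℝ => x - t) (-ContinuousLinearMap.id ℝ (ℝ × ℝ)) t :=
      (hasFDerivAt_id t).const_sub x
    have := (h1.comp t h2).fderiv
    simp only [classicalPartial]
    change fderiv ℝ (ρ.normed volume ∘ fun t => x - t) t (dir j) = _
    rw [this]
    simp
  have hind : ∀ u v : ℝ × ℝ → ℝ, ∫ t, slab.indicator u t * v t = ∫ t in slab, u t * v t :=
    fun u v => by
    rw [← integral_indicator measurableSet_slab]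
    congr 1; ext t
    by_cases ht : t ∈ slab <;> simp [ht]
  rw [hflip, hflip]
  simp only [classicalPartial]
  rw [hd.fderiv, convolution_precompR_apply _ hf (ρ.hasCompactSupport_normed.fderiv ℝ)
    ((ρ.contDiff_normed (n := 1)).continuous_fderiv (by simp))]
  simp only [convolution_def, ContinuousLinearMap.flip_apply, ContinuousLinearMap.lsmul_apply,
    smul_eq_mul]
  have e := h _ hct
  simp only [pair, hcp, mul_neg, integral_neg, neg_inj] at e
  rw [← hind, ← hind] at e
  simp only [mul_comm (fderiv ℝ _ _ _), mul_comm (ρ.normed volume _)]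
  exact e

/-! ### Stream functions -/

lemma fderiv_apply_eq (f : ℝ × ℝ → ℝ) (x y : ℝ × ℝ) :
    fderiv ℝ f x y = y.1 * classicalPartial 0 f x + y.2 * classicalPartial 1 f x := by
  have : y = y.1 • dir 0 + y.2 • dir 1 := by ext <;> simp [dir]
  conv_lhs => rw [this]
  simp [classicalPartial]

/-- The one-form `w₁ dx₂ - w₂ dx₁` is closed because `div w = 0`, and therefore exact on the plane.
-/
lemma exists_stream {w : Fin 2 → ℝ × ℝ → ℝ} (hw : ∀ i, ContDiff ℝ ∞ (w i))
    (hdiv : ∀ x, classicalPartial 0 (w 0) x + classicalPartial 1 (w 1) x = 0) :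
    ∃ ψ : ℝ × ℝ → ℝ, ContDiff ℝ ∞ ψ ∧ (∀ x, classicalPartial 1 ψ x = w 0 x) ∧
      ∀ x, classicalPartial 0 ψ x = -w 1 x := by
  set ξ : ℝ × ℝ → (ℝ × ℝ →L[ℝ] ℝ) := fun x =>
    w 0 x • ContinuousLinearMap.snd ℝ ℝ ℝ - w 1 x • ContinuousLinearMap.fst ℝ ℝ ℝ with hξ
  have hξs : ContDiff ℝ ∞ ξ := ((hw 0).smul contDiff_const).sub ((hw 1).smul contDiff_const)
  have hd : ∀ i x, DifferentiableAt ℝ (w i) x := fun i x => (hw i).differentiable (by simp) x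
  have hfd : ∀ a, fderiv ℝ ξ a = (fderiv ℝ (w 0) a).smulRight (ContinuousLinearMap.snd ℝ ℝ ℝ)
      - (fderiv ℝ (w 1) a).smulRight (ContinuousLinearMap.fst ℝ ℝ ℝ) := fun a =>
    (((hd 0 a).hasFDerivAt.smul_const _).sub ((hd 1 a).hasFDerivAt.smul_const _)).fderiv
  obtain ⟨ψ, hψ⟩ := convex_univ.exists_forall_hasFDerivAt_of_fderiv_symmetric (s := univ)
    isOpen_univ (hξs.differentiable (by simp)).differentiableOn (fun a _ x y => by
      rw [hfd]
      simp only [sub_apply, ContinuousLinearMap.smulRight_apply, smul_apply,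
        ContinuousLinearMap.coe_snd', ContinuousLinearMap.coe_fst', smul_eq_mul,
        fderiv_apply_eq (w 0), fderiv_apply_eq (w 1)]
      linear_combination (x.1 * y.2 - y.1 * x.2) * hdiv a)
  have hf : fderiv ℝ ψ = ξ := funext fun x => (hψ x (mem_univ x)).fderiv
  refine ⟨ψ, ?_, fun x => ?_, fun x => ?_⟩
  · rw [contDiff_infty_iff_fderiv, hf]
    exact ⟨fun x => (hψ x (mem_univ x)).differentiableAt, hξs⟩
  · simp [classicalPartial, hf, hξ, dir]
  · simp [classicalPartial, hf, hξ, dir]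

lemma hasDerivAt_vertical {f : ℝ × ℝ → ℝ} (hf : Differentiable ℝ f) (s y : ℝ) :
    HasDerivAt (fun y => f (s, y)) (classicalPartial 1 f (s, y)) y := by
  have h2 : HasDerivAt (fun y : ℝ => (s, y)) ((0 : ℝ), (1 : ℝ)) y :=
    (hasDerivAt_const y s).prodMk (hasDerivAt_id y)
  exact (hf (s, y)).hasFDerivAt.comp_hasDerivAt y h2

/-- A smooth divergence free field supported in a smaller strip has a stream function vanishing
outside that strip and square integrable over the slab. -/
lemma exists_stream_of_strip {w : Fin 2 → ℝ × ℝ → ℝ} (hw : ∀ i, ContDiff ℝ ∞ (w i))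
    (hdiv : ∀ x, classicalPartial 0 (w 0) x + classicalPartial 1 (w 1) x = 0) {r : ℝ}
    (hr1 : r < 1) (hsupp : ∀ i x, r ≤ |x.2| → w i x = 0) (hL : MemLp (w 0) 2 volume) :
    ∃ ψ : ℝ × ℝ → ℝ, ContDiff ℝ ∞ ψ ∧ (∀ x, classicalPartial 1 ψ x = w 0 x) ∧
      (∀ x, classicalPartial 0 ψ x = -w 1 x) ∧ (∀ x, r ≤ |x.2| → ψ x = 0) ∧
      MemLp ψ 2 (volume.restrict slab) := by
  obtain ⟨ψ₀, h0s, h01, h00⟩ := exists_stream hw hdiv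
  -- The additive constant is fixed so that the stream function vanishes on the lower half plane
  -- outside the support of `w`.
  set ψ : ℝ × ℝ → ℝ := fun x => ψ₀ x + -ψ₀ (0, -1) with hψ
  have hs : ContDiff ℝ ∞ ψ := h0s.add contDiff_const
  have hpd : ∀ j x, classicalPartial j ψ x = classicalPartial j ψ₀ x := fun j x => by
    simp [classicalPartial, hψ, fderiv_add_const]
  have hp1 : ∀ x, classicalPartial 1 ψ x = w 0 x := fun x => (hpd 1 x).trans (h01 x)
  have hp0 : ∀ x, classicalPartial 0 ψ x = -w 1 x := fun x => (hpd 0 x).trans (h00 x)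
  have hdiff : Differentiable ℝ ψ := hs.differentiable (by simp)
  have hfz : ∀ x : ℝ × ℝ, r ≤ |x.2| → fderiv ℝ ψ x = 0 := fun x hx => by
    ext
    all_goals simp [fderiv_apply_eq ψ, hp0, hp1, hsupp _ x hx]
  have hconst : ∀ {S : Set (ℝ × ℝ)}, Convex ℝ S → (∀ x ∈ S, r ≤ |x.2|) → ∀ x ∈ S, ∀ y ∈ S,
      ψ x = ψ y := by
    intro S hS hSr x hx y hy
    have := hS.norm_image_sub_le_of_norm_hasFDerivWithin_le (f := ψ) (f' := fun _ => 0) (C := 0)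
      (fun z hz => by
        have := (hdiff z).hasFDerivAt
        rw [hfz z (hSr z hz)] at this
        exact this.hasFDerivWithinAt) (fun z _ => by simp) hx hy
    rw [zero_mul] at this
    have := norm_le_zero_iff.1 this
    linarith
  have hlow : ∀ x : ℝ × ℝ, x.2 ≤ -r → ψ x = 0 := fun x hx => by
    have := hconst (S := {x : ℝ × ℝ | x.2 ≤ -r})
      (convex_halfSpace_le (LinearMap.snd ℝ ℝ ℝ).isLinear (-r))
      (fun z hz => by rw [le_abs]; right; linarith [show z.2 ≤ -r from hz]) x hx (0, -1)
      (by simp only [mem_ofPred_eq]; linarith)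
    rw [this]; simp [hψ]
  set G : ℝ → ℝ := fun s => ∫ y in Ioo (-1 : ℝ) 1, w 0 (s, y) ^ 2 with hG
  have hGi : Integrable G := integrable_setIntegral_strip (F := fun x => w 0 x ^ 2) hL.integrable_sq
  -- Cauchy-Schwarz along the vertical segment starting at the lower wall. The factor 2 bounds its
  -- length.
  have hbound : ∀ s y, -1 ≤ y → y ≤ 1 → ψ (s, y) ^ 2 ≤ 2 * G s := fun s y hy hy' => by
    have hc : Continuous fun y => w 0 (s, y) := (hw 0).continuous.comp (by fun_prop)
    have e1 : ∫ z in (-1 : ℝ)..y, w 0 (s, z) = ψ (s, y) - ψ (s, -1) :=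
      intervalIntegral.integral_eq_sub_of_hasDerivAt
        (fun z _ => by simpa [hp1] using hasDerivAt_vertical hdiff s z) (hc.intervalIntegrable _ _)
    rw [hlow (s, -1) (by simp; linarith), sub_zero] at e1
    have e2 := sq_intervalIntegral_le hy (hc.intervalIntegrable _ _)
      ((hc.pow 2).intervalIntegrable _ _)
    have e3 : ∫ z in (-1 : ℝ)..y, w 0 (s, z) ^ 2 ≤ G s := by
      rw [hG]
      simp only
      rw [← integral_Ioc_eq_integral_Ioo, ← intervalIntegral.integral_of_le (by norm_num)]
      exact intervalIntegral.integral_mono_interval le_rfl hy hy'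
        (Eventually.of_forall fun z => sq_nonneg _) ((hc.pow 2).intervalIntegrable _ _)
    have e4 : 0 ≤ ∫ z in (-1 : ℝ)..y, w 0 (s, z) ^ 2 :=
      intervalIntegral.integral_nonneg hy fun z _ => sq_nonneg _
    rw [e1] at e2
    nlinarith
  have hup : ∀ x : ℝ × ℝ, r ≤ x.2 → ψ x = 0 := by
    have hc : ∀ x : ℝ × ℝ, r ≤ x.2 → ψ x = ψ (0, 1) := fun x hx =>
      hconst (S := {x : ℝ × ℝ | r ≤ x.2})
        (convex_halfSpace_ge (LinearMap.snd ℝ ℝ ℝ).isLinear r)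
        (fun z hz => by rw [le_abs]; left; exact hz) x hx (0, 1)
        (by simp only [mem_ofPred_eq]; linarith)
    have hi : Integrable fun _ : ℝ => ψ (0, 1) ^ 2 := by
      refine (hGi.const_mul 2).mono' aestronglyMeasurable_const (Eventually.of_forall fun s => ?_)
      rw [Real.norm_of_nonneg (sq_nonneg _), ← hc (s, 1) hr1.le]
      exact hbound s 1 (by norm_num) le_rfl
    rw [integrable_const_iff] at hi
    -- Above the strip `ψ` is a constant, the horizontal flux through a cross section. Its square is
    -- dominated by the integrable function `2G` on the whole line, so the flux must be zero.
    rcases hi with h | h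
    · intro x hx
      rw [hc x hx]
      exact pow_eq_zero_iff (by norm_num) |>.1 h
    · have := h.measure_univ_lt_top
      simp at this
  refine ⟨ψ, hs, hp1, hp0, fun x hx => ?_, ?_⟩
  · rcases le_abs.1 hx with h | h
    · exact hup x h
    · exact hlow x (by linarith)
  · rw [memLp_two_iff_integrable_sq hs.continuous.aestronglyMeasurable]
    have hpr : volume.restrict slab
        = (volume : Measure ℝ).prod (volume.restrict (Ioo (-1 : ℝ) 1)) := by
      unfold slab strip
      rw [Measure.volume_eq_prod, ← Measure.prod_restrict, Measure.restrict_univ]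
    have hi : Integrable (fun x : ℝ × ℝ => 2 * G x.1) (volume.restrict slab) := by
      rw [hpr]; exact (hGi.const_mul 2).comp_fst _
    refine hi.mono' (hs.continuous.pow 2).aestronglyMeasurable ?_
    filter_upwards [ae_restrict_mem measurableSet_slab] with x hx
    rw [Real.norm_of_nonneg (sq_nonneg _)]
    have := mem_strip.1 hx
    exact hbound x.1 x.2 this.1.le this.2.le

/-- Horizontal cutoff functions with decaying derivatives. -/
lemma exists_horizontal_cutoff : ∃ (g g' g'' : ℕ → ℝ → ℝ) (K : ℝ),
    (∀ n, ContDiff ℝ ∞ (g n) ∧ ContDiff ℝ ∞ (g' n) ∧ Continuous (g'' n)) ∧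
    (∀ n, deriv (g n) = g' n ∧ deriv (g' n) = g'' n) ∧
    (∀ n, ∃ R, ∀ s, R < |s| → g n s = 0) ∧
    (∀ n s, |g n s| ≤ K ∧ |g' n s| ≤ K ∧ |g'' n s| ≤ K) ∧
    ∀ s, Tendsto (fun n => g n s) atTop (𝓝 1) ∧ Tendsto (fun n => g' n s) atTop (𝓝 0) ∧
      Tendsto (fun n => g'' n s) atTop (𝓝 0) := by
  let β : ContDiffBump (0 : ℝ) := ⟨1, 2, by norm_num, by norm_num⟩
  have hβ : ContDiff ℝ ∞ β := β.contDiff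
  have hβ' : ContDiff ℝ ∞ (deriv β) := (contDiff_infty_iff_deriv.1 hβ).2
  have hβ'' : ContDiff ℝ ∞ (deriv (deriv β)) := (contDiff_infty_iff_deriv.1 hβ').2
  have c0 : HasCompactSupport β := β.hasCompactSupport
  obtain ⟨K0, hK0⟩ := c0.exists_bound_of_continuous hβ.continuous
  obtain ⟨K1, hK1⟩ := c0.deriv.exists_bound_of_continuous hβ'.continuous
  obtain ⟨K2, hK2⟩ := c0.deriv.deriv.exists_bound_of_continuous hβ''.continuous
  have hK0' : 0 ≤ K0 := (norm_nonneg _).trans (hK0 0)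
  have hK1' : 0 ≤ K1 := (norm_nonneg _).trans (hK1 0)
  have hK2' : 0 ≤ K2 := (norm_nonneg _).trans (hK2 0)
  set a : ℕ → ℝ := fun n => 1 / ((n : ℝ) + 1) with ha
  have a0 : ∀ n, 0 < a n := fun n => by simp only [ha]; positivity
  have a1 : ∀ n, a n ≤ 1 := fun n => by
    simp only [ha]; rw [div_le_one (by positivity)]; linarith [n.cast_nonneg (α := ℝ)]
  have al : Tendsto a atTop (𝓝 0) := tendsto_one_div_add_atTop_nhds_zero_nat
  have dcomp : ∀ {f : ℝ → ℝ} (n : ℕ), Differentiable ℝ f →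
      deriv (fun s => f (a n * s)) = fun s => a n * deriv f (a n * s) := by
    intro f n hf
    ext s
    have h2 : HasDerivAt (fun s : ℝ => a n * s) (a n) s := by
      simpa using (hasDerivAt_id s).const_mul (a n)
    have := ((hf (a n * s)).hasDerivAt.comp s h2).deriv
    rw [mul_comm]; exact this
  have lim : ∀ s, Tendsto (fun n => a n * s) atTop (𝓝 0) := fun s => by
    simpa using al.mul_const s
  refine ⟨fun n s => β (a n * s), fun n s => a n * deriv β (a n * s),
    fun n s => a n * (a n * deriv (deriv β) (a n * s)), K0 + K1 + K2, fun n => ⟨?_, ?_, ?_⟩,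
    fun n => ⟨?_, ?_⟩, fun n => ⟨2 / a n, fun s hs => ?_⟩, fun n s => ⟨?_, ?_, ?_⟩,
    fun s => ⟨?_, ?_, ?_⟩⟩
  · exact hβ.comp (contDiff_const.mul contDiff_id)
  · exact contDiff_const.mul (hβ'.comp (contDiff_const.mul contDiff_id))
  · exact continuous_const.mul (continuous_const.mul (hβ''.continuous.comp
      (continuous_const.mul continuous_id)))
  · exact dcomp n (hβ.differentiable (by simp))
  · have := dcomp n (hβ'.differentiable (by simp))
    ext s
    have hdf : DifferentiableAt ℝ (fun s => deriv β (a n * s)) s :=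
      ((hβ'.differentiable (by simp)).comp (differentiable_id.const_mul (a n))) s
    exact (deriv_const_mul (a n) hdf).trans (congrArg (a n * ·) (congrFun this s))
  · refine β.zero_of_le_dist ?_
    rw [Real.dist_eq, sub_zero, abs_mul, abs_of_pos (a0 n)]
    rw [div_lt_iff₀ (a0 n)] at hs
    change (2 : ℝ) ≤ _
    linarith
  · have := hK0 (a n * s)
    rw [Real.norm_eq_abs] at this
    linarith
  · have := hK1 (a n * s)
    rw [Real.norm_eq_abs] at this
    rw [abs_mul, abs_of_pos (a0 n)]
    nlinarith [a0 n, a1 n, abs_nonneg (deriv β (a n * s))]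
  · have := hK2 (a n * s)
    rw [Real.norm_eq_abs] at this
    rw [abs_mul, abs_mul, abs_of_pos (a0 n), ← mul_assoc]
    have h1 : a n * a n ≤ 1 := by nlinarith [a0 n, a1 n]
    nlinarith [a0 n, abs_nonneg (deriv (deriv β) (a n * s))]
  · have := (hβ.continuous.tendsto 0).comp (lim s)
    rw [β.one_of_mem_closedBall (by simp [β])] at this
    exact this
  · simpa using al.mul ((hβ'.continuous.tendsto 0).comp (lim s))
  · simpa using al.mul (al.mul ((hβ''.continuous.tendsto 0).comp (lim s)))

/-- Smooth square integrable divergence free fields supported in a smaller strip. -/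
lemma mem_solenoidal_of_smooth {w : Fin 2 → ℝ × ℝ → ℝ} (hw : ∀ i, ContDiff ℝ ∞ (w i))
    (hdiv : ∀ x, classicalPartial 0 (w 0) x + classicalPartial 1 (w 1) x = 0) {r : ℝ}
    (hr1 : r < 1) (hsupp : ∀ i x, r ≤ |x.2| → w i x = 0) (hL : ∀ i, MemLp (w i) 2 volume)
    (hL' : ∀ i j, MemLp (classicalPartial j (w i)) 2 volume) {X : Field}
    (hX : ∀ i, X.1 i =ᵐ[volume.restrict slab] w i)
    (hX' : ∀ i j, X.2 i j =ᵐ[volume.restrict slab] classicalPartial j (w i)) :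
    X ∈ solenoidal := by
  obtain ⟨ψ, hs, h1, h0, hz, hψ⟩ := exists_stream_of_strip hw hdiv hr1 hsupp (hL 0)
  obtain ⟨g, g', g'', K, hc, hd, hR, hb, hl⟩ := exists_horizontal_cutoff
  have hgs : ∀ n, ContDiff ℝ ∞ fun x : ℝ × ℝ => g n x.1 := fun n => (hc n).1.comp contDiff_fst
  have hgs' : ∀ n, ContDiff ℝ ∞ fun x : ℝ × ℝ => g' n x.1 := fun n => (hc n).2.1.comp contDiff_fst
  have pg : ∀ n j x, classicalPartial j (fun x : ℝ × ℝ => g n x.1) x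
      = if j = 0 then g' n x.1 else 0 := fun n j x => by
    rw [classicalPartial_fst ((hc n).1.differentiable (by simp)), (hd n).1]
  have pg' : ∀ n j x, classicalPartial j (fun x : ℝ × ℝ => g' n x.1) x
      = if j = 0 then g'' n x.1 else 0 := fun n j x => by
    rw [classicalPartial_fst ((hc n).2.1.differentiable (by simp)), (hd n).2]
  have dg : ∀ n x, DifferentiableAt ℝ (fun x : ℝ × ℝ => g n x.1) x :=
    fun n x => (hgs n).differentiable (by simp) x
  have dg' : ∀ n x, DifferentiableAt ℝ (fun x : ℝ × ℝ => g' n x.1) x :=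
    fun n x => (hgs' n).differentiable (by simp) x
  have dψ : ∀ x, DifferentiableAt ℝ ψ x := fun x => hs.differentiable (by simp) x
  have dw : ∀ i x, DifferentiableAt ℝ (w i) x := fun i x => (hw i).differentiable (by simp) x
  -- The stream function is cut off rather than the field: the curl of the product stays divergence
  -- free.
  have test : ∀ n, IsTest slab fun x => g n x.1 * ψ x := fun n => by
    obtain ⟨R, hR⟩ := hR n
    have hcl : tsupport (fun x => g n x.1 * ψ x) ⊆ Icc (-R) R ×ˢ Icc (-r) r := by
      refine closure_minimal (fun x hx => ?_) (isClosed_Icc.prod isClosed_Icc)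
      have hx1 : |x.1| ≤ R := by
        by_contra h
        exact hx (by simp [hR _ (not_le.1 h)])
      have hx2 : |x.2| ≤ r := by
        by_contra h
        exact hx (by simp [hz _ (not_le.1 h).le])
      exact ⟨abs_le.1 hx1, abs_le.1 hx2⟩
    refine ⟨(hgs n).mul hs, (isCompact_Icc.prod isCompact_Icc).of_isClosed_subset
      (isClosed_tsupport _) hcl, hcl.trans fun x hx => mem_strip.2 ⟨?_, ?_⟩⟩
    · linarith [hx.2.1]
    · linarith [hx.2.2]
  have c0 : ∀ n, curl (fun x => g n x.1 * ψ x) 0 = fun x => g n x.1 * w 0 x := fun n => by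
    ext x
    change classicalPartial 1 _ x = _
    rw [classicalPartial_mul (dg n x) (dψ x), pg, h1]
    simp
  -- The price of the cutoff is a term with `g'ψ`, and one with `g''ψ` in the gradient. They tend to
  -- 0 in `L²` because `ψ` itself is square integrable over the slab.
  have c1 : ∀ n, curl (fun x => g n x.1 * ψ x) 1 = fun x => g n x.1 * w 1 x + -(g' n x.1 * ψ x) :=
    fun n => by
    ext x
    change -classicalPartial 0 _ x = _
    rw [classicalPartial_mul (dg n x) (dψ x), pg, h0]
    simp
    ring
  have rs : ∀ {f : ℝ × ℝ → ℝ}, MemLp f 2 volume → MemLp f 2 (volume.restrict slab) :=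
    fun h => h.mono_measure Measure.restrict_le_self
  have T0 : ∀ {f : ℝ × ℝ → ℝ}, MemLp f 2 (volume.restrict slab) →
      L2Tendsto (fun n x => g n x.1 * f x) (fun x => 1 * f x) := fun hf =>
    L2Tendsto.mul_of_bounded hf (fun n => (hgs n).continuous) (fun n x => (hb n x.1).1)
      fun x => (hl x.1).1
  have T1 : ∀ {f : ℝ × ℝ → ℝ}, MemLp f 2 (volume.restrict slab) →
      L2Tendsto (fun n x => g' n x.1 * f x) (fun x => 0 * f x) := fun hf =>
    L2Tendsto.mul_of_bounded hf (fun n => (hgs' n).continuous) (fun n x => (hb n x.1).2.1)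
      fun x => (hl x.1).2.1
  have T2 : ∀ {f : ℝ × ℝ → ℝ}, MemLp f 2 (volume.restrict slab) →
      L2Tendsto (fun n x => g'' n x.1 * f x) (fun x => 0 * f x) := fun hf =>
    L2Tendsto.mul_of_bounded hf (fun n => (hc n).2.2.comp continuous_fst)
      (fun n x => (hb n x.1).2.2) fun x => (hl x.1).2.2
  have hw' := fun i => rs (hL i)
  have hdw := fun i j => rs (hL' i j)
  have p1 : ∀ n i j x, classicalPartial j (fun x => g n x.1 * w i x) x
      = g n x.1 * classicalPartial j (w i) x + (if j = 0 then g' n x.1 else 0) * w i x :=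
    fun n i j x => by rw [classicalPartial_mul (dg n x) (dw i x), pg]
  have p2 : ∀ n j x, classicalPartial j (fun x => g' n x.1 * ψ x) x
      = g' n x.1 * classicalPartial j ψ x + (if j = 0 then g'' n x.1 else 0) * ψ x :=
    fun n j x => by rw [classicalPartial_mul (dg' n x) (dψ x), pg']
  have p3 : ∀ n j x, classicalPartial j (fun x => g n x.1 * w 1 x + -(g' n x.1 * ψ x)) x
      = classicalPartial j (fun x => g n x.1 * w 1 x) x
        + -classicalPartial j (fun x => g' n x.1 * ψ x) x := fun n j x => by
    have d1 : DifferentiableAt ℝ (fun x => g n x.1 * w 1 x) x := (dg n x).mul (dw 1 x)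
    have d2 : DifferentiableAt ℝ (fun x => -(g' n x.1 * ψ x)) x := ((dg' n x).mul (dψ x)).neg
    rw [classicalPartial_add d1 d2, classicalPartial_neg]
  refine mem_solenoidal_of_tendsto test (fun i => ?_) (fun i j => ?_)
  · fin_cases i
    · simp only [Fin.zero_eta, c0]
      refine (T0 (hw' 0)).congr ?_
      filter_upwards [hX 0] with x hx
      rw [hx, one_mul]
    · simp only [Fin.mk_one, c1]
      refine ((T0 (hw' 1)).add (T1 hψ).neg).congr ?_
      filter_upwards [hX 1] with x hx
      rw [hx]; ring
  · fin_cases i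
    · simp only [Fin.zero_eta, c0]
      have e : ∀ n, classicalPartial j (fun x => g n x.1 * w 0 x)
          = fun x => g n x.1 * classicalPartial j (w 0) x
            + (if j = 0 then g' n x.1 else 0) * w 0 x := fun n => funext (p1 n 0 j)
      simp only [e]
      fin_cases j
      · refine ((T0 (hdw 0 0)).add (T1 (hw' 0))).congr ?_
        filter_upwards [hX' 0 0] with x hx
        exact .trans (by ring) hx.symm
      · simp only [Fin.mk_one, one_ne_zero, if_false, zero_mul, add_zero]
        refine (T0 (hdw 0 1)).congr ?_
        filter_upwards [hX' 0 1] with x hx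
        exact .trans (by ring) hx.symm
    · simp only [Fin.mk_one, c1]
      have e : ∀ n, classicalPartial j (fun x => g n x.1 * w 1 x + -(g' n x.1 * ψ x))
          = fun x => (g n x.1 * classicalPartial j (w 1) x
            + (if j = 0 then g' n x.1 else 0) * w 1 x)
            + -(g' n x.1 * classicalPartial j ψ x + (if j = 0 then g'' n x.1 else 0) * ψ x) :=
        fun n => funext fun x => by rw [p3, p1, p2]
      simp only [e]
      fin_cases j
      · have hψ0 : MemLp (classicalPartial 0 ψ) 2 (volume.restrict slab) := by
          have : classicalPartial 0 ψ = fun x => -w 1 x := funext h0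
          rw [this]; exact (hw' 1).neg
        refine (((T0 (hdw 1 0)).add (T1 (hw' 1))).add ((T1 hψ0).add (T2 hψ)).neg).congr ?_
        filter_upwards [hX' 1 0] with x hx
        exact .trans (by ring) hx.symm
      · have hψ1 : MemLp (classicalPartial 1 ψ) 2 (volume.restrict slab) := by
          have : classicalPartial 1 ψ = w 0 := funext h1
          rw [this]; exact hw' 0
        simp only [Fin.mk_one, one_ne_zero, if_false, zero_mul, add_zero]
        refine ((T0 (hdw 1 1)).add (T1 hψ1).neg).congr ?_
        filter_upwards [hX' 1 1] with x hx
        exact .trans (by ring) hx.symm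

/-- Divergence free `H¹` fields with zero traces on the sides of the slab are limits of divergence
free test fields. -/
theorem mem_solenoidal {X : Field} (hX : ∀ i j, HasWeakPartial slab j (X.1 i) (X.2 i j))
    (hdiv : ∀ᵐ x ∂(volume.restrict slab), X.2 0 0 x + X.2 1 1 x = 0)
    (htr : ∀ i, HasLowerTrace (-1) 1 (X.1 i) 0 ∧ HasUpperTrace (-1) 1 (X.1 i) 0) :
    X ∈ solenoidal := by
  have hext : ∀ i j φ, IsTest univ φ →
      pair slab (X.1 i) (classicalPartial j φ) = -pair slab (X.2 i j) φ := by
    intro i j φ hφ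
    have hloc : ∀ f : L2, LocallyIntegrable f (volume.restrict slab) := fun f =>
      locallyIntegrable_of_memLp (Lp.memLp f)
    have h0 := (hX i 0).integral_horizontal (by norm_num) (hloc _) (hloc _) hφ
    have h1 := pair_vertical_of_zero_trace (hX i 1) (htr i).1 (htr i).2 hφ
    fin_cases j
    · exact h0
    · exact h1
  have hmeas : ∀ f : L2, Measurable (slab.indicator f) := fun f =>
    (Lp.stronglyMeasurable f).measurable.indicator measurableSet_slab
  have hmem : ∀ f : L2, MemLp (slab.indicator f) 2 volume := fun f =>
    (memLp_indicator_iff_restrict measurableSet_slab).2 (Lp.memLp f)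
  have hloc : ∀ f : L2, LocallyIntegrable (slab.indicator f) := fun f =>
    (hmem f).locallyIntegrable (by norm_num)
  set ε : ℕ → ℝ := fun n => 1 / ((n : ℝ) + 1) with hε
  have ε0 : ∀ n, 0 < ε n := fun n => by simp only [hε]; positivity
  have ε1 : ∀ n, ε n ≤ 1 := fun n => by
    simp only [hε]; rw [div_le_one (by positivity)]; linarith [n.cast_nonneg (α := ℝ)]
  have εl : Tendsto ε atTop (𝓝 0) := tendsto_one_div_add_atTop_nhds_zero_nat
  let ρ : ℕ → ContDiffBump (0 : ℝ × ℝ) := fun n =>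
    ⟨ε n / 2, ε n, half_pos (ε0 n), half_lt_self (ε0 n)⟩
  -- Mollification at scale `ε` enlarges the support to `|x₂| ≤ 1 + ε`. Dilation by `1 + 2ε` brings
  -- it back to `|x₂| ≤ (1 + ε)/(1 + 2ε)`, strictly inside the slab.
  set l : ℕ → ℝ := fun n => 1 + 2 * ε n with hl
  have l1 : ∀ n, 1 ≤ l n := fun n => by simp only [hl]; linarith [ε0 n]
  have ll : Tendsto l atTop (𝓝 1) := by simpa using (εl.const_mul 2).const_add 1
  set W : ℕ → L2 → ℝ × ℝ → ℝ := fun n f x => mollify (ρ n) (slab.indicator f) (l n • x) with hW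
  have Wc : ∀ n f, ContDiff ℝ ∞ (W n f) := fun n f =>
    (contDiff_mollify (ρ n) (hloc f)).comp (contDiff_id.const_smul (l n))
  have Wm : ∀ n f, MemLp (W n f) 2 volume := fun n f => by
    refine ⟨(Wc n f).continuous.aestronglyMeasurable, ?_⟩
    exact ((eLpNorm_comp_smul_le (contDiff_mollify (ρ n) (hloc f)).continuous.measurable
      (l1 n)).trans (eLpNorm_mollify_le (ρ n) (hmeas f))).trans_lt (hmem f).2
  have Wp : ∀ n i j x, classicalPartial j (W n (X.1 i)) x = l n * W n (X.2 i j) x := by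
    intro n i j x
    have h1 := ((contDiff_mollify (ρ n) (hloc (X.1 i))).differentiable (by simp)
      (l n • x)).hasFDerivAt
    have h2 : HasFDerivAt (fun x : ℝ × ℝ => l n • x) (l n • ContinuousLinearMap.id ℝ (ℝ × ℝ)) x :=
      (hasFDerivAt_id x).const_smul (l n)
    have h3 := (h1.comp x h2).fderiv
    have h4 := classicalPartial_mollify (ρ n) (hloc (X.1 i)) (hext i j) (l n • x)
    simp only [classicalPartial] at h4 ⊢
    change fderiv ℝ (mollify (ρ n) (slab.indicator (X.1 i)) ∘ fun x => l n • x) x (dir j) = _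
    rw [h3]
    simp only [ContinuousLinearMap.comp_apply, smul_apply,
      ContinuousLinearMap.id_apply, map_smul, smul_eq_mul, h4, hW]
  have Wz : ∀ n f x, (1 + ε n) / l n ≤ |x.2| → W n f x = 0 := by
    intro n f x hx
    have hl0 : 0 < l n := by linarith [l1 n]
    rw [div_le_iff₀ hl0] at hx
    simp only [hW]
    rw [mollify_apply]
    refine integral_eq_zero_of_ae (Eventually.of_forall fun t => ?_)
    simp only [Pi.zero_apply]
    by_cases ht : ‖t‖ < (ρ n).rOut
    · rw [indicator_of_notMem, mul_zero]
      intro hmem'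
      have h1 := mem_strip.1 hmem'
      have h2 : |t.2| < ε n := (norm_snd_le t).trans_lt ht
      have h3 : |(l n • x - t).2| < 1 := abs_lt.2 h1
      have h4 : (l n • x - t).2 = l n * x.2 - t.2 := by simp
      have h5 : |l n * x.2| ≤ |l n * x.2 - t.2| + |t.2| := by
        have := abs_add_le (l n * x.2 - t.2) t.2
        simpa using this
      rw [abs_mul, abs_of_pos hl0] at h5
      rw [h4] at h3
      nlinarith
    · have : t ∉ Function.support ((ρ n).normed volume) := by
        rw [(ρ n).support_normed_eq, mem_ball_zero_iff]; exact ht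
      rw [Function.notMem_support.1 this, zero_mul]
  have Wd : ∀ n x, W n (X.2 0 0) x + W n (X.2 1 1) x = 0 := by
    intro n x
    simp only [hW]
    rw [mollify_apply, mollify_apply, ← integral_add]
    · have hz : ∀ᵐ y, slab.indicator (X.2 0 0) y + slab.indicator (X.2 1 1) y = 0 := by
        filter_upwards [(ae_restrict_iff' measurableSet_slab).1 hdiv] with y hy
        by_cases hys : y ∈ slab
        · simp only [hys, indicator_of_mem]; exact hy hys
        · simp [hys]
      refine integral_eq_zero_of_ae ?_
      have hq := (quasiMeasurePreserving_sub_left volume (l n • x)).ae hz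
      filter_upwards [hq] with t ht
      rw [← mul_add, ht, mul_zero]; rfl
    · exact ((ρ n).hasCompactSupport_normed (μ := volume)).convolutionExists_left
        (ContinuousLinearMap.lsmul ℝ ℝ) (ρ n).continuous_normed (hloc _) _
    · exact ((ρ n).hasCompactSupport_normed (μ := volume)).convolutionExists_left
        (ContinuousLinearMap.lsmul ℝ ℝ) (ρ n).continuous_normed (hloc _) _
  have rs : ∀ {f : ℝ × ℝ → ℝ}, MemLp f 2 volume → MemLp f 2 (volume.restrict slab) :=
    fun h => h.mono_measure Measure.restrict_le_self
  set F : ℕ → L2 → L2 := fun n f => (rs (Wm n f)).toLp (W n f) with hF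
  -- The factor `l n` on the gradient comes from the chain rule for the dilation. It tends to 1 and,
  -- being common to all derivatives, does not disturb the divergence.
  set Y : ℕ → Field := fun n => (fun i => F n (X.1 i), fun i j => l n • F n (X.2 i j)) with hY
  have Ymem : ∀ n, Y n ∈ solenoidal := by
    intro n
    have hl0 : 0 < l n := by linarith [l1 n]
    have hp : ∀ i j, classicalPartial j (W n (X.1 i)) = fun x => l n * W n (X.2 i j) x :=
      fun i j => funext (Wp n i j)
    refine mem_solenoidal_of_smooth (w := fun i => W n (X.1 i)) (r := (1 + ε n) / l n)
      (fun i => Wc n _) (fun x => ?_) ?_ (fun i x hx => Wz n _ x hx) (fun i => Wm n _)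
      (fun i j => ?_) (fun i => MemLp.coeFn_toLp (rs (Wm n (X.1 i)))) (fun i j => ?_)
    · rw [Wp, Wp, ← mul_add, Wd, mul_zero]
    · rw [div_lt_one hl0]; simp only [hl]; linarith [ε0 n]
    · rw [hp]; exact (Wm n _).const_mul _
    · rw [hp]
      refine (Lp.coeFn_smul (l n) (F n (X.2 i j))).trans ?_
      filter_upwards [MemLp.coeFn_toLp (rs (Wm n (X.2 i j)))] with x hx
      rw [Pi.smul_apply, hx, smul_eq_mul]
  have Flim : ∀ f, Tendsto (fun n => F n f) atTop (𝓝 f) := by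
    intro f
    rw [Lp.tendsto_Lp_iff_tendsto_eLpNorm']
    have h := tendsto_mollify_dilate (ρ := ρ) (r := l) εl ε1 l1 ll (hmeas f) (hmem f)
    refine tendsto_of_tendsto_of_tendsto_of_le_of_le tendsto_const_nhds h (fun _ => zero_le)
      fun n => ?_
    have e : (⇑(F n f) - ⇑f : ℝ × ℝ → ℝ) =ᵐ[volume.restrict slab]
        fun x => W n f x - slab.indicator f x := by
      filter_upwards [MemLp.coeFn_toLp (rs (Wm n f)), ae_restrict_mem measurableSet_slab]
        with x hx hxs
      rw [Pi.sub_apply, hx, indicator_of_mem hxs]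
    rw [eLpNorm_congr_ae e]
    exact eLpNorm_mono_measure _ Measure.restrict_le_self
  have Ylim : Tendsto Y atTop (𝓝 X) := by
    refine Prod.tendsto_iff _ _ |>.2 ⟨tendsto_pi_nhds.2 fun i => Flim _,
      tendsto_pi_nhds.2 fun i => tendsto_pi_nhds.2 fun j => ?_⟩
    simpa using ll.smul (Flim (X.2 i j))
  exact isClosed_solenoidal.mem_of_tendsto Ylim (Eventually.of_forall Ymem)

/-! ### Coercivity of the potential -/

/-- The squared `L²` norm of a vector field. -/
def normSq (u : Fin 2 → L2) : ℝ := ∑ i, ‖u i‖ ^ 2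

/-- The squared `H¹` norm of a field. -/
def h1NormSq (x : Field) : ℝ := ∑ i, (‖x.1 i‖ ^ 2 + ∑ j, ‖x.2 i j‖ ^ 2)

/-- The energy `‖u‖² + ‖∂₂u‖²`. -/
def vertSq (x : Field) : ℝ := ∑ i, (‖x.1 i‖ ^ 2 + ‖x.2 i 1‖ ^ 2)

/-- The energy `‖∂₁u₁‖² + ‖u₂‖²_{H¹}`. -/
def horSq (x : Field) : ℝ := ‖x.2 0 0‖ ^ 2 + (‖x.1 1‖ ^ 2 + ∑ j, ‖x.2 1 j‖ ^ 2)

lemma continuous_normSq : Continuous normSq :=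
  continuous_finsetSum _ fun i _ => (continuous_apply i).norm.pow 2

lemma continuous_h1NormSq : Continuous h1NormSq :=
  continuous_finsetSum _ fun i _ => ((continuous_fst_apply i).norm.pow 2).add
    (continuous_finsetSum _ fun j _ => (continuous_snd_apply i j).norm.pow 2)

lemma continuous_vertSq : Continuous vertSq :=
  continuous_finsetSum _ fun i _ => ((continuous_fst_apply i).norm.pow 2).add
    ((continuous_snd_apply i 1).norm.pow 2)

lemma continuous_horSq : Continuous horSq :=
  ((continuous_snd_apply 0 0).norm.pow 2).add (((continuous_fst_apply 1).norm.pow 2).add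
    (continuous_finsetSum _ fun j _ => (continuous_snd_apply 1 j).norm.pow 2))

lemma normSq_nonneg (u : Fin 2 → L2) : 0 ≤ normSq u := Finset.sum_nonneg fun _ _ => sq_nonneg _

lemma h1NormSq_nonneg (x : Field) : 0 ≤ h1NormSq x := by unfold h1NormSq; positivity

/-- The properties of an energy functional used in the estimates: it is a continuous nonnegative
quadratic quantity, equivalent to the potential form on divergence free fields. -/
structure IsEnergy (c : Coeffs) (B : Fin 2 → ℝ) (e : Field → ℝ) (κ M : ℝ) : Prop where
  κ_pos : 0 < κ
  cont : Continuous e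
  nonneg : ∀ x, 0 ≤ e x
  add_le : ∀ x y, e (x + y) ≤ 2 * e x + 2 * e y
  coercive : ∀ x ∈ solenoidal, κ * e x ≤ potential c B x x
  bound : ∀ x y, |potential c B x y| ≤ M * √(e x) * √(e y)

lemma norm_add_sq_le {E : Type*} [SeminormedAddCommGroup E] (a b : E) :
    ‖a + b‖ ^ 2 ≤ 2 * ‖a‖ ^ 2 + 2 * ‖b‖ ^ 2 := by
  have := norm_add_le a b
  nlinarith [norm_nonneg (a + b), norm_nonneg a, norm_nonneg b, sq_nonneg (‖a‖ - ‖b‖)]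

lemma abs_inner_le_of_sq_le {f g : L2} {a b : ℝ} (hf : ‖f‖ ^ 2 ≤ a) (hg : ‖g‖ ^ 2 ≤ b) :
    ‖f‖ * ‖g‖ ≤ √a * √b :=
  mul_le_mul (Real.le_sqrt_of_sq_le hf) (Real.le_sqrt_of_sq_le hg) (norm_nonneg _)
    (Real.sqrt_nonneg _)

/-- The magnetic part is `B²‖∂₂u‖²` and gravity takes away at most `(g[ρ]/2)‖∂₂u₂‖²`. The Poincaré
constant 4 gives `vertSq ≤ 5‖∂₂u‖²`, hence the divisor 5. -/
lemma isEnergy_vertSq {c : Coeffs} {B : ℝ} (hB : c.gJump / 2 < B ^ 2) :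
    IsEnergy c ![0, B] vertSq ((B ^ 2 - c.gJump / 2) / 5) (2 * B ^ 2 + 2 * c.gJump) where
  κ_pos := by linarith
  cont := continuous_vertSq
  nonneg x := by unfold vertSq; positivity
  add_le x y := by
    simp only [vertSq, Fin.sum_univ_two, Prod.fst_add, Prod.snd_add, Pi.add_apply]
    linarith [norm_add_sq_le (x.1 0) (y.1 0), norm_add_sq_le (x.1 1) (y.1 1),
      norm_add_sq_le (x.2 0 1) (y.2 0 1), norm_add_sq_le (x.2 1 1) (y.2 1 1)]
  coercive x hx := by
    have p0 := solenoidal_poincare hx 0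
    have p1 := solenoidal_poincare hx 1
    have tr := solenoidal_trace hx
    have hg := c.gJump_pos
    rw [potential_apply, pairCLM_comm upper (x.2 1 1)]
    simp only [vertSq, Fin.sum_univ_two, Matrix.cons_val_zero, Matrix.cons_val_one,
      real_inner_self_eq_norm_sq, zero_mul, mul_zero, zero_add]
    nlinarith [mul_le_mul_of_nonneg_left p0 (sub_pos.2 hB).le,
      mul_le_mul_of_nonneg_left p1 (sub_pos.2 hB).le, mul_le_mul_of_nonneg_left tr hg.le,
      mul_nonneg hg.le (sq_nonneg ‖x.2 0 1‖)]
  bound x y := by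
    have hg := c.gJump_pos
    have le1 : ∀ (z : Field) i, ‖z.1 i‖ ^ 2 ≤ vertSq z := fun z i => by
      refine le_trans ?_ (Finset.single_le_sum (f := fun i => ‖z.1 i‖ ^ 2 + ‖z.2 i 1‖ ^ 2)
        (fun i _ => by positivity) (Finset.mem_univ i))
      linarith [sq_nonneg ‖z.2 i 1‖]
    have le2 : ∀ (z : Field) i, ‖z.2 i 1‖ ^ 2 ≤ vertSq z := fun z i => by
      refine le_trans ?_ (Finset.single_le_sum (f := fun i => ‖z.1 i‖ ^ 2 + ‖z.2 i 1‖ ^ 2)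
        (fun i _ => by positivity) (Finset.mem_univ i))
      linarith [sq_nonneg ‖z.1 i‖]
    have b0 := (abs_real_inner_le_norm (x.2 0 1) (y.2 0 1)).trans
      (abs_inner_le_of_sq_le (le2 x 0) (le2 y 0))
    have b1 := (abs_real_inner_le_norm (x.2 1 1) (y.2 1 1)).trans
      (abs_inner_le_of_sq_le (le2 x 1) (le2 y 1))
    have b2 := (abs_pairCLM_le upper (x.1 1) (y.2 1 1)).trans
      (abs_inner_le_of_sq_le (le1 x 1) (le2 y 1))
    have b3 := (abs_pairCLM_le upper (x.2 1 1) (y.1 1)).trans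
      (abs_inner_le_of_sq_le (le2 x 1) (le1 y 1))
    rw [potential_apply]
    simp only [Fin.sum_univ_two, Matrix.cons_val_zero, Matrix.cons_val_one, zero_mul, mul_zero,
      zero_add]
    rw [abs_le] at b0 b1 b2 b3 ⊢
    have hB2 := sq_nonneg B
    constructor <;> nlinarith

/-- The magnetic part is `B²(‖∂₁u₁‖² + ‖∂₁u₂‖²)`, and `‖∂₁u₁‖ = ‖∂₂u₂‖` by incompressibility, so it
dominates the gravity term. The divisor 6 counts `‖∂₂u₂‖²` once for itself, once for `∂₁u₁`, and
four times for `u₂` through the Poincaré inequality. -/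
lemma isEnergy_horSq {c : Coeffs} {B : ℝ} (hB : c.gJump / 2 < B ^ 2) :
    IsEnergy c ![B, 0] horSq ((B ^ 2 - c.gJump / 2) / 6) (2 * B ^ 2 + 2 * c.gJump) where
  κ_pos := by linarith
  cont := continuous_horSq
  nonneg x := by unfold horSq; positivity
  add_le x y := by
    simp only [horSq, Fin.sum_univ_two, Prod.fst_add, Prod.snd_add, Pi.add_apply]
    linarith [norm_add_sq_le (x.2 0 0) (y.2 0 0), norm_add_sq_le (x.1 1) (y.1 1),
      norm_add_sq_le (x.2 1 0) (y.2 1 0), norm_add_sq_le (x.2 1 1) (y.2 1 1)]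
  coercive x hx := by
    have p1 := solenoidal_poincare hx 1
    have tr := solenoidal_trace hx
    have hd : ‖x.2 0 0‖ = ‖x.2 1 1‖ := by
      rw [eq_neg_of_add_eq_zero_left (solenoidal_div hx), norm_neg]
    have hg := c.gJump_pos
    rw [potential_apply, pairCLM_comm upper (x.2 1 1)]
    simp only [horSq, Fin.sum_univ_two, Matrix.cons_val_zero, Matrix.cons_val_one,
      real_inner_self_eq_norm_sq, zero_mul, mul_zero, add_zero, hd]
    nlinarith [mul_le_mul_of_nonneg_left p1 (sub_pos.2 hB).le,
      mul_le_mul_of_nonneg_left tr hg.le, mul_nonneg hg.le (sq_nonneg ‖x.2 1 0‖),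
      mul_nonneg (sub_pos.2 hB).le (sq_nonneg ‖x.2 1 0‖)]
  bound x y := by
    have hg := c.gJump_pos
    have le0 : ∀ z : Field, ‖z.2 0 0‖ ^ 2 ≤ horSq z := fun z => by
      simp only [horSq, Fin.sum_univ_two]
      linarith [sq_nonneg ‖z.1 1‖, sq_nonneg ‖z.2 1 0‖, sq_nonneg ‖z.2 1 1‖]
    have le1 : ∀ z : Field, ‖z.1 1‖ ^ 2 ≤ horSq z := fun z => by
      simp only [horSq, Fin.sum_univ_two]
      linarith [sq_nonneg ‖z.2 0 0‖, sq_nonneg ‖z.2 1 0‖, sq_nonneg ‖z.2 1 1‖]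
    have le2 : ∀ z : Field, ‖z.2 1 0‖ ^ 2 ≤ horSq z := fun z => by
      simp only [horSq, Fin.sum_univ_two]
      linarith [sq_nonneg ‖z.2 0 0‖, sq_nonneg ‖z.1 1‖, sq_nonneg ‖z.2 1 1‖]
    have le3 : ∀ z : Field, ‖z.2 1 1‖ ^ 2 ≤ horSq z := fun z => by
      simp only [horSq, Fin.sum_univ_two]
      linarith [sq_nonneg ‖z.2 0 0‖, sq_nonneg ‖z.1 1‖, sq_nonneg ‖z.2 1 0‖]
    have b0 := (abs_real_inner_le_norm (x.2 0 0) (y.2 0 0)).trans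
      (abs_inner_le_of_sq_le (le0 x) (le0 y))
    have b1 := (abs_real_inner_le_norm (x.2 1 0) (y.2 1 0)).trans
      (abs_inner_le_of_sq_le (le2 x) (le2 y))
    have b2 := (abs_pairCLM_le upper (x.1 1) (y.2 1 1)).trans
      (abs_inner_le_of_sq_le (le1 x) (le3 y))
    have b3 := (abs_pairCLM_le upper (x.2 1 1) (y.1 1)).trans
      (abs_inner_le_of_sq_le (le3 x) (le1 y))
    rw [potential_apply]
    simp only [Fin.sum_univ_two, Matrix.cons_val_zero, Matrix.cons_val_one, zero_mul, mul_zero,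
      add_zero]
    rw [abs_le] at b0 b1 b2 b3 ⊢
    have hB2 := sq_nonneg B
    constructor <;> nlinarith

/-- Coercivity of the viscous form in `H¹`. -/
lemma viscous_coercive {c : Coeffs} {x : Field} (hx : x ∈ solenoidal) :
    min c.μp c.μm / 5 * h1NormSq x ≤ viscous c x x := by
  have hm : 0 < min c.μp c.μm := lt_min c.μp_pos c.μm_pos
  refine le_trans ?_ (korn hx)
  rw [div_mul_eq_mul_div, mul_div_assoc]
  refine mul_le_mul_of_nonneg_left ?_ hm.le
  -- By the Poincaré inequality the squared `H¹` norm is at most 5 times the squared norm of the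
  -- gradient.
  have p0 := solenoidal_poincare hx 0
  have p1 := solenoidal_poincare hx 1
  simp only [h1NormSq, Fin.sum_univ_two]
  linarith [sq_nonneg ‖x.2 0 0‖, sq_nonneg ‖x.2 1 0‖, sq_nonneg ‖x.2 0 1‖, sq_nonneg ‖x.2 1 1‖]

/-! ### Evolutions -/

/-- The weak form of the linearized system as an evolution of fields. -/
structure IsEvolution (c : Coeffs) (B : Fin 2 → ℝ) (T : ℝ) (V : ℝ → Field)
    (vt : ℝ → Fin 2 → L2) (N : ℝ → Field) : Prop where
  cont : ContinuousOn V (Icc 0 T)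
  deriv_V : ∀ t ∈ Icc 0 T, HasDerivWithinAt (fun s => (V s).1) (vt t) (Icc 0 T) t
  deriv_N : ∀ t ∈ Icc 0 T, HasDerivWithinAt N (V t) (Icc 0 T) t
  mem : ∀ t ∈ Icc 0 T, V t ∈ solenoidal
  weak : ∀ t ∈ Icc 0 T, ∀ x ∈ solenoidal,
    inertia c (vt t) x.1 + viscous c (V t) x + potential c B (N t) x = 0

namespace IsEvolution

variable {c : Coeffs} {B : Fin 2 → ℝ} {T : ℝ} {V : ℝ → Field} {vt : ℝ → Fin 2 → L2}
  {N : ℝ → Field}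

lemma continuousOn_viscous (h : IsEvolution c B T V vt N) :
    ContinuousOn (fun t => viscous c (V t) (V t)) (Icc 0 T) :=
  ((viscous c).continuous.comp_continuousOn h.cont).clm_apply h.cont

/-- The velocity is itself an admissible test field. By the symmetry of `inertia` and `potential`,
the weak form at `x = V s` is the time derivative of the energy. -/
lemma energy_identity (h : IsEvolution c B T V vt N) {t : ℝ} (ht : t ∈ Icc 0 T) :
    inertia c (V t).1 (V t).1 / 2 + potential c B (N t) (N t) / 2
      + ∫ s in (0 : ℝ)..t, viscous c (V s) (V s)
      = inertia c (V 0).1 (V 0).1 / 2 + potential c B (N 0) (N 0) / 2 := by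
  set E : ℝ → ℝ := fun s => inertia c (V s).1 (V s).1 / 2 + potential c B (N s) (N s) / 2 with hE
  have hsub : Icc 0 t ⊆ Icc 0 T := Icc_subset_Icc le_rfl ht.2
  have hd : ∀ s ∈ Icc 0 T, HasDerivWithinAt E (-viscous c (V s) (V s)) (Icc 0 T) s := by
    intro s hs
    have d1 := ((inertia c).hasFDerivAt.comp_hasDerivWithinAt s (h.deriv_V s hs)).clm_apply
      (h.deriv_V s hs)
    have d2 := ((potential c B).hasFDerivAt.comp_hasDerivWithinAt s (h.deriv_N s hs)).clm_apply
      (h.deriv_N s hs)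
    refine ((d1.div_const 2).add (d2.div_const 2)).congr_deriv ?_
    have w := h.weak s hs _ (h.mem s hs)
    simp only [Function.comp_apply]
    rw [inertia_comm c (V s).1 (vt s), potential_comm c B (V s) (N s)]
    linarith
  have hFTC := intervalIntegral.integral_eq_sub_of_hasDerivAt_of_le (f := E)
    (f' := fun s => -viscous c (V s) (V s)) ht.1
    (fun s hs => ((hd s (hsub hs)).continuousWithinAt).mono hsub)
    (fun s hs => (hd s (hsub (Ioo_subset_Icc_self hs))).hasDerivAt
      (Icc_mem_nhds hs.1 (hs.2.trans_le ht.2)))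
    ((h.continuousOn_viscous.mono hsub).neg.intervalIntegrable_of_Icc ht.1)
  rw [intervalIntegral.integral_neg] at hFTC
  simp only [hE] at hFTC
  linarith

/-- The derivative of `N` takes values in `solenoidal`, so the class of `N` in the quotient by this
subspace has zero derivative and is constant. -/
lemma sub_mem (h : IsEvolution c B T V vt N) {t : ℝ} (ht : t ∈ Icc 0 T) :
    N t - N 0 ∈ solenoidal := by
  -- Closedness makes the quotient seminorm a norm, so norm zero in the quotient means membership in
  -- the subspace.
  have hcl : IsClosed (solenoidal : Set Field) := isClosed_solenoidal
  have h0 : (0 : ℝ) ∈ Icc 0 T := ⟨le_rfl, ht.1.trans ht.2⟩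
  have hd : ∀ s ∈ Icc 0 T, HasDerivWithinAt (fun s => solenoidal.mkQL (N s)) 0 (Icc 0 T) s := by
    intro s hs
    have := (solenoidal.mkQL.hasFDerivAt.comp_hasDerivWithinAt s (h.deriv_N s hs))
    have hz : solenoidal.mkQL (V s) = 0 := by
      simpa using (Submodule.Quotient.mk_eq_zero solenoidal).2 (h.mem s hs)
    rw [hz] at this
    exact this
  have hdist := (convex_Icc 0 T).norm_image_sub_le_of_norm_hasDerivWithin_le (C := 0) hd
    (fun s _ => by simp) h0 ht
  rw [zero_mul] at hdist
  have e := norm_le_zero_iff.1 hdist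
  rw [← map_sub] at e
  exact (Submodule.Quotient.mk_eq_zero solenoidal).1 e

/-- The basic energy estimate. -/
lemma estimate (h : IsEvolution c B T V vt N) {e : Field → ℝ} {κ M : ℝ}
    (he : IsEnergy c B e κ M) {t : ℝ} (ht : t ∈ Icc 0 T) :
    min (min (c.ρm / 2) (κ / 8)) (min c.μp c.μm / 5)
        * (normSq (V t).1 + e (N t) + ∫ s in (0 : ℝ)..t, h1NormSq (V s))
      ≤ (c.ρp / 2 + (M ^ 2 / κ + κ / 4)) * (normSq (V 0).1 + e (N 0)) := by
  set k := min (min (c.ρm / 2) (κ / 8)) (min c.μp c.μm / 5) with hk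
  have k1 : k ≤ c.ρm / 2 := (min_le_left _ _).trans (min_le_left _ _)
  have k2 : k ≤ κ / 8 := (min_le_left _ _).trans (min_le_right _ _)
  have k3 : k ≤ min c.μp c.μm / 5 := min_le_right _ _
  have hκ := he.κ_pos
  have hsub : Icc 0 t ⊆ Icc 0 T := Icc_subset_Icc le_rfl ht.2
  have hZ := h.sub_mem ht
  set Z := N t - N 0 with hZd
  have hN : N t = N 0 + Z := by rw [hZd]; abel
  have id := h.energy_identity ht
  -- In the energy identity the value at `N 0` cancels between the two sides. What remains is a
  -- cross term and the form at `Z`, where coercivity is available.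
  have hb : potential c B (N t) (N t) = potential c B (N 0) (N 0)
      + 2 * potential c B (N 0) Z + potential c B Z Z := by
    rw [hN]
    simp only [map_add, add_apply]
    rw [potential_comm c B Z (N 0)]; ring
  have hco := he.coercive Z hZ
  have hbd := (abs_le.1 (he.bound (N 0) Z)).1
  have s1 := Real.sq_sqrt (he.nonneg (N 0))
  have s2 := Real.sq_sqrt (he.nonneg Z)
  set p := √(e (N 0))
  set q := √(e Z)
  -- The weight `κ/4` leaves half of the coercive contribution `(κ/2) e(Z)`. That remainder pays for
  -- `(κ/8) e(N t)` through `e(N t) ≤ 2 e(N 0) + 2 e(Z)`.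
  have young : M * p * q ≤ κ / 4 * q ^ 2 + M ^ 2 / κ * p ^ 2 := by
    have : κ / 4 * q ^ 2 + M ^ 2 / κ * p ^ 2 - M * p * q = (κ * q / 2 - M * p) ^ 2 / κ := by
      field_simp; ring
    have h2 : 0 ≤ (κ * q / 2 - M * p) ^ 2 / κ := by positivity
    linarith
  have hint : min c.μp c.μm / 5 * ∫ s in (0 : ℝ)..t, h1NormSq (V s)
      ≤ ∫ s in (0 : ℝ)..t, viscous c (V s) (V s) := by
    rw [← intervalIntegral.integral_const_mul]
    refine intervalIntegral.integral_mono_on ht.1 ?_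
      ((h.continuousOn_viscous.mono hsub).intervalIntegrable_of_Icc ht.1)
      fun s hs => viscous_coercive (h.mem s (hsub hs))
    exact ((continuous_h1NormSq.comp_continuousOn (h.cont.mono hsub)).const_smul
      (min c.μp c.μm / 5)).intervalIntegrable_of_Icc ht.1
  have hint0 : 0 ≤ ∫ s in (0 : ℝ)..t, h1NormSq (V s) :=
    intervalIntegral.integral_nonneg ht.1 fun s _ => h1NormSq_nonneg _
  have m1 := le_inertia_self c (V t).1
  have m0 := inertia_self_le c (V 0).1
  change c.ρm * normSq (V t).1 ≤ _ at m1
  change _ ≤ c.ρp * normSq (V 0).1 at m0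
  have eN := he.add_le (N 0) Z
  rw [← hN] at eN
  have n1 := normSq_nonneg (V t).1
  have n2 := he.nonneg (N t)
  have n3 := normSq_nonneg (V 0).1
  have n4 := he.nonneg (N 0)
  have hρp : 0 < c.ρp := c.ρm_pos.trans c.ρm_lt_ρp
  have hMκ : 0 ≤ M ^ 2 / κ := by positivity
  have t1 := mul_le_mul_of_nonneg_right k1 n1
  have t2 := mul_le_mul_of_nonneg_right k2 n2
  have t3 := mul_le_mul_of_nonneg_right k3 hint0
  have t4 := mul_le_mul_of_nonneg_left eN (by positivity : 0 ≤ κ / 8)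
  have t5 : 0 ≤ c.ρp / 2 * e (N 0) := by positivity
  have t6 : 0 ≤ (M ^ 2 / κ + κ / 4) * normSq (V 0).1 := by positivity
  rw [s1, s2] at young
  nlinarith

/-- Difference quotients in time of an evolution. -/
lemma diffQuot (h : IsEvolution c B T V vt N) {d : ℝ} (hd : 0 < d) :
    IsEvolution c B (T - d) (fun t => d⁻¹ • (V (t + d) - V t)) (fun t => d⁻¹ • (vt (t + d) - vt t))
      (fun t => d⁻¹ • (N (t + d) - N t)) := by
  have m0 : ∀ {t}, t ∈ Icc 0 (T - d) → t ∈ Icc 0 T := fun ht => ⟨ht.1, by linarith [ht.2]⟩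
  have m1 : ∀ {t}, t ∈ Icc 0 (T - d) → t + d ∈ Icc 0 T :=
    fun ht => ⟨by linarith [ht.1], by linarith [ht.2]⟩
  have mt : MapsTo (fun t => t + d) (Icc 0 (T - d)) (Icc 0 T) := fun t ht => m1 ht
  have shift : ∀ {E : Type _} [NormedAddCommGroup E] [NormedSpace ℝ E] {f : ℝ → E} {f' : ℝ → E},
      (∀ t ∈ Icc 0 T, HasDerivWithinAt f (f' t) (Icc 0 T) t) → ∀ t ∈ Icc 0 (T - d),
      HasDerivWithinAt (fun t => d⁻¹ • (f (t + d) - f t)) (d⁻¹ • (f' (t + d) - f' t))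
        (Icc 0 (T - d)) t := by
    intro E _ _ f f' hf t ht
    have h1 := (hf _ (m1 ht)).scomp t (((hasDerivAt_id t).add_const d).hasDerivWithinAt) mt
    rw [one_smul] at h1
    exact (h1.sub ((hf t (m0 ht)).mono fun s hs => m0 hs)).const_smul d⁻¹
  refine ⟨?_, fun t ht => shift h.deriv_V t ht, fun t ht => shift h.deriv_N t ht, fun t ht => ?_,
    fun t ht x hx => ?_⟩
  · exact ((h.cont.comp (by fun_prop) mt).sub (h.cont.mono fun s hs => m0 hs)).const_smul d⁻¹
  · exact solenoidal.smul_mem _ (solenoidal.sub_mem (h.mem _ (m1 ht)) (h.mem _ (m0 ht)))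
  · have w1 := h.weak _ (m1 ht) x hx
    have w0 := h.weak _ (m0 ht) x hx
    simp only [map_smul, map_sub, smul_apply, sub_apply, smul_eq_mul]
    linear_combination d⁻¹ * (w1 - w0)

end IsEvolution

/-! ### Weak derivatives in `L²(Ω)` -/

lemma isOpen_slab : IsOpen slab := isOpen_strip _ _

/-- For elements of `L²` the integrability conditions are automatic, and what is left is a family of
linear conditions stable under weak limits and under integration in time. -/
lemma hasWeakPartial_iff_inner {j : Fin 2} {f g : L2} :
    HasWeakPartial slab j f g ↔ ∀ φ (hφ : IsTest slab φ),
      inner ℝ f (hφ.partial j).toL2 = -inner ℝ g hφ.toL2 := by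
  have key : ∀ (u : L2) {φ : ℝ × ℝ → ℝ} (hφ : IsTest slab φ),
      inner ℝ u hφ.toL2 = ∫ x in slab, u x * φ x := fun u φ hφ => by
    rw [← pairCLM_slab, pairCLM_toL2_right measurableSet_slab le_rfl]; rfl
  have loc : ∀ u : L2, LocallyIntegrableOn u slab := fun u =>
    locallyIntegrableOn_of_restrict isOpen_slab (locallyIntegrable_of_memLp (Lp.memLp u))
  simp only [key]
  exact ⟨fun h => h.2.2, fun h => ⟨loc f, loc g, h⟩⟩

lemma HasWeakPartial.smul_sub {j : Fin 2} {f g f' g' : L2} (h : HasWeakPartial slab j f g)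
    (h' : HasWeakPartial slab j f' g') (r : ℝ) :
    HasWeakPartial slab j (r • (f - f') : L2) (r • (g - g') : L2) := by
  rw [hasWeakPartial_iff_inner] at h h' ⊢
  intro φ hφ
  simp only [real_inner_smul_left, inner_sub_left, h φ hφ, h' φ hφ]
  ring

lemma l2Sq_coe (f : L2) : l2Sq f = ENNReal.ofReal (‖f‖ ^ 2) := by
  rw [l2Sq, ENNReal.ofReal_pow (norm_nonneg _), Lp.norm_def,
    ENNReal.ofReal_toReal (Lp.eLpNorm_ne_top f)]

lemma HasWeakPartial.partialSq_eq {j : Fin 2} {f g : L2} (h : HasWeakPartial slab j f g) :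
    partialSq j f = ENNReal.ofReal (‖g‖ ^ 2) := by
  rw [partialSq, if_pos ⟨_, h⟩, ← l2Sq_coe, l2Sq, l2Sq,
    eLpNorm_congr_ae (h.weakPartial_ae isOpen_slab)]

/-- Weak derivatives pass to limits. -/
lemma exists_hasWeakPartial_of_frequently {j : Fin 2} {f g : ℕ → L2} {f₀ : L2} {R : ℝ}
    (hf : Tendsto f atTop (𝓝 f₀))
    (h : ∃ᶠ n in atTop, HasWeakPartial slab j (f n) (g n) ∧ ‖g n‖ ≤ R) :
    ∃ G : L2, HasWeakPartial slab j f₀ G ∧ ‖G‖ ≤ R := by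
  set S : Set ℕ := {n | HasWeakPartial slab j (f n) (g n) ∧ ‖g n‖ ≤ R}
  have hne : NeBot (atTop ⊓ 𝓟 S) := frequently_mem_iff_neBot.1 h
  -- An ultrafilter concentrated on the good indices plays the role of a weakly convergent
  -- subsequence. Banach-Alaoglu gives its limit in the dual ball, and the Riesz isometry returns an
  -- element of `L²`.
  let 𝒰 : Ultrafilter ℕ := Ultrafilter.of (atTop ⊓ 𝓟 S)
  have h1 : (𝒰 : Filter ℕ) ≤ atTop := (Ultrafilter.of_le _).trans inf_le_left
  have h2 : ∀ᶠ n in (𝒰 : Filter ℕ), n ∈ S :=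
    (Ultrafilter.of_le _).trans inf_le_right (mem_principal_self S)
  let Φ : ℕ → WeakDual ℝ L2 := fun n => StrongDual.toWeakDual (InnerProductSpace.toDual ℝ L2 (g n))
  obtain ⟨y, hy, hlim⟩ := (WeakDual.isCompact_closedBall (𝕜 := ℝ) (0 : StrongDual ℝ L2) R).ultrafilter_le_nhds
    (𝒰.map Φ) (by
      rw [le_principal_iff]
      change ∀ᶠ n in (𝒰 : Filter ℕ), Φ n ∈ _
      filter_upwards [h2] with n hn
      simpa [Φ] using hn.2)
  have hlim' : Tendsto Φ (𝒰 : Filter ℕ) (𝓝 y) := hlim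
  refine ⟨(InnerProductSpace.toDual ℝ L2).symm (WeakDual.toStrongDual y),
    hasWeakPartial_iff_inner.2 fun φ hφ => ?_, ?_⟩
  · have t1 : Tendsto (fun n => inner ℝ (g n) hφ.toL2) (𝒰 : Filter ℕ) (𝓝 (y hφ.toL2)) :=
      ((WeakDual.eval_continuous hφ.toL2).tendsto y).comp hlim'
    have t2 : Tendsto (fun n => inner ℝ (f n) (hφ.partial j).toL2) (𝒰 : Filter ℕ)
        (𝓝 (inner ℝ f₀ (hφ.partial j).toL2)) := (hf.mono_left h1).inner tendsto_const_nhds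
    rw [InnerProductSpace.toDual_symm_apply]
    refine tendsto_nhds_unique_of_eventuallyEq t2 t1.neg ?_
    filter_upwards [h2] with n hn
    exact hasWeakPartial_iff_inner.1 hn.1 φ hφ
  · rw [LinearIsometryEquiv.norm_map]
    simpa using hy

/-- Weak lower semicontinuity of the norm, without assuming that the limit has a derivative. Any
finite bound exceeding the lower limit is respected infinitely often, and this bound already yields
a weak derivative obeying it. -/
lemma partialSq_le_liminf {j : Fin 2} {f g : ℕ → L2} {f₀ : L2} (hf : Tendsto f atTop (𝓝 f₀))
    (h : ∀ᶠ n in atTop, HasWeakPartial slab j (f n) (g n)) :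
    partialSq j f₀ ≤ liminf (fun n => ENNReal.ofReal (‖g n‖ ^ 2)) atTop := by
  refine le_of_forall_gt_imp_ge_of_dense fun b hb => ?_
  rcases eq_or_ne b ⊤ with rfl | hbt
  · exact le_top
  obtain ⟨G, hG, hGb⟩ := exists_hasWeakPartial_of_frequently (R := √b.toReal) hf
    (((frequently_lt_of_liminf_lt (by isBoundedDefault) hb).and_eventually h).mono
      fun n hn => ⟨hn.2, Real.le_sqrt_of_sq_le
        ((ENNReal.ofReal_le_iff_le_toReal hbt).1 hn.1.le)⟩)
  rw [hG.partialSq_eq, ENNReal.ofReal_le_iff_le_toReal hbt]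
  calc ‖G‖ ^ 2 ≤ √b.toReal ^ 2 := by gcongr
    _ = b.toReal := Real.sq_sqrt ENNReal.toReal_nonneg

lemma sum_liminf_le {ι : Type*} (s : Finset ι) (a : ι → ℕ → ℝ≥0∞) :
    ∑ i ∈ s, liminf (a i) atTop ≤ liminf (fun n => ∑ i ∈ s, a i n) atTop := by
  simp only [liminf_eq_iSup_iInf_of_nat]
  rw [ENNReal.finsetSum_iSup_of_monotone fun i n m hnm =>
    biInf_mono fun k hk => le_trans hnm hk]
  exact iSup_mono fun n => le_iInf₂ fun k hk => Finset.sum_le_sum fun i _ => iInf₂_le k hk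

lemma liminf_add_le (a b : ℕ → ℝ≥0∞) :
    liminf a atTop + liminf b atTop ≤ liminf (fun n => a n + b n) atTop := by
  simp only [liminf_eq_iSup_iInf_of_nat]
  rw [ENNReal.iSup_add_iSup_of_monotone (fun n m hnm => biInf_mono fun k hk => le_trans hnm hk)
    (fun n m hnm => biInf_mono fun k hk => le_trans hnm hk)]
  exact iSup_mono fun n => le_iInf₂ fun k hk => add_le_add (iInf₂_le k hk) (iInf₂_le k hk)

/-- Only `L²` convergence of the fields is required. This is how the difference quotients of the
velocity control the `H¹` norm of `∂ₜv`, which is not assumed to lie in `H¹`. -/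
lemma h1Sq_le_liminf {X : ℕ → Field} {w : Fin 2 → L2}
    (hX : Tendsto (fun n => (X n).1) atTop (𝓝 w))
    (h : ∀ᶠ n in atTop, ∀ i j, HasWeakPartial slab j ((X n).1 i) ((X n).2 i j)) :
    ∑ i, h1Sq (w i) ≤ liminf (fun n => ENNReal.ofReal (h1NormSq (X n))) atTop := by
  have hXi := fun i => tendsto_pi_nhds.1 hX i
  have e : ∀ n, ENNReal.ofReal (h1NormSq (X n)) = ∑ i, (ENNReal.ofReal (‖(X n).1 i‖ ^ 2)
      + ∑ j, ENNReal.ofReal (‖(X n).2 i j‖ ^ 2)) := fun n => by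
    rw [h1NormSq, ENNReal.ofReal_sum_of_nonneg fun i _ => by positivity]
    refine Finset.sum_congr rfl fun i _ => ?_
    rw [ENNReal.ofReal_add (by positivity) (by positivity),
      ENNReal.ofReal_sum_of_nonneg fun j _ => by positivity]
  simp only [e]
  refine le_trans (Finset.sum_le_sum fun i _ => ?_) (sum_liminf_le Finset.univ _)
  have l0 : l2Sq (w i) = liminf (fun n => ENNReal.ofReal (‖(X n).1 i‖ ^ 2)) atTop := by
    rw [l2Sq_coe]
    exact ((ENNReal.continuous_ofReal.tendsto _).comp ((hXi i).norm.pow 2)).liminf_eq.symm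
  have l1 : ∑ j, partialSq j (w i)
      ≤ liminf (fun n => ∑ j, ENNReal.ofReal (‖(X n).2 i j‖ ^ 2)) atTop :=
    (Finset.sum_le_sum fun j _ => partialSq_le_liminf (hXi i)
      (h.mono fun n hn => hn i j)).trans (sum_liminf_le Finset.univ _)
  exact (add_le_add l0.le l1).trans (liminf_add_le _ _)

/-! ### Solutions as evolutions -/

/-- A path with values in `L²(Ω)` whose velocity has a continuous weak derivative, and which has
one itself initially, has a weak derivative at all times. -/
lemma exists_path_hasWeakPartial {T : ℝ} (hT : 0 ≤ T) {j : Fin 2} {n u D : ℝ → L2} {G₀ : L2}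
    (hn : ∀ t ∈ Icc 0 T, HasDerivWithinAt n (u t) (Icc 0 T) t) (hD : ContinuousOn D (Icc 0 T))
    (hu : ∀ t ∈ Icc 0 T, HasWeakPartial slab j (u t) (D t))
    (h₀ : HasWeakPartial slab j (n 0) G₀) :
    ∃ G : ℝ → L2, (∀ t ∈ Icc 0 T, HasDerivWithinAt G (D t) (Icc 0 T) t) ∧
      ∀ t ∈ Icc 0 T, HasWeakPartial slab j (n t) (G t) := by
  -- Freezing `D` at the end points extends it continuously to the line, so the primitive is
  -- differentiable on all of `[0, T]`, ends included.
  have hc : Continuous fun s => D (projIcc 0 T hT s) :=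
    (continuousOn_iff_continuous_domRestrict.1 hD).comp continuous_projIcc
  have hG : ∀ t ∈ Icc 0 T, HasDerivWithinAt
      (fun t => G₀ + ∫ s in (0 : ℝ)..t, D (projIcc 0 T hT s)) (D t) (Icc 0 T) t := fun t ht => by
    have := ((hc.integral_hasStrictDerivAt 0 t).hasDerivAt.const_add G₀).hasDerivWithinAt
      (s := Icc 0 T)
    rwa [projIcc_of_mem hT ht] at this
  refine ⟨_, hG, fun t ht => hasWeakPartial_iff_inner.2 fun φ hφ => ?_⟩
  set G : ℝ → L2 := fun t => G₀ + ∫ s in (0 : ℝ)..t, D (projIcc 0 T hT s) with hGd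
  -- For a fixed test function the defect in the weak derivative identity has zero time derivative,
  -- and it vanishes at time 0.
  have hd : ∀ s ∈ Icc 0 T, HasDerivWithinAt
      (fun s => (inner ℝ (n s) (hφ.partial j).toL2 : ℝ) + inner ℝ (G s) hφ.toL2) 0 (Icc 0 T) s := by
    intro s hs
    have d1 := (hn s hs).inner ℝ (hasDerivWithinAt_const s (Icc 0 T) (hφ.partial j).toL2)
    have d2 := (hG s hs).inner ℝ (hasDerivWithinAt_const s (Icc 0 T) hφ.toL2)
    refine (d1.add d2).congr_deriv ?_
    simp [hasWeakPartial_iff_inner.1 (hu s hs) φ hφ]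
  have hdist := (convex_Icc 0 T).norm_image_sub_le_of_norm_hasDerivWithin_le (C := 0) hd
    (fun s _ => by simp) ⟨le_rfl, hT⟩ ht
  rw [zero_mul] at hdist
  have e := norm_le_zero_iff.1 hdist
  have e0 := hasWeakPartial_iff_inner.1 h₀ φ hφ
  have eG : G 0 = G₀ := by simp [hGd]
  change inner ℝ (n t) _ = -inner ℝ (G t) _
  simp only [eG] at e
  linarith

lemma MemH1.exists_hasWeakPartial_L2 {f : L2} (h : MemH1 slab f) (j : Fin 2) :
    ∃ G : L2, HasWeakPartial slab j f G := by
  obtain ⟨g, hg, hg2⟩ := h.2 j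
  exact ⟨hg2.toLp g, hg.congr EventuallyEq.rfl hg2.coeFn_toLp.symm⟩

/-- The gradient of `η` is taken as its initial value plus the time integral of the continuous
gradient of `v`. Thus `η` together with its gradient is differentiable in time, which the energy
identity needs. Incompressibility and no slip place the velocity in `solenoidal`. -/
theorem IsSolution.exists_evolution {c : Coeffs} {B : Fin 2 → ℝ} {T : ℝ} (hT : 0 ≤ T)
    {v vt η : ℝ → Fin 2 → L2} {q : ℝ → ℝ × ℝ → ℝ} (h : IsSolution c B T v vt η q) :
    ∃ DV DN : ℝ → Fin 2 → Fin 2 → L2,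
      IsEvolution c B T (fun t => (v t, DV t)) vt (fun t => (η t, DN t)) ∧
      (∀ t ∈ Icc 0 T, ∀ i j, HasWeakPartial slab j (v t i) (DV t i j)) ∧
      ∀ t ∈ Icc 0 T, ∀ i j, HasWeakPartial slab j (η t i) (DN t i j) := by
  have h0 : (0 : ℝ) ∈ Icc 0 T := ⟨le_rfl, hT⟩
  choose D hDc hDw using h.grad_v
  choose G₀ hG₀ using fun i j => (h.η_H1 i 0 h0).exists_hasWeakPartial_L2 j
  choose G hGd hGw using fun i j =>
    exists_path_hasWeakPartial hT (h.deriv_η i) (hDc i j) (hDw i j) (hG₀ i j)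
  have dV : ∀ t ∈ Icc 0 T, HasDerivWithinAt v (vt t) (Icc 0 T) t := fun t ht =>
    hasDerivWithinAt_pi.2 fun i => h.deriv_v i t ht
  have dN : ∀ t ∈ Icc 0 T, HasDerivWithinAt η (v t) (Icc 0 T) t := fun t ht =>
    hasDerivWithinAt_pi.2 fun i => h.deriv_η i t ht
  refine ⟨fun t i j => D i j t, fun t i j => G i j t, ⟨?_, dV, fun t ht => ?_, fun t ht => ?_,
    fun t ht x hx => ?_⟩, fun t ht i j => hDw i j t ht, fun t ht i j => hGw i j t ht⟩
  · exact ContinuousOn.prodMk (fun t ht => (dV t ht).continuousWithinAt)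
      (continuousOn_pi.2 fun i => continuousOn_pi.2 fun j => hDc i j)
  · exact (dN t ht).prodMk (hasDerivWithinAt_pi.2 fun i => hasDerivWithinAt_pi.2 fun j =>
      hGd i j t ht)
  · refine mem_solenoidal (fun i j => hDw i j t ht) ?_ fun i => h.no_slip i t ht
    filter_upwards [h.div_v t ht, (hDw 0 0 t ht).weakPartial_ae isOpen_slab,
      (hDw 1 1 t ht).weakPartial_ae isOpen_slab] with x hx h0 h1
    rw [← h0, ← h1, hx]
  · refine weak_form_solenoidal (fun i j => hDw i j t ht) (fun i j => hGw i j t ht)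
      (fun i => h.v_H2 i t ht) (fun i => h.η_H2 i t ht) (h.grad_q · t ht) (h.momentum t ht).1
      (h.momentum t ht).2 ?_ (h.jump_stress t ht) hx
    filter_upwards [h.div_v t ht, (hDw 0 0 t ht).weakPartial_ae isOpen_slab,
      (hDw 1 1 t ht).weakPartial_ae isOpen_slab] with x hx h0 h1
    rw [← h0, ← h1, hx]

/-! ### The estimates -/

lemma sum_h1Sq_eq {u : Fin 2 → L2} {D : Fin 2 → Fin 2 → L2}
    (h : ∀ i j, HasWeakPartial slab j (u i) (D i j)) :
    ∑ i, h1Sq (u i) = ENNReal.ofReal (h1NormSq (u, D)) := by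
  simp only [h1Sq, l2Sq_coe, fun i j => (h i j).partialSq_eq, h1NormSq]
  rw [ENNReal.ofReal_sum_of_nonneg fun i _ => by positivity]
  refine Finset.sum_congr rfl fun i _ => ?_
  rw [ENNReal.ofReal_add (by positivity) (by positivity),
    ENNReal.ofReal_sum_of_nonneg fun j _ => by positivity]

lemma verticalEnergy_eq (w : Fin 2 → L2) {u : Fin 2 → L2} {D : Fin 2 → Fin 2 → L2}
    (h : ∀ i j, HasWeakPartial slab j (u i) (D i j)) :
    verticalEnergy w u = ENNReal.ofReal (normSq w + vertSq (u, D)) := by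
  simp only [verticalEnergy, l2Sq_coe, fun i j => (h i j).partialSq_eq, normSq, vertSq,
    Finset.sum_add_distrib, ← add_assoc]
  rw [ENNReal.ofReal_add (by positivity) (by positivity),
    ENNReal.ofReal_add (by positivity) (by positivity)]
  simp only [ENNReal.ofReal_sum_of_nonneg fun i _ => sq_nonneg _]

lemma horizontalEnergy_eq (w : Fin 2 → L2) {u : Fin 2 → L2} {D : Fin 2 → Fin 2 → L2}
    (h : ∀ i j, HasWeakPartial slab j (u i) (D i j)) :
    horizontalEnergy w u = ENNReal.ofReal (normSq w + horSq (u, D)) := by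
  simp only [horizontalEnergy, h1Sq, l2Sq_coe, fun i j => (h i j).partialSq_eq, normSq, horSq]
  rw [ENNReal.ofReal_add (by positivity) (by positivity),
    ENNReal.ofReal_add (by positivity) (by positivity),
    ENNReal.ofReal_add (by positivity) (by positivity)]
  simp only [ENNReal.ofReal_sum_of_nonneg fun i _ => sq_nonneg _, add_assoc]

lemma IsEvolution.estimate_ofReal {c : Coeffs} {B : Fin 2 → ℝ} {T : ℝ} {V : ℝ → Field}
    {vt : ℝ → Fin 2 → L2} {N : ℝ → Field} (h : IsEvolution c B T V vt N) {e : Field → ℝ}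
    {κ M : ℝ} (he : IsEnergy c B e κ M) {C : ℝ≥0}
    (hC : (c.ρp / 2 + (M ^ 2 / κ + κ / 4))
      / min (min (c.ρm / 2) (κ / 8)) (min c.μp c.μm / 5) ≤ C) {t : ℝ} (ht : t ∈ Icc 0 T) :
    ENNReal.ofReal (normSq (V t).1 + e (N t)) + ∫⁻ s in Icc 0 t, ENNReal.ofReal (h1NormSq (V s))
      ≤ C * ENNReal.ofReal (normSq (V 0).1 + e (N 0)) := by
  have hκ := he.κ_pos
  have hk : 0 < min (min (c.ρm / 2) (κ / 8)) (min c.μp c.μm / 5) := by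
    have := c.ρm_pos
    have := c.μp_pos
    have := c.μm_pos
    positivity
  have hcont : ContinuousOn (fun s => h1NormSq (V s)) (Icc 0 t) :=
    continuous_h1NormSq.comp_continuousOn (h.cont.mono (Icc_subset_Icc le_rfl ht.2))
  have hI : ∫⁻ s in Icc 0 t, ENNReal.ofReal (h1NormSq (V s))
      = ENNReal.ofReal (∫ s in (0 : ℝ)..t, h1NormSq (V s)) := by
    rw [intervalIntegral.integral_of_le ht.1, ← integral_Icc_eq_integral_Ioc,
      ofReal_integral_eq_lintegral_ofReal (hcont.integrableOn_compact isCompact_Icc)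
        (Eventually.of_forall fun s => h1NormSq_nonneg _)]
  have hE : ∀ s, 0 ≤ normSq (V s).1 + e (N s) := fun s => add_nonneg (normSq_nonneg _) (he.nonneg _)
  rw [hI, ← ENNReal.ofReal_add (hE t)
    (intervalIntegral.integral_nonneg ht.1 fun s _ => h1NormSq_nonneg _),
    ← ENNReal.ofReal_coe_nnreal, ← ENNReal.ofReal_mul C.coe_nonneg]
  refine ENNReal.ofReal_le_ofReal (le_trans ?_ (mul_le_mul_of_nonneg_right hC (hE 0)))
  rw [div_mul_eq_mul_div, le_div_iff₀' hk]
  exact h.estimate he ht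

/-! ### Difference quotients and the limit to the time derivative -/

section DiffQuot

variable {E : Type*} [NormedAddCommGroup E] [NormedSpace ℝ E] {f : ℝ → E} {f' : E} {T t : ℝ}
  {d : ℕ → ℝ}

lemma tendsto_diffQuot_right (hf : HasDerivWithinAt f f' (Icc 0 T) t) (hd : ∀ n, 0 < d n)
    (hd0 : Tendsto d atTop (𝓝 0)) (ht : 0 ≤ t) (htT : t < T) :
    Tendsto (fun n => (d n)⁻¹ • (f (t + d n) - f t)) atTop (𝓝 f') := by
  have hs := hasDerivWithinAt_iff_tendsto_slope.1 hf
  have hx : Tendsto (fun n => t + d n) atTop (𝓝[Icc 0 T \ {t}] t) := by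
    refine tendsto_nhdsWithin_iff.2 ⟨by simpa using hd0.const_add t, ?_⟩
    filter_upwards [hd0.eventually_lt_const (sub_pos.2 htT)] with n hn
    exact ⟨⟨by linarith [hd n], by linarith⟩, by simpa using (hd n).ne'⟩
  refine (hs.comp hx).congr fun n => ?_
  simp [slope_def_module]

/-- The backward quotient at `t` is the forward quotient evaluated at `t - d`, and it is kept in
that form to match `IsEvolution.diffQuot`. -/
lemma tendsto_diffQuot_left (hf : HasDerivWithinAt f f' (Icc 0 T) t) (hd : ∀ n, 0 < d n)
    (hd0 : Tendsto d atTop (𝓝 0)) (ht : 0 < t) (htT : t ≤ T) :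
    Tendsto (fun n => (d n)⁻¹ • (f (t - d n + d n) - f (t - d n))) atTop (𝓝 f') := by
  have hs := hasDerivWithinAt_iff_tendsto_slope.1 hf
  have hx : Tendsto (fun n => t - d n) atTop (𝓝[Icc 0 T \ {t}] t) := by
    refine tendsto_nhdsWithin_iff.2 ⟨by simpa using hd0.const_sub t, ?_⟩
    filter_upwards [hd0.eventually_lt_const ht] with n hn
    exact ⟨⟨by linarith, by linarith [hd n]⟩, by simpa using (hd n).ne'⟩
  refine (hs.comp hx).congr fun n => ?_
  simp only [Function.comp_apply, sub_add_cancel]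
  rw [slope_comm]
  simp [slope_def_module]

end DiffQuot

/-- The estimate for the time derivative of an evolution, obtained from the difference quotients. -/
lemma IsEvolution.estimate_deriv {c : Coeffs} {B : Fin 2 → ℝ} {T : ℝ} {V : ℝ → Field}
    {vt : ℝ → Fin 2 → L2} {𝒩 : ℝ → Field} (h : IsEvolution c B T V vt 𝒩) {e : Field → ℝ}
    {κ M : ℝ} (he : IsEnergy c B e κ M) {C : ℝ≥0}
    (hC : (c.ρp / 2 + (M ^ 2 / κ + κ / 4))
      / min (min (c.ρm / 2) (κ / 8)) (min c.μp c.μm / 5) ≤ C)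
    (hw : ∀ s ∈ Icc 0 T, ∀ i j, HasWeakPartial slab j ((V s).1 i) ((V s).2 i j))
    {t : ℝ} (ht0 : 0 < t) (htT : t ≤ T) :
    ENNReal.ofReal (normSq (vt t) + e (V t)) + dissipation vt t
      ≤ C * ENNReal.ofReal (normSq (vt 0) + e (V 0)) := by
  have ht : t ∈ Icc 0 T := ⟨ht0.le, htT⟩
  have h0 : (0 : ℝ) ∈ Icc 0 T := ⟨le_rfl, ht0.le.trans htT⟩
  -- The shift by 2 keeps each step strictly between 0 and `t`.
  set d : ℕ → ℝ := fun n => t / (n + 2) with hd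
  have hdpos : ∀ n, 0 < d n := fun n => by simp only [hd]; positivity
  have hdt : ∀ n, d n < t := fun n => div_lt_self ht0 (by linarith [n.cast_nonneg (α := ℝ)])
  have hd0 : Tendsto d atTop (𝓝 0) :=
    tendsto_const_nhds.div_atTop (tendsto_atTop_add_const_right _ _ tendsto_natCast_atTop_atTop)
  set Q : ℕ → ℝ → Field := fun n s => (d n)⁻¹ • (V (s + d n) - V s) with hQ
  set N : ℕ → ℝ → Field := fun n s => (d n)⁻¹ • (𝒩 (s + d n) - 𝒩 s) with hN
  have hevn := fun n => h.diffQuot (hdpos n)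
  -- The quotients live on `[0, T - d]` only. Evaluating at `t - d` stays inside this interval and
  -- gives the backward quotient at `t`, so the end point `t = T` is covered.
  have hmem : ∀ n, t - d n ∈ Icc 0 (T - d n) := fun n =>
    ⟨by linarith [hdt n], by linarith [ht.2]⟩
  have hest := fun n => (hevn n).estimate_ofReal he hC (hmem n)
  have hQ1 : ∀ n s, (Q n s).1 = (d n)⁻¹ • ((V (s + d n)).1 - (V s).1) := fun n s => rfl
  have hVr : ∀ s ∈ Icc 0 T, s < T → Tendsto (fun n => (Q n s).1) atTop (𝓝 (vt s)) :=
    fun s hs hsT => by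
      simp only [hQ1]
      exact tendsto_diffQuot_right (f := fun s => (V s).1) (h.deriv_V s hs) hdpos hd0 hs.1 hsT
  have hVl : Tendsto (fun n => (Q n (t - d n)).1) atTop (𝓝 (vt t)) := by
    simp only [hQ1]
    exact tendsto_diffQuot_left (f := fun s => (V s).1) (h.deriv_V t ht) hdpos hd0 ht0 htT
  have hNr : Tendsto (fun n => N n 0) atTop (𝓝 (V 0)) :=
    tendsto_diffQuot_right (h.deriv_N 0 h0) hdpos hd0 le_rfl (ht0.trans_le htT)
  have hNl : Tendsto (fun n => N n (t - d n)) atTop (𝓝 (V t)) :=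
    tendsto_diffQuot_left (h.deriv_N t ht) hdpos hd0 ht0 htT
  have hright : Tendsto (fun n => (C : ℝ≥0∞) * ENNReal.ofReal (normSq (Q n 0).1 + e (N n 0))) atTop
      (𝓝 (C * ENNReal.ofReal (normSq (vt 0) + e (V 0)))) :=
    ENNReal.Tendsto.const_mul (ENNReal.tendsto_ofReal
      (((continuous_normSq.tendsto _).comp (hVr 0 h0 (ht0.trans_le htT))).add
        ((he.cont.tendsto _).comp hNr))) (Or.inr ENNReal.coe_ne_top)
  have hleft : Tendsto (fun n => ENNReal.ofReal (normSq (Q n (t - d n)).1 + e (N n (t - d n))))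
      atTop (𝓝 (ENNReal.ofReal (normSq (vt t) + e (V t)))) :=
    ENNReal.tendsto_ofReal (((continuous_normSq.tendsto _).comp hVl).add
      ((he.cont.tendsto _).comp hNl))
  -- The intervals of integration vary with `n`; indicators put all integrals on the line, so that
  -- Fatou's lemma applies. Each `s < t` eventually lies in the interval, and the exceptional point
  -- `s = t` is null.
  set F : ℕ → ℝ → ℝ≥0∞ := fun n => (Icc 0 (t - d n)).indicator
    fun s => ENNReal.ofReal (h1NormSq (Q n s)) with hF
  have hFm : ∀ n, AEMeasurable (F n) := fun n => by
    refine (aemeasurable_indicator_iff measurableSet_Icc).2 ?_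
    refine ENNReal.measurable_ofReal.comp_aemeasurable (ContinuousOn.aemeasurable ?_ measurableSet_Icc)
    exact continuous_h1NormSq.comp_continuousOn
      ((hevn n).cont.mono (Icc_subset_Icc le_rfl (hmem n).2))
  have hdis : dissipation vt t ≤ liminf (fun n => ∫⁻ s in Icc 0 (t - d n),
      ENNReal.ofReal (h1NormSq (Q n s))) atTop := by
    have e1 : ∀ n, ∫⁻ s in Icc 0 (t - d n), ENNReal.ofReal (h1NormSq (Q n s)) = ∫⁻ s, F n s :=
      fun n => (lintegral_indicator measurableSet_Icc _).symm
    simp only [e1]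
    refine le_trans ?_ (lintegral_liminf_le' hFm)
    rw [dissipation, ← lintegral_indicator measurableSet_Icc]
    refine lintegral_mono_ae ?_
    filter_upwards [Measure.ae_ne volume t] with s hst
    by_cases hs : s ∈ Icc 0 t
    swap
    · rw [indicator_of_notMem hs]; exact zero_le
    have hlt : s < t := lt_of_le_of_ne hs.2 hst
    have hev1 : ∀ᶠ n in atTop, s ≤ t - d n := by
      filter_upwards [hd0.eventually_lt_const (sub_pos.2 hlt)] with n hn
      linarith
    have e2 : liminf (fun n => F n s) atTop
        = liminf (fun n => ENNReal.ofReal (h1NormSq (Q n s))) atTop :=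
      liminf_congr (hev1.mono fun n hn =>
        indicator_of_mem (s := Icc 0 (t - d n)) ⟨hs.1, hn⟩ _)
    have hsT : s ∈ Icc 0 T := ⟨hs.1, hs.2.trans ht.2⟩
    rw [indicator_of_mem hs, e2]
    refine h1Sq_le_liminf (hVr s hsT (hlt.trans_le htT)) (hev1.mono fun n hn i j => ?_)
    exact (hw _ ⟨by linarith [hs.1, hdpos n], by linarith [ht.2]⟩ i j).smul_sub (hw s hsT i j) _
  calc ENNReal.ofReal (normSq (vt t) + e (V t)) + dissipation vt t
      ≤ liminf (fun n => ENNReal.ofReal (normSq (Q n (t - d n)).1 + e (N n (t - d n)))) atTop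
        + liminf (fun n => ∫⁻ s in Icc 0 (t - d n), ENNReal.ofReal (h1NormSq (Q n s))) atTop :=
        add_le_add hleft.liminf_eq.ge hdis
    _ ≤ _ := liminf_add_le _ _
    _ ≤ _ := liminf_le_liminf (Eventually.of_forall hest)
    _ = _ := hright.liminf_eq

/-- Both estimates, for an energy functional `E` given by `e` on `H¹` fields. -/
theorem IsSolution.estimates {c : Coeffs} {B : Fin 2 → ℝ} {e : Field → ℝ} {κ M : ℝ}
    (he : IsEnergy c B e κ M) {E : (Fin 2 → L2) → (Fin 2 → L2) → ℝ≥0∞}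
    (hE : ∀ (w : Fin 2 → L2) {u : Fin 2 → L2} {D : Fin 2 → Fin 2 → L2},
      (∀ i j, HasWeakPartial slab j (u i) (D i j)) →
        E w u = ENNReal.ofReal (normSq w + e (u, D))) {C : ℝ≥0} (hC1 : 1 ≤ C)
    (hC : (c.ρp / 2 + (M ^ 2 / κ + κ / 4))
      / min (min (c.ρm / 2) (κ / 8)) (min c.μp c.μm / 5) ≤ C) {T : ℝ} (hT : 0 < T)
    {v vt η : ℝ → Fin 2 → L2} {q : ℝ → ℝ × ℝ → ℝ} (h : IsSolution c B T v vt η q)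
    {t : ℝ} (ht : t ∈ Icc 0 T) :
    E (vt t) (v t) + dissipation vt t ≤ C * E (vt 0) (v 0) ∧
      E (v t) (η t) + dissipation v t ≤ C * E (v 0) (η 0) := by
  obtain ⟨DV, DN, hev, hDV, hDN⟩ := h.exists_evolution hT.le
  have h0 : (0 : ℝ) ∈ Icc 0 T := ⟨le_rfl, hT.le⟩
  constructor
  swap
  · have hdis : dissipation v t = ∫⁻ s in Icc 0 t, ENNReal.ofReal (h1NormSq (v s, DV s)) :=
      setLIntegral_congr_fun measurableSet_Icc fun s hs =>
        sum_h1Sq_eq (hDV s ⟨hs.1, hs.2.trans ht.2⟩)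
    rw [hdis, hE _ (hDN t ht), hE _ (hDN 0 h0)]
    exact hev.estimate_ofReal he hC ht
  -- At `t = 0` there is no room for a difference quotient. There the dissipation vanishes and `1 ≤
  -- C` is enough.
  rcases ht.1.eq_or_lt with rfl | ht0
  · have hz : dissipation vt 0 = 0 := by simp [dissipation]
    rw [hz, add_zero]
    exact le_mul_of_one_le_left zero_le (by exact_mod_cast hC1)
  rw [hE _ (hDV t ht), hE _ (hDV 0 h0)]
  exact hev.estimate_deriv he hC hDV ht0 ht.2

end RayleighTaylorMHD

end

theorem theorem2p4 (c : RayleighTaylorMHD.Coeffs) (B : ℝ)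
    (hB : RayleighTaylorMHD.criticalNumber c < |B|) :
    ∃ C : NNReal,
      -- vertical magnetic vector
      (∀ (T : ℝ) (v vt η : ℝ → Fin 2 → RayleighTaylorMHD.L2) (q : ℝ → ℝ × ℝ → ℝ), 0 < T →
        RayleighTaylorMHD.IsSolution c ![0, B] T v vt η q →
        (∀ t ∈ Set.Icc 0 T,
          RayleighTaylorMHD.verticalEnergy (vt t) (v t) + RayleighTaylorMHD.dissipation vt t
            ≤ C * RayleighTaylorMHD.verticalEnergy (vt 0) (v 0)) ∧
        ((∀ i, RayleighTaylorMHD.HasLowerTrace (-1) 1 (η 0 i) 0 ∧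
            RayleighTaylorMHD.HasUpperTrace (-1) 1 (η 0 i) 0) →
          ∀ t ∈ Set.Icc 0 T,
            RayleighTaylorMHD.verticalEnergy (v t) (η t) + RayleighTaylorMHD.dissipation v t
              ≤ C * RayleighTaylorMHD.verticalEnergy (v 0) (η 0))) ∧
      -- horizontal magnetic vector
      (∀ (T : ℝ) (v vt η : ℝ → Fin 2 → RayleighTaylorMHD.L2) (q : ℝ → ℝ × ℝ → ℝ), 0 < T →
        RayleighTaylorMHD.IsSolution c ![B, 0] T v vt η q →
        (∀ t ∈ Set.Icc 0 T,
          RayleighTaylorMHD.horizontalEnergy (vt t) (v t) + RayleighTaylorMHD.dissipation vt t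
            ≤ C * RayleighTaylorMHD.horizontalEnergy (vt 0) (v 0)) ∧
        ((∀ᵐ x ∂(MeasureTheory.volume.restrict RayleighTaylorMHD.slab),
            RayleighTaylorMHD.weakPartial RayleighTaylorMHD.slab 0 (η 0 0) x
              + RayleighTaylorMHD.weakPartial RayleighTaylorMHD.slab 1 (η 0 1) x = 0) →
          ∀ t ∈ Set.Icc 0 T,
            RayleighTaylorMHD.horizontalEnergy (v t) (η t) + RayleighTaylorMHD.dissipation v t
              ≤ C * RayleighTaylorMHD.horizontalEnergy (v 0) (η 0))) := by
  have hB' := RayleighTaylorMHD.half_gJump_lt_sq hB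
  have hv := RayleighTaylorMHD.isEnergy_vertSq hB'
  have hh := RayleighTaylorMHD.isEnergy_horSq hB'
  -- The constant of the energy estimate involves only the coefficients and, through `κ` and `M`,
  -- the number `B`. It is raised to at least 1 to cover the initial time.
  have bound : ∀ κ M : ℝ, ∃ C : NNReal, 1 ≤ C ∧ (c.ρp / 2 + (M ^ 2 / κ + κ / 4))
      / min (min (c.ρm / 2) (κ / 8)) (min c.μp c.μm / 5) ≤ C := fun κ M =>
    ⟨max 1 (Real.toNNReal _), le_max_left _ _,
      (Real.le_coe_toNNReal _).trans (NNReal.coe_le_coe.2 (le_max_right _ _))⟩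
  obtain ⟨C₁, h₁, h₁'⟩ := bound ((B ^ 2 - c.gJump / 2) / 5) (2 * B ^ 2 + 2 * c.gJump)
  obtain ⟨C₂, -, h₂'⟩ := bound ((B ^ 2 - c.gJump / 2) / 6) (2 * B ^ 2 + 2 * c.gJump)
  have hC := h₁.trans (le_max_left C₁ C₂)
  have l₁ := h₁'.trans (NNReal.coe_le_coe.2 (le_max_left C₁ C₂))
  have l₂ := h₂'.trans (NNReal.coe_le_coe.2 (le_max_right C₁ C₂))
  refine ⟨max C₁ C₂, fun T v vt η q hT h => ?_, fun T v vt η q hT h => ?_⟩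
  · have est := fun t ht => h.estimates (t := t) hv RayleighTaylorMHD.verticalEnergy_eq hC l₁ hT ht
    exact ⟨fun t ht => (est t ht).1, fun _ t ht => (est t ht).2⟩
  · have est := fun t ht => h.estimates (t := t) hh RayleighTaylorMHD.horizontalEnergy_eq hC l₂ hT ht
    exact ⟨fun t ht => (est t ht).1, fun _ t ht => (est t ht).2⟩
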